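/- Let $(\mathcal C,\otimes,\mathbf 1,\Psi)$ be a braided monoidal category in which idempotents split, and let $\overline{\mathcal C}$ be the same monoidal category with the inverse braiding $\overline\Psi_{X,Y}=(\Psi_{Y,X})^{-1}$. Hopf algebras are assumed to have invertible antipode. **Definitions.** A *braided quantum group* (quasitriangular Hopf algebra) $(A,\overline A,\mathcal R)$ in $\mathcal C$ consists of a Hopf algebra $A=(A,m,\eta,\Delta,\varepsilon,S)$ in $\mathcal C$, a Hopf algebra $\overline A=(A,m,\eta,\overline\Delta,\varepsilon,\overline S)$ in $\overline{\mathcal C}$ with the same algebra structure and counit, and a convolution invertible $\mathcal R:\mathbf 1\to A\otimes A$ that is a bialgebra copairing $\mathbf 1\to\overline A_{\rm op}\otimes A$, where $\overline A_{\rm op}$ has comultiplication $\Psi_{A,A}\circ\overline\Delta$; that is, $$((\Psi\overline\Delta)\otimes{\rm id})\mathcal R=({\rm id}\otimes{\rm id}\otimes m)({\rm id}\otimes\mathcal R\otimes{\rm id})\mathcal R,\quad ({\rm id}\otimes\Delta)\mathcal R=(m\otimes{\rm id}\otimes{\rm id})({\rm id}\otimes\mathcal R\otimes{\rm id})\mathcal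 R,\quad (\varepsilon\otimes{\rm id})\mathcal R=\eta=({\rm id}\otimes\varepsilon)\mathcal R,$$ such that $(\Psi_{A,A}\circ\overline\Delta)\cdot\mathcal R=\mathcal R\cdot\Delta$ for the convolution product formed in the tensor product algebra $A\otimes A$ of $\mathcal C$. $\mathcal C_{\mathcal O(A,\overline A)}$ is the category of right $A$-modules $(X,\mu)$ in $\mathcal C$ with $({\rm id}\otimes\mu)(\Psi_{X,A}\otimes{\rm id})({\rm id}\otimes\Delta)=({\rm id}\otimes\mu)((\Psi_{A,X})^{-1}\otimes{\rm id})({\rm id}\otimes\overline\Delta)$, with module morphisms and the diagonal action on tensor products. With the coaction $\nu_X=(\mu_X\otimes{\rm id}_A)({\rm id}_X\otimes\mathcal R)$ it is braided by $({\rm id}_Y\otimes\mu_X)(\Psi_{X,Y}\otimes{\rm id}_A)({\rm id}_X\otimes\nu_Y)$. The inverse braiding is given by the same formula in $\overline{\mathcal C}$, with the coactions $\overline\nu_X=(\mu_X\otimes{\rm id}_A)({\rm id}_X\otimes(\Psi_{A,A})^{-1}\mathcal R^{-1})$, where $\mathcal R^{-1}$ is the convolution inverse. For a braided quantum group $(B,\overline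 B,\mathcal R_B)$ in $\mathcal C_{\mathcal O(A,\overline A)}$, the bosonization $(A\ltimes B,\overline A\ltimes\overline B,\mathcal R_{A\ltimes B})$ has underlying object $A\otimes B$, unit $\eta_A\otimes\eta_B$, counit $\varepsilon_A\otimes\varepsilon_B$, cross product multiplication $$(m_A\otimes m_B)\bigl({\rm id}_A\otimes({\rm id}_A\otimes\mu_B)(\Psi_{B,A}\otimes{\rm id}_A)({\rm id}_B\otimes\Delta_A)\otimes{\rm id}_B\bigr),$$ cross coproduct comultiplication $$\bigl({\rm id}_A\otimes({\rm id}_B\otimes m_A)(\Psi_{A,B}\otimes{\rm id}_A)({\rm id}_A\otimes\nu_B)\otimes{\rm id}_B\bigr)(\Delta_A\otimes\Delta_B)$$ for $A\ltimes B$, the same formula in $\overline{\mathcal C}$ with $\overline\Delta_A,\overline\Delta_B,\overline\nu_B$ and $(\Psi_{B,A})^{-1}$ for $\overline A\ltimes\overline B$, and $$\mathcal R_{A\ltimes B}=(m_{A\ltimes B}\otimes m_{A\ltimes B})(\iota_B\otimes(\iota_A\otimes\iota_A)\mathcal R_A\otimes\iota_B)\mathcal R_B,\qquad \iota_A={\rm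 id}_A\otimes\eta_B,\ \ \iota_B=\eta_A\otimes{\rm id}_B.$$ A *quantum group projection* of $(H,\overline H,\mathcal R_H)$ onto $(A,\overline A,\mathcal R_A)$ consists of morphisms $i:A\to H$, $p:H\to A$ with $p\circ i={\rm id}_A$, each of which is a bialgebra morphism both between $A$ and $H$ and between $\overline A$ and $\overline H$, such that $m_H(i\,S_A\,p\otimes{\rm id})\Delta_H=m_H(i\,\overline S_A\,p\otimes{\rm id})\overline\Delta_H$, $({\rm id}_H\otimes p)\mathcal R_H=(i\otimes{\rm id}_A)\mathcal R_A$ and $(p\otimes{\rm id}_H)\mathcal R_H=({\rm id}_A\otimes i)\mathcal R_A$. **Theorem (Radford–Majid criterion for braided quantum groups).** Let $(i,p)$ be a quantum group projection of $(H,\overline H,\mathcal R_H)$ onto $(A,\overline A,\mathcal R_A)$ in $\mathcal C$. Then there exist a braided quantum group $(B,\overline B,\mathcal R_B)$ in $\mathcal C_{\mathcal O(A,\overline A)}$ and an isomorphism $\varphi:H\to A\otimes B$ in $\mathcal C$ which is an isomorphism of braided quantum groups $$(H,\overline H,\mathcal R_H)\cong(A\ltimes B,\overline A\ltimes\overline B,\mathcal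 R_{A\ltimes B}),$$ i.e. it preserves multiplication, unit, counit, both comultiplications and the R-matrix, and which identifies the projection with the canonical one: $\varphi\circ i=\iota_A$ and $({\rm id}_A\otimes\varepsilon_B)\circ\varphi=p$. -/

import Mathlib

open CategoryTheory MonoidalCategory

universe v u

namespace BraidedQG

variable {C : Type u} [Category.{v} C] [MonoidalCategory C]

/-- Apply `s` to the two inner factors of a fourfold tensor product. -/
def mid {X P Q P' Q' Y : C} (s : P ⊗ Q ⟶ P' ⊗ Q') :
    (X ⊗ P) ⊗ (Q ⊗ Y) ⟶ (X ⊗ P') ⊗ (Q' ⊗ Y) :=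
  (α_ X P (Q ⊗ Y)).hom ≫ X ◁ ((α_ P Q Y).inv ≫ s ▷ Y ≫ (α_ P' Q' Y).hom) ≫
    (α_ X P' (Q' ⊗ Y)).inv

/-- `(f ⊗ g) ∘ (id ⊗ t ⊗ id) ∘ r` for `r : 1 → P ⊗ Q` and `t : 1 → P' ⊗ Q'`: the element
`t` is inserted between the two legs of `r`, and neighbouring legs are then combined by
`f` and `g`. -/
def nest {P Q P' Q' Y Z : C} (r : 𝟙_ C ⟶ P ⊗ Q) (t : 𝟙_ C ⟶ P' ⊗ Q')
    (f : P ⊗ P' ⟶ Y) (g : Q' ⊗ Q ⟶ Z) : 𝟙_ C ⟶ Y ⊗ Z :=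
  r ≫ P ◁ ((λ_ Q).inv ≫ t ▷ Q ≫ (α_ P' Q' Q).hom) ≫ (α_ P P' (Q' ⊗ Q)).inv ≫ (f ⊗ₘ g)

/-- The structure morphisms `(m, η, Δ, Δ̄, ε, R)` carried by a triple `(X, X̄, R)`: two
coalgebra structures with a common counit on one algebra, and a morphism `R : 1 → X ⊗ X`.
No axiom is imposed here. -/
structure QTData (X : C) where
  mul : X ⊗ X ⟶ X
  one : 𝟙_ C ⟶ X
  comul : X ⟶ X ⊗ X
  comulBar : X ⟶ X ⊗ X
  counit : X ⟶ 𝟙_ C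
  R : 𝟙_ C ⟶ X ⊗ X

/-- `f` is a morphism of bialgebras both from `X` to `Y` and from `X̄` to `Ȳ`. -/
structure QTData.IsBialgHom {X Y : C} (d : QTData X) (e : QTData Y) (f : X ⟶ Y) : Prop where
  mul : d.mul ≫ f = (f ⊗ₘ f) ≫ e.mul
  one : d.one ≫ f = e.one
  comul : f ≫ e.comul = d.comul ≫ (f ⊗ₘ f)
  comulBar : f ≫ e.comulBar = d.comulBar ≫ (f ⊗ₘ f)
  counit : f ≫ e.counit = d.counit

variable [BraidedCategory C]

/-- The product `m_{X ⊗ X} ∘ (f ⊗ g)`, where `m_{X ⊗ X} = (m ⊗ m) ∘ (id ⊗ Ψ ⊗ id)` is the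
multiplication of the tensor product algebra. -/
def convMul {X Y Z : C} (m : X ⊗ X ⟶ X) (f : Y ⟶ X ⊗ X) (g : Z ⟶ X ⊗ X) : Y ⊗ Z ⟶ X ⊗ X :=
  (f ⊗ₘ g) ≫ tensorμ X X X X ≫ (m ⊗ₘ m)

/-- A quasitriangular Hopf algebra `(X, X̄, R)` in the braided category `C`: a Hopf algebra `X` in
`C` and a Hopf algebra `X̄` in `C̄` (the category `C` with the inverse braiding), both with
invertible antipode, which have the same multiplication, unit and counit, and an
R-matrix `R`. The opposite bialgebra `X̄_op` in `C` has the comultiplication `Ψ ∘ Δ̄`. The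
(unique) convolution inverse of `R` is recorded as data. -/
structure QuantumGroup (X : C) where
  hopf : HopfObj X
  hopfBar : @HopfObj C _ _ (reverseBraiding C) X
  mul_bar : hopfBar.mul = hopf.mul
  one_bar : hopfBar.one = hopf.one
  counit_bar : hopfBar.counit = hopf.counit
  isIso_antipode : IsIso hopf.antipode
  isIso_antipode_bar : IsIso hopfBar.antipode
  R : 𝟙_ C ⟶ X ⊗ X
  Rinv : 𝟙_ C ⟶ X ⊗ X
  /-- `R : 1 → X̄_op ⊗ X` is a bialgebra copairing (this and the next three fields). -/
  R_comul_left : R ≫ (hopfBar.comul ≫ (β_ X X).hom) ▷ X = nest R R (𝟙 (X ⊗ X)) hopf.mul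
  R_comul_right : R ≫ X ◁ hopf.comul = nest R R hopf.mul (𝟙 (X ⊗ X))
  R_counit_left : R ≫ hopf.counit ▷ X = hopf.one ≫ (λ_ X).inv
  R_counit_right : R ≫ X ◁ hopf.counit = hopf.one ≫ (ρ_ X).inv
  R_mul_Rinv : (λ_ (𝟙_ C)).inv ≫ convMul hopf.mul R Rinv =
    (λ_ (𝟙_ C)).inv ≫ (hopf.one ⊗ₘ hopf.one)
  Rinv_mul_R : (λ_ (𝟙_ C)).inv ≫ convMul hopf.mul Rinv R =
    (λ_ (𝟙_ C)).inv ≫ (hopf.one ⊗ₘ hopf.one)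
  /-- `(Ψ ∘ Δ̄) · R = R · Δ`. -/
  quasitriangular : (ρ_ X).inv ≫ convMul hopf.mul (hopfBar.comul ≫ (β_ X X).hom) R =
    (λ_ X).inv ≫ convMul hopf.mul R hopf.comul

namespace QuantumGroup

variable {X : C} (Q : QuantumGroup X)

abbrev mul : X ⊗ X ⟶ X := Q.hopf.mul

abbrev one : 𝟙_ C ⟶ X := Q.hopf.one

abbrev comul : X ⟶ X ⊗ X := Q.hopf.comul

abbrev comulBar : X ⟶ X ⊗ X := Q.hopfBar.comul

abbrev counit : X ⟶ 𝟙_ C := Q.hopf.counit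

abbrev S : X ⟶ X := Q.hopf.antipode

abbrev Sbar : X ⟶ X := Q.hopfBar.antipode

/-- The structure morphisms of a quasitriangular Hopf algebra. -/
@[simps] def toQTData : QTData X where
  mul := Q.mul
  one := Q.one
  comul := Q.comul
  comulBar := Q.comulBar
  counit := Q.counit
  R := Q.R

end QuantumGroup

/-- Moving an algebra past a module: `(id ⊗ μ) ∘ (Ψ ⊗ id) ∘ (id ⊗ Δ) : X ⊗ A → A ⊗ X`. -/
def past {A X : C} (Δ : A ⟶ A ⊗ A) (act : X ⊗ A ⟶ X) : X ⊗ A ⟶ A ⊗ X :=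
  X ◁ Δ ≫ (α_ X A A).inv ≫ (β_ X A).hom ▷ A ≫ (α_ A X A).hom ≫ A ◁ act

/-- The same with the inverse braiding of `C`, that is, the morphism `past` of the category `C̄`. -/
def pastBar {A X : C} (Δ : A ⟶ A ⊗ A) (act : X ⊗ A ⟶ X) : X ⊗ A ⟶ A ⊗ X :=
  @past C _ _ (reverseBraiding C) A X Δ act

theorem pastBar_eq {A X : C} (Δ : A ⟶ A ⊗ A) (act : X ⊗ A ⟶ X) : pastBar Δ act =
    X ◁ Δ ≫ (α_ X A A).inv ≫ (β_ A X).inv ▷ A ≫ (α_ A X A).hom ≫ A ◁ act := rfl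

/-- The action of the tensor product algebra `A ⊗ A` on a tensor product of `A`-modules. -/
def tensorAct {A X Y : C} (aX : X ⊗ A ⟶ X) (aY : Y ⊗ A ⟶ Y) :
    (X ⊗ Y) ⊗ (A ⊗ A) ⟶ X ⊗ Y :=
  tensorμ X Y A A ≫ (aX ⊗ₘ aY)

/-- The diagonal action
`(μ ⊗ μ) ∘ (id ⊗ Ψ ⊗ id) ∘ (id ⊗ id ⊗ Δ)` on a tensor product of modules. -/
def diagAct {A X Y : C} (Δ : A ⟶ A ⊗ A) (aX : X ⊗ A ⟶ X) (aY : Y ⊗ A ⟶ Y) :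
    (X ⊗ Y) ⊗ A ⟶ X ⊗ Y :=
  (X ⊗ Y) ◁ Δ ≫ tensorAct aX aY

section lemmas

variable {A X Y Z : C}

theorem diagAct_eq (Δ : A ⟶ A ⊗ A) (aX : X ⊗ A ⟶ X) (aY : Y ⊗ A ⟶ Y) :
    diagAct Δ aX aY = (α_ X Y A).hom ≫ X ◁ past Δ aY ≫ (α_ X A Y).inv ≫ aX ▷ Y := by
  simp only [diagAct, tensorAct, past, tensorμ, MonoidalCategory.tensorHom_def']
  monoidal

theorem past_diagAct (Δ : A ⟶ A ⊗ A) (h : Δ ≫ A ◁ Δ = Δ ≫ Δ ▷ A ≫ (α_ A A A).hom)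
    (aX : X ⊗ A ⟶ X) (aY : Y ⊗ A ⟶ Y) :
    past Δ (diagAct Δ aX aY) = (α_ X Y A).hom ≫ X ◁ past Δ aY ≫ (α_ X A Y).inv ≫
      past Δ aX ▷ Y ≫ (α_ A X Y).hom := by
  have hN : (β_ Y A).hom ≫ Δ ▷ Y =
      Y ◁ Δ ≫ (α_ _ _ _).inv ≫ (β_ Y A).hom ▷ A ≫ (α_ _ _ _).hom ≫ A ◁ (β_ Y A).hom ≫
        (α_ _ _ _).inv := by
    rw [← BraidedCategory.braiding_naturality_right, BraidedCategory.braiding_tensor_right_hom]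
  simp only [past, diagAct_eq, BraidedCategory.braiding_tensor_left_hom]
  calc
    _ = 𝟙 _ ⊗≫ X ◁ Y ◁ Δ ⊗≫ X ◁ (β_ Y A).hom ▷ A ⊗≫ ((β_ X A).hom ▷ (Y ⊗ A) ≫ (A ⊗ X) ◁ (Y ◁ Δ)) ⊗≫
        A ◁ X ◁ (β_ Y A).hom ▷ A ⊗≫ A ◁ X ◁ A ◁ aY ⊗≫ A ◁ aX ▷ Y := by
      monoidal
    _ = 𝟙 _ ⊗≫ X ◁ Y ◁ Δ ⊗≫ X ◁ ((β_ Y A).hom ▷ A ≫ (A ⊗ Y) ◁ Δ) ⊗≫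
        ((β_ X A).hom ▷ ((Y ⊗ A) ⊗ A) ≫ (A ⊗ X) ◁ ((β_ Y A).hom ▷ A)) ⊗≫
        A ◁ X ◁ A ◁ aY ⊗≫ A ◁ aX ▷ Y := by
      rw [← whisker_exchange]
      monoidal
    _ = 𝟙 _ ⊗≫ X ◁ Y ◁ Δ ⊗≫ X ◁ (Y ⊗ A) ◁ Δ ⊗≫ X ◁ (β_ Y A).hom ▷ (A ⊗ A) ⊗≫
        X ◁ A ◁ (β_ Y A).hom ▷ A ⊗≫ ((β_ X A).hom ▷ (A ⊗ Y ⊗ A) ≫ (A ⊗ X) ◁ (A ◁ aY)) ⊗≫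
        A ◁ aX ▷ Y := by
      rw [← whisker_exchange, ← whisker_exchange]
      monoidal
    _ = 𝟙 _ ⊗≫ X ◁ Y ◁ (Δ ≫ A ◁ Δ) ⊗≫ X ◁ (β_ Y A).hom ▷ (A ⊗ A) ⊗≫
        X ◁ A ◁ (β_ Y A).hom ▷ A ⊗≫ X ◁ (A ⊗ A) ◁ aY ⊗≫ (β_ X A).hom ▷ (A ⊗ Y) ⊗≫
        A ◁ aX ▷ Y := by
      rw [← whisker_exchange]
      monoidal
    _ = 𝟙 _ ⊗≫ X ◁ Y ◁ Δ ⊗≫ X ◁ ((β_ Y A).hom ≫ Δ ▷ Y) ▷ A ⊗≫ X ◁ (A ⊗ A) ◁ aY ⊗≫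
        (β_ X A).hom ▷ (A ⊗ Y) ⊗≫ A ◁ aX ▷ Y := by
      rw [h, hN]
      monoidal
    _ = 𝟙 _ ⊗≫ X ◁ Y ◁ Δ ⊗≫ X ◁ (β_ Y A).hom ▷ A ⊗≫ X ◁ (Δ ▷ (Y ⊗ A) ≫ (A ⊗ A) ◁ aY) ⊗≫
        (β_ X A).hom ▷ (A ⊗ Y) ⊗≫ A ◁ aX ▷ Y := by
      monoidal
    _ = _ := by
      rw [← whisker_exchange]
      monoidal

theorem past_counit (Δ : A ⟶ A ⊗ A) (ε : A ⟶ 𝟙_ C) (h : Δ ≫ ε ▷ A = (λ_ A).inv)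
    (aX : X ⊗ A ⟶ X) : past Δ aX ≫ ε ▷ X = aX ≫ (λ_ X).inv := by
  have hN : (β_ X A).hom ≫ ε ▷ X = X ◁ ε ≫ (ρ_ X).hom ≫ (λ_ X).inv := by
    rw [← BraidedCategory.braiding_naturality_right, braiding_tensorUnit_right]
  calc
    _ = X ◁ Δ ⊗≫ (β_ X A).hom ▷ A ⊗≫ (A ◁ aX ≫ ε ▷ X) := by
      simp only [past]
      monoidal
    _ = X ◁ Δ ⊗≫ ((β_ X A).hom ≫ ε ▷ X) ▷ A ⊗≫ _ ◁ aX := by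
      rw [whisker_exchange]
      monoidal
    _ = X ◁ (Δ ≫ ε ▷ A) ⊗≫ aX ⊗≫ 𝟙 _ := by
      rw [hN]
      monoidal
    _ = _ := by
      rw [h]
      monoidal

theorem past_unit (Δ : A ⟶ A ⊗ A) (ε : A ⟶ 𝟙_ C) (h : Δ ≫ A ◁ ε = (ρ_ A).inv) :
    past Δ ((λ_ A).hom ≫ ε) = (λ_ A).hom ≫ (ρ_ A).inv := by
  calc
    _ = 𝟙_ C ◁ (Δ ≫ A ◁ ε) ⊗≫ 𝟙 _ := by
      simp only [past, braiding_tensorUnit_left]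
      monoidal
    _ = _ := by
      rw [h]
      monoidal

theorem past_natural (Δ : A ⟶ A ⊗ A) (aX : X ⊗ A ⟶ X) (aY : Y ⊗ A ⟶ Y) (f : X ⟶ Y)
    (h : aX ≫ f = f ▷ A ≫ aY) : f ▷ A ≫ past Δ aY = past Δ aX ≫ A ◁ f := by
  simp only [past, Category.assoc, ← MonoidalCategory.whiskerLeft_comp, h]
  have h2 : f ▷ A ▷ A ≫ (β_ Y A).hom ▷ A = (β_ X A).hom ▷ A ≫ (A ◁ f) ▷ A := by
    rw [← comp_whiskerRight, BraidedCategory.braiding_naturality_left, comp_whiskerRight]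
  rw [← whisker_exchange_assoc]
  simp [reassoc_of% h2]

theorem tensorAct_mul (m : A ⊗ A ⟶ A) (aX : X ⊗ A ⟶ X) (aY : Y ⊗ A ⟶ Y)
    (hX : X ◁ m ≫ aX = (α_ X A A).inv ≫ aX ▷ A ≫ aX)
    (hY : Y ◁ m ≫ aY = (α_ Y A A).inv ≫ aY ▷ A ≫ aY) :
    (X ⊗ Y) ◁ (tensorμ A A A A ≫ (m ⊗ₘ m)) ≫ tensorAct aX aY =
      (α_ (X ⊗ Y) (A ⊗ A) (A ⊗ A)).inv ≫ tensorAct aX aY ▷ (A ⊗ A) ≫ tensorAct aX aY := by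
  rw [Iso.eq_inv_comp]
  simp only [tensorAct, MonoidalCategory.whiskerLeft_comp, comp_whiskerRight, Category.assoc]
  rw [tensorμ_natural_left_assoc, tensorμ_natural_right_assoc]
  simp only [tensorHom_comp_tensorHom]
  rw [hX, hY, ← tensorHom_comp_tensorHom, ← tensor_associativity_assoc]
  simp only [tensorHom_comp_tensorHom, Iso.hom_inv_id_assoc]

theorem tensorAct_convMul (m : A ⊗ A ⟶ A) (aX : X ⊗ A ⟶ X) (aY : Y ⊗ A ⟶ Y)
    (hX : X ◁ m ≫ aX = (α_ X A A).inv ≫ aX ▷ A ≫ aX)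
    (hY : Y ◁ m ≫ aY = (α_ Y A A).inv ≫ aY ▷ A ≫ aY) {U V : C}
    (f : U ⟶ A ⊗ A) (g : V ⟶ A ⊗ A) :
    (X ⊗ Y) ◁ convMul m f g ≫ tensorAct aX aY =
      (α_ (X ⊗ Y) U V).inv ≫ ((X ⊗ Y) ◁ f ≫ tensorAct aX aY) ▷ V ≫
        (X ⊗ Y) ◁ g ≫ tensorAct aX aY := by
  have key := tensorAct_mul m aX aY hX hY
  simp only [convMul]
  rw [MonoidalCategory.whiskerLeft_comp, Category.assoc, key, MonoidalCategory.tensorHom_def f g,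
    comp_whiskerRight, Category.assoc, ← whisker_exchange_assoc]
  monoidal

theorem tensorAct_one (η : 𝟙_ C ⟶ A) (aX : X ⊗ A ⟶ X) (aY : Y ⊗ A ⟶ Y)
    (hX : X ◁ η ≫ aX = (ρ_ X).hom) (hY : Y ◁ η ≫ aY = (ρ_ Y).hom) :
    (X ⊗ Y) ◁ ((λ_ (𝟙_ C)).inv ≫ (η ⊗ₘ η)) ≫ tensorAct aX aY = (ρ_ (X ⊗ Y)).hom := by
  simp only [tensorAct, MonoidalCategory.whiskerLeft_comp, Category.assoc]
  rw [tensorμ_natural_right_assoc, tensorHom_comp_tensorHom, hX, hY, ← tensor_right_unitality]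

theorem tensorAct_braiding (aX : X ⊗ A ⟶ X) (aY : Y ⊗ A ⟶ Y) :
    @tensorAct C _ _ (reverseBraiding C) A X Y aX aY ≫ (β_ X Y).hom =
      (β_ X Y).hom ▷ (A ⊗ A) ≫ (Y ⊗ X) ◁ (β_ A A).hom ≫ tensorAct aY aX := by
  have h : (β_ A Y).inv ▷ A ≫ (β_ A Y).hom ▷ A = 𝟙 _ := by
    rw [← comp_whiskerRight, Iso.inv_hom_id, id_whiskerRight]
  have h1 : @tensorμ C _ _ (reverseBraiding C) X Y A A ≫ (β_ (X ⊗ A) (Y ⊗ A)).hom =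
      (β_ X Y).hom ▷ (A ⊗ A) ≫ (Y ⊗ X) ◁ (β_ A A).hom ≫ tensorμ Y X A A := by
    rw [BraidedCategory.braiding_tensor_left_hom, BraidedCategory.braiding_tensor_right_hom,
      BraidedCategory.braiding_tensor_right_hom X]
    calc
      _ = 𝟙 _ ⊗≫ X ◁ ((β_ A Y).inv ▷ A ≫ (β_ A Y).hom ▷ A) ⊗≫
          ((X ⊗ Y) ◁ (β_ A A).hom ≫ (β_ X Y).hom ▷ (A ⊗ A)) ⊗≫ Y ◁ (β_ X A).hom ▷ A ⊗≫ 𝟙 _ := by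
        dsimp only [tensorμ, Iso.symm_hom]
        monoidal
      _ = _ := by
        rw [h, whisker_exchange]
        dsimp only [tensorμ]
        monoidal
  dsimp only [tensorAct]
  rw [Category.assoc, BraidedCategory.braiding_naturality, reassoc_of% h1]

end lemmas

/-- The objects of the category `C_{O(A, Ā)}`: right `A`-modules on which `Δ` with the braiding and
`Δ̄` with the inverse braiding of `C` act in the same way. -/
structure ModuleO {A : C} (Q : QuantumGroup A) where
  X : C
  act : X ⊗ A ⟶ X
  act_one : X ◁ Q.one ≫ act = (ρ_ X).hom
  act_mul : X ◁ Q.mul ≫ act = (α_ X A A).inv ≫ act ▷ A ≫ act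
  compatible : past Q.comul act = pastBar Q.comulBar act

namespace ModuleO

variable {A : C} {Q : QuantumGroup A}

/-- The morphisms of `C_{O(A, Ā)}` are the morphisms of right `A`-modules. -/
@[ext]
structure Hom (M N : ModuleO Q) where
  hom : M.X ⟶ N.X
  linear : M.act ≫ hom = hom ▷ A ≫ N.act

@[simps]
instance : Category (ModuleO Q) where
  Hom M N := Hom M N
  id M := ⟨𝟙 M.X, by simp⟩
  comp f g := ⟨f.hom ≫ g.hom, by
    rw [← Category.assoc, f.linear, Category.assoc, g.linear, comp_whiskerRight, Category.assoc]⟩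

@[ext]
theorem hom_ext {M N : ModuleO Q} {f g : M ⟶ N} (h : f.hom = g.hom) : f = g :=
  Hom.ext h

theorem diagAct_bar (M N : ModuleO Q) : diagAct Q.comul M.act N.act =
    @diagAct C _ _ (reverseBraiding C) A M.X N.X Q.comulBar M.act N.act := by
  rw [diagAct_eq, N.compatible]
  exact (@diagAct_eq C _ _ (reverseBraiding C) _ _ _ Q.comulBar M.act N.act).symm

/-- The tensor product of two modules, with the diagonal action. -/
@[reducible]
def tensor (M N : ModuleO Q) : ModuleO Q where
  X := M.X ⊗ N.X
  act := diagAct Q.comul M.act N.act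
  act_one := by
    let _ := Q.hopf
    have h : Q.one ≫ Q.comul = (λ_ (𝟙_ C)).inv ≫ (Q.one ⊗ₘ Q.one) :=
      BimonObj.one_comul A
    rw [diagAct, ← MonoidalCategory.whiskerLeft_comp_assoc, h]
    exact tensorAct_one _ _ _ M.act_one N.act_one
  act_mul := by
    let _ := Q.hopf
    have h : Q.mul ≫ Q.comul = convMul Q.mul Q.comul Q.comul :=
      BimonObj.mul_comul A
    rw [diagAct, ← MonoidalCategory.whiskerLeft_comp_assoc, h]
    exact tensorAct_convMul _ _ _ M.act_mul N.act_mul _ _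
  compatible := by
    rw [past_diagAct _ (@ComonObj.comul_assoc _ _ _ A Q.hopf.toComonObj), M.compatible,
      N.compatible, diagAct_bar]
    exact (@past_diagAct C _ _ (reverseBraiding C) _ _ _ Q.comulBar
      (@ComonObj.comul_assoc _ _ _ A Q.hopfBar.toComonObj) M.act N.act).symm

/-- The unit object, with the action given by the counit. -/
@[reducible]
def unit (Q : QuantumGroup A) : ModuleO Q where
  X := 𝟙_ C
  act := (λ_ A).hom ≫ Q.counit
  act_one := by
    let _ := Q.hopf
    have h : Q.one ≫ Q.counit = 𝟙 _ := BimonObj.one_counit A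
    rw [leftUnitor_naturality_assoc, h]
    monoidal
  act_mul := by
    let _ := Q.hopf
    have h : Q.mul ≫ Q.counit = (Q.counit ⊗ₘ Q.counit) ≫ (λ_ (𝟙_ C)).hom :=
      BimonObj.mul_counit A
    rw [leftUnitor_naturality_assoc, h, MonoidalCategory.tensorHom_def]
    monoidal
  compatible := by
    rw [past_unit _ _ (@ComonObj.comul_counit _ _ _ A Q.hopf.toComonObj),
      show Q.counit = Q.hopfBar.counit from Q.counit_bar.symm]
    exact (@past_unit C _ _ (reverseBraiding C) _ Q.comulBar _
      (@ComonObj.comul_counit _ _ _ A Q.hopfBar.toComonObj)).symm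

theorem past_tensor (M N : ModuleO Q) : past Q.comul (diagAct Q.comul M.act N.act) =
    (α_ M.X N.X A).hom ≫ M.X ◁ past Q.comul N.act ≫ (α_ M.X A N.X).inv ≫
      past Q.comul M.act ▷ N.X ≫ (α_ A M.X N.X).hom :=
  past_diagAct _ (@ComonObj.comul_assoc _ _ _ A Q.hopf.toComonObj) _ _

theorem diagAct_natural {M N M' N' : ModuleO Q} (f : M ⟶ N) (g : M' ⟶ N') :
    diagAct Q.comul M.act M'.act ≫ (f.hom ⊗ₘ g.hom) =
      (f.hom ⊗ₘ g.hom) ▷ A ≫ diagAct Q.comul N.act N'.act := by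
  have h := tensorμ_natural_left f.hom g.hom A A
  dsimp only [diagAct, tensorAct]
  rw [← whisker_exchange_assoc, reassoc_of% h]
  simp only [Category.assoc, tensorHom_comp_tensorHom]
  rw [f.linear, g.linear]

theorem associator_linear (M N P : ModuleO Q) :
    diagAct Q.comul (diagAct Q.comul M.act N.act) P.act ≫ (α_ M.X N.X P.X).hom =
      (α_ M.X N.X P.X).hom ▷ A ≫ diagAct Q.comul M.act (diagAct Q.comul N.act P.act) := by
  rw [diagAct_eq, diagAct_eq, diagAct_eq _ M.act, past_tensor]
  monoidal

theorem leftUnitor_linear (M : ModuleO Q) :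
    diagAct Q.comul ((λ_ A).hom ≫ Q.counit) M.act ≫ (λ_ M.X).hom = (λ_ M.X).hom ▷ A ≫ M.act := by
  have h := past_counit Q.comul Q.counit (@ComonObj.counit_comul _ _ _ A Q.hopf.toComonObj) M.act
  calc
    _ = 𝟙 _ ⊗≫ (past Q.comul M.act ≫ Q.counit ▷ M.X) ⊗≫ 𝟙 _ := by
      rw [diagAct_eq]
      monoidal
    _ = _ := by
      rw [h]
      monoidal

theorem rightUnitor_linear (M : ModuleO Q) :
    diagAct Q.comul M.act ((λ_ A).hom ≫ Q.counit) ≫ (ρ_ M.X).hom = (ρ_ M.X).hom ▷ A ≫ M.act := by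
  rw [diagAct_eq, past_unit _ _ (@ComonObj.comul_counit _ _ _ A Q.hopf.toComonObj)]
  monoidal

/-- Isomorphisms of modules. -/
@[reducible]
def mkIso {M N : ModuleO Q} (e : M.X ≅ N.X) (h : M.act ≫ e.hom = e.hom ▷ A ≫ N.act) : M ≅ N where
  hom := ⟨e.hom, h⟩
  inv := ⟨e.inv, by
    rw [Iso.comp_inv_eq, Category.assoc, h, ← comp_whiskerRight_assoc, Iso.inv_hom_id,
      id_whiskerRight, Category.id_comp]⟩
  hom_inv_id := hom_ext e.hom_inv_id
  inv_hom_id := hom_ext e.inv_hom_id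

/-- The monoidal structure of `C_{O(A, Ā)}`: that of `C` on the underlying objects and morphisms. -/
@[simps! tensorObj_X tensorObj_act tensorUnit_X tensorUnit_act tensorHom_hom whiskerLeft_hom
  whiskerRight_hom associator_hom_hom associator_inv_hom leftUnitor_hom_hom leftUnitor_inv_hom
  rightUnitor_hom_hom rightUnitor_inv_hom]
instance : MonoidalCategory (ModuleO Q) where
  tensorObj := tensor
  tensorUnit := unit Q
  tensorHom f g := ⟨f.hom ⊗ₘ g.hom, diagAct_natural f g⟩
  whiskerLeft M _ _ f := ⟨M.X ◁ f.hom, by simpa using diagAct_natural (𝟙 M) f⟩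
  whiskerRight f M := ⟨f.hom ▷ M.X, by simpa using diagAct_natural f (𝟙 M)⟩
  associator M N P := mkIso (α_ M.X N.X P.X) (associator_linear M N P)
  leftUnitor M := mkIso (λ_ M.X) (leftUnitor_linear M)
  rightUnitor M := mkIso (ρ_ M.X) (rightUnitor_linear M)
  tensorHom_def _ _ := hom_ext (MonoidalCategory.tensorHom_def _ _)
  id_tensorHom_id _ _ := hom_ext (MonoidalCategory.id_tensorHom_id _ _)
  tensorHom_comp_tensorHom _ _ _ _ := hom_ext (MonoidalCategory.tensorHom_comp_tensorHom _ _ _ _)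
  whiskerLeft_id _ _ := hom_ext (MonoidalCategory.whiskerLeft_id _ _)
  id_whiskerRight _ _ := hom_ext (MonoidalCategory.id_whiskerRight _ _)
  associator_naturality _ _ _ := hom_ext (MonoidalCategory.associator_naturality _ _ _)
  leftUnitor_naturality _ := hom_ext (MonoidalCategory.leftUnitor_naturality _)
  rightUnitor_naturality _ := hom_ext (MonoidalCategory.rightUnitor_naturality _)
  pentagon _ _ _ _ := hom_ext (MonoidalCategory.pentagon _ _ _ _)
  triangle _ _ := hom_ext (MonoidalCategory.triangle _ _)

/-- The coaction `ν = (μ ⊗ id) ∘ (id ⊗ r)` for `r : 1 → A ⊗ A`. -/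
def coactBy (M : ModuleO Q) (r : 𝟙_ C ⟶ A ⊗ A) : M.X ⟶ M.X ⊗ A :=
  (ρ_ M.X).inv ≫ M.X ◁ r ≫ (α_ M.X A A).inv ≫ M.act ▷ A

/-- The coaction `(μ ⊗ id) ∘ (id ⊗ R)`, which makes an object of `C_{O(A, Ā)}` a crossed module over
`A` in `C`. -/
def coact (M : ModuleO Q) : M.X ⟶ M.X ⊗ A := M.coactBy Q.R

/-- The coaction which makes an object of `C_{O(A, Ā)}` a crossed module over `Ā` in `C̄`. It is
induced by the R-matrix `Ψ⁻¹ ∘ R⁻¹` of the pair `(Ā, A)` in `C̄`; the crossed module braiding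
in `C̄` that belongs to it is the inverse of the braiding of `C_{O(A, Ā)}`
(see `braidIso`). -/
def coactBar (M : ModuleO Q) : M.X ⟶ M.X ⊗ A := M.coactBy (Q.Rinv ≫ (β_ A A).inv)

/-- The crossed module braiding `(id ⊗ μ) ∘ (s ⊗ id) ∘ (id ⊗ ν)` for a coaction `ν` on `N` and a
braiding `s` of the underlying objects. -/
def crossedBraid (M N : ModuleO Q) (s : M.X ⊗ N.X ⟶ N.X ⊗ M.X) (ν : N.X ⟶ N.X ⊗ A) :
    M.X ⊗ N.X ⟶ N.X ⊗ M.X :=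
  M.X ◁ ν ≫ (α_ M.X N.X A).inv ≫ s ▷ A ≫ (α_ N.X M.X A).hom ≫ N.X ◁ M.act

/-- The action of `r : 1 → A ⊗ A` on `M ⊗ N`. -/
def actOn (M N : ModuleO Q) (r : 𝟙_ C ⟶ A ⊗ A) : M.X ⊗ N.X ⟶ M.X ⊗ N.X :=
  (ρ_ (M.X ⊗ N.X)).inv ≫ (M.X ⊗ N.X) ◁ r ≫ tensorAct M.act N.act

theorem actOn_comp (M N : ModuleO Q) (r s : 𝟙_ C ⟶ A ⊗ A) :
    M.actOn N r ≫ M.actOn N s = M.actOn N ((λ_ (𝟙_ C)).inv ≫ convMul Q.mul r s) := by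
  have key := tensorAct_convMul Q.mul M.act N.act M.act_mul N.act_mul r s
  simp only [actOn]
  rw [MonoidalCategory.whiskerLeft_comp _ (λ_ (𝟙_ C)).inv]
  simp only [Category.assoc]
  rw [key]
  generalize tensorAct M.act N.act = T
  have h : (M.X ⊗ N.X) ◁ r ≫ T ≫ (ρ_ (M.X ⊗ N.X)).inv =
      (ρ_ _).inv ≫ ((M.X ⊗ N.X) ◁ r ≫ T) ▷ 𝟙_ C := by
    simp
  rw [reassoc_of% h]
  monoidal

theorem actOn_one (M N : ModuleO Q) :
    M.actOn N ((λ_ (𝟙_ C)).inv ≫ (Q.one ⊗ₘ Q.one)) = 𝟙 _ := by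
  rw [actOn, tensorAct_one _ _ _ M.act_one N.act_one, Iso.inv_hom_id]

theorem crossedBraid_eq (M N : ModuleO Q) :
    M.crossedBraid N (β_ M.X N.X).hom N.coact = (β_ M.X N.X).hom ≫ N.actOn M Q.R := by
  have h : ∀ r : 𝟙_ C ⟶ A ⊗ A, (β_ M.X N.X).hom ≫ (ρ_ (N.X ⊗ M.X)).inv ≫ (N.X ⊗ M.X) ◁ r =
      (ρ_ (M.X ⊗ N.X)).inv ≫ (M.X ⊗ N.X) ◁ r ≫ (β_ M.X N.X).hom ▷ (A ⊗ A) := by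
    intro r
    rw [whisker_exchange]
    simp
  simp only [crossedBraid, coact, coactBy, actOn, tensorAct]
  rw [reassoc_of% (h Q.R)]
  have h2 : (β_ M.X N.X).hom ▷ (A ⊗ A) ≫ tensorμ N.X M.X A A =
      (α_ _ _ _).hom ≫ M.X ◁ (α_ _ _ _).inv ≫ (α_ _ _ _).inv ≫
        (β_ M.X (N.X ⊗ A)).hom ▷ A ≫ (α_ _ _ _).hom := by
    rw [BraidedCategory.braiding_tensor_right_hom]
    simp only [tensorμ]
    monoidal
  rw [reassoc_of% h2, MonoidalCategory.tensorHom_def]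
  simp only [MonoidalCategory.whiskerLeft_comp, Category.assoc]
  have h3 : M.X ◁ N.act ▷ A ≫ (α_ M.X N.X A).inv ≫ (β_ M.X N.X).hom ▷ A =
      (α_ _ _ _).inv ≫ (β_ M.X (N.X ⊗ A)).hom ▷ A ≫ N.act ▷ M.X ▷ A := by
    rw [← comp_whiskerRight, ← BraidedCategory.braiding_naturality_right, comp_whiskerRight]
    monoidal
  rw [reassoc_of% h3]
  monoidal

theorem crossedBraid_bar_eq (M N : ModuleO Q) :
    N.crossedBraid M (β_ M.X N.X).inv M.coactBar = N.actOn M Q.Rinv ≫ (β_ M.X N.X).inv := by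
  simp only [crossedBraid, coactBar, coactBy, actOn, tensorAct]
  have h1 : (N.act ⊗ₘ M.act) ≫ (β_ M.X N.X).inv =
      (β_ (M.X ⊗ A) (N.X ⊗ A)).inv ≫ (M.act ⊗ₘ N.act) := by
    rw [Iso.comp_inv_eq, Category.assoc, BraidedCategory.braiding_naturality,
      Iso.inv_hom_id_assoc]
  have h2 : tensorμ N.X M.X A A ≫ (β_ (M.X ⊗ A) (N.X ⊗ A)).inv =
      (N.X ⊗ M.X) ◁ (β_ A A).inv ≫ (α_ _ _ _).hom ≫ N.X ◁ (α_ _ _ _).inv ≫ (α_ _ _ _).inv ≫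
        (β_ (M.X ⊗ A) N.X).inv ▷ A ≫ (α_ _ _ _).hom := by
    rw [BraidedCategory.braiding_tensor_right_inv, BraidedCategory.braiding_tensor_left_inv _ _ A]
    have h : (β_ M.X A).hom ▷ A ≫ (β_ M.X A).inv ▷ A = 𝟙 _ := by
      rw [← comp_whiskerRight, Iso.hom_inv_id, id_whiskerRight]
    calc
      _ = 𝟙 _ ⊗≫ N.X ◁ ((β_ M.X A).hom ▷ A ≫ (β_ M.X A).inv ▷ A) ⊗≫
          (N.X ⊗ M.X) ◁ (β_ A A).inv ⊗≫ (β_ (M.X ⊗ A) N.X).inv ▷ A ⊗≫ 𝟙 _ := by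
        simp only [tensorμ]
        monoidal
      _ = _ := by
        rw [h]
        monoidal
  have h3 : N.X ◁ M.act ▷ A ≫ (α_ N.X M.X A).inv ≫ (β_ M.X N.X).inv ▷ A =
      (α_ _ _ _).inv ≫ (β_ (M.X ⊗ A) N.X).inv ▷ A ≫ M.act ▷ N.X ▷ A := by
    rw [← comp_whiskerRight, ← BraidedCategory.braiding_inv_naturality_right, comp_whiskerRight]
    monoidal
  simp only [Category.assoc]
  rw [h1, reassoc_of% h2, MonoidalCategory.tensorHom_def]
  simp only [MonoidalCategory.whiskerLeft_comp, Category.assoc]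
  rw [reassoc_of% h3]
  monoidal

/-- The braiding of `C_{O(A, Ā)}` on underlying objects. -/
@[simps]
def braidIso (M N : ModuleO Q) : M.X ⊗ N.X ≅ N.X ⊗ M.X where
  hom := M.crossedBraid N (β_ M.X N.X).hom N.coact
  inv := N.crossedBraid M (β_ M.X N.X).inv M.coactBar
  hom_inv_id := by
    rw [crossedBraid_eq, crossedBraid_bar_eq, Category.assoc,
      reassoc_of% (actOn_comp N M Q.R Q.Rinv), Q.R_mul_Rinv, actOn_one]
    simp
  inv_hom_id := by
    rw [crossedBraid_eq, crossedBraid_bar_eq, Category.assoc, Iso.inv_hom_id_assoc,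
      actOn_comp N M Q.Rinv Q.R, Q.Rinv_mul_R, actOn_one]

theorem braid_linear (M N : ModuleO Q) :
    diagAct Q.comul M.act N.act ≫ (braidIso M N).hom =
      (braidIso M N).hom ▷ A ≫ diagAct Q.comul N.act M.act := by
  have h1 : diagAct Q.comul M.act N.act ≫ (β_ M.X N.X).hom = (β_ M.X N.X).hom ▷ A ≫
      (N.X ⊗ M.X) ◁ (Q.comulBar ≫ (β_ A A).hom) ≫ tensorAct N.act M.act := by
    have h := tensorAct_braiding M.act N.act
    rw [diagAct_bar]
    dsimp only [diagAct]
    rw [Category.assoc, h, whisker_exchange_assoc, MonoidalCategory.whiskerLeft_comp,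
      Category.assoc]
  have h2 := tensorAct_convMul Q.mul N.act M.act N.act_mul M.act_mul Q.R Q.comul
  have h3 := tensorAct_convMul Q.mul N.act M.act N.act_mul M.act_mul
    (Q.comulBar ≫ (β_ A A).hom) Q.R
  have h4 := Q.quasitriangular
  rw [Iso.inv_comp_eq] at h4
  rw [h4] at h3
  simp only [braidIso_hom, crossedBraid_eq]
  rw [reassoc_of% h1, comp_whiskerRight, Category.assoc]
  congr 1
  simp only [actOn, diagAct]
  generalize tensorAct N.act M.act = T at h2 h3 ⊢
  rw [MonoidalCategory.whiskerLeft_comp, MonoidalCategory.whiskerLeft_comp _ (λ_ A).inv] at h3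
  simp only [Category.assoc] at h3
  rw [h2] at h3
  have h5 : ((N.X ⊗ M.X) ◁ (Q.comulBar ≫ (β_ A A).hom) ≫ T) ≫ (ρ_ (N.X ⊗ M.X)).inv =
      (ρ_ _).inv ≫ ((N.X ⊗ M.X) ◁ (Q.comulBar ≫ (β_ A A).hom) ≫ T) ▷ 𝟙_ C :=
    rightUnitor_inv_naturality _
  rw [Category.assoc] at h5
  rw [reassoc_of% h5]
  have h6 := (ρ_ _).inv ≫= ((α_ (N.X ⊗ M.X) A (𝟙_ C)).hom ≫= h3)
  rw [Iso.hom_inv_id_assoc] at h6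
  rw [← h6]
  monoidal

theorem coact_natural {M N : ModuleO Q} (f : M ⟶ N) :
    M.coact ≫ f.hom ▷ A = f.hom ≫ N.coact := by
  simp only [coact, coactBy, Category.assoc, ← comp_whiskerRight, f.linear]
  rw [rightUnitor_inv_naturality_assoc, ← whisker_exchange_assoc]
  simp

theorem coact_comul (M : ModuleO Q) :
    M.coact ≫ M.X ◁ Q.comul = M.coact ≫ M.coact ▷ A ≫ (α_ M.X A A).hom := by
  have hR := Q.R_comul_right
  calc
    _ = 𝟙 _ ⊗≫ M.X ◁ Q.R ⊗≫ (M.act ▷ A ≫ M.X ◁ Q.comul) := by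
      simp only [coact, coactBy]
      monoidal
    _ = 𝟙 _ ⊗≫ M.X ◁ (Q.R ≫ A ◁ Q.comul) ⊗≫ M.act ▷ (A ⊗ A) := by
      rw [← whisker_exchange]
      monoidal
    _ = 𝟙 _ ⊗≫ M.X ◁ Q.R ⊗≫ M.X ◁ A ◁ Q.R ▷ A ⊗≫ (M.X ◁ Q.mul ≫ M.act) ▷ (A ⊗ A) := by
      rw [hR]
      simp only [nest, MonoidalCategory.tensorHom_def]
      monoidal
    _ = 𝟙 _ ⊗≫ M.X ◁ Q.R ⊗≫ ((M.X ⊗ A) ◁ Q.R ≫ M.act ▷ (A ⊗ A)) ▷ A ⊗≫ M.act ▷ (A ⊗ A) := by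
      rw [M.act_mul]
      monoidal
    _ = _ := by
      rw [whisker_exchange]
      simp only [coact, coactBy]
      monoidal

theorem insert_braiding {A W : C} (R : 𝟙_ C ⟶ A ⊗ A) :
    (ρ_ W).inv ≫ W ◁ R ≫ (α_ W A A).inv ≫ (β_ A W).inv ▷ A =
      (λ_ W).inv ≫ R ▷ W ≫ (α_ A A W).hom ≫ A ◁ (β_ A W).hom ≫ (α_ A W A).inv := by
  have h : R ▷ W ≫ (β_ (A ⊗ A) W).hom = (λ_ W).hom ≫ (ρ_ W).inv ≫ W ◁ R := by
    rw [BraidedCategory.braiding_naturality_left, braiding_tensorUnit_left, Category.assoc]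
  rw [BraidedCategory.braiding_tensor_left_hom] at h
  have h' : (ρ_ W).inv ≫ W ◁ R = (λ_ W).inv ≫ R ▷ W ≫ (α_ A A W).hom ≫ A ◁ (β_ A W).hom ≫
      (α_ A W A).inv ≫ (β_ A W).hom ▷ A ≫ (α_ W A A).hom := by
    rw [h, Iso.inv_hom_id_assoc]
  rw [reassoc_of% h']
  simp

theorem coact_tensor (M N : ModuleO Q) :
    (tensor M N).coact = (M.coact ⊗ₘ N.coact) ≫ tensorμ M.X A N.X A ≫ (M.X ⊗ N.X) ◁ Q.mul := by
  have hR : Q.R ≫ Q.comulBar ▷ A = nest Q.R Q.R (𝟙 (A ⊗ A)) Q.mul ≫ (β_ A A).inv ▷ A := by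
    rw [← Q.R_comul_left, Category.assoc, ← comp_whiskerRight, Category.assoc, Iso.hom_inv_id,
      Category.comp_id]
  have hW := insert_braiding (W := N.X ⊗ A) Q.R
  rw [BraidedCategory.braiding_tensor_right_inv] at hW
  calc
    _ = 𝟙 _ ⊗≫ (M.X ⊗ N.X) ◁ (Q.R ≫ Q.comulBar ▷ A) ⊗≫ M.X ◁ (β_ A N.X).inv ▷ (A ⊗ A) ⊗≫
        M.X ◁ A ◁ N.act ▷ A ⊗≫ M.act ▷ (N.X ⊗ A) ⊗≫ 𝟙 _ := by
      dsimp only [coact, coactBy]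
      rw [diagAct_eq, N.compatible, pastBar_eq]
      monoidal
    _ = 𝟙 _ ⊗≫ (M.X ⊗ N.X) ◁ Q.R ⊗≫
        M.X ◁ ((ρ_ (N.X ⊗ A)).inv ≫ (N.X ⊗ A) ◁ Q.R ≫ (α_ _ A A).inv ≫ ((α_ _ _ _).hom ≫
          N.X ◁ (β_ A A).inv ≫ (α_ _ _ _).inv ≫ (β_ A N.X).inv ▷ A ≫ (α_ _ _ _).hom) ▷ A) ▷ A ⊗≫
        M.X ◁ A ◁ N.X ◁ A ◁ Q.mul ⊗≫ M.X ◁ A ◁ N.act ▷ A ⊗≫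
        M.act ▷ (N.X ⊗ A) ⊗≫ 𝟙 _ := by
      rw [hR]
      calc
        _ = 𝟙 _ ⊗≫ (M.X ⊗ N.X) ◁ Q.R ⊗≫ M.X ◁ N.X ◁ A ◁ Q.R ▷ A ⊗≫
            M.X ◁ N.X ◁ ((A ⊗ A) ◁ Q.mul ≫ (β_ A A).inv ▷ A) ⊗≫
            M.X ◁ (β_ A N.X).inv ▷ (A ⊗ A) ⊗≫
            M.X ◁ A ◁ N.act ▷ A ⊗≫ M.act ▷ (N.X ⊗ A) ⊗≫ 𝟙 _ := by
          simp only [nest, MonoidalCategory.tensorHom_def]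
          monoidal
        _ = 𝟙 _ ⊗≫ (M.X ⊗ N.X) ◁ Q.R ⊗≫ M.X ◁ N.X ◁ A ◁ Q.R ▷ A ⊗≫
            M.X ◁ N.X ◁ (β_ A A).inv ▷ (A ⊗ A) ⊗≫
            M.X ◁ ((N.X ⊗ A) ◁ (A ◁ Q.mul) ≫ (β_ A N.X).inv ▷ (A ⊗ A)) ⊗≫
            M.X ◁ A ◁ N.act ▷ A ⊗≫ M.act ▷ (N.X ⊗ A) ⊗≫ 𝟙 _ := by
          rw [whisker_exchange]
          monoidal
        _ = _ := by
          rw [whisker_exchange]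
          monoidal
    _ = _ := by
      rw [hW]
      calc
        _ = 𝟙 _ ⊗≫ (M.X ⊗ N.X) ◁ Q.R ⊗≫ M.X ◁ Q.R ▷ (N.X ⊗ A) ▷ A ⊗≫
            M.X ◁ A ◁ (β_ A (N.X ⊗ A)).hom ▷ A ⊗≫
            M.X ◁ A ◁ ((N.X ⊗ A) ◁ Q.mul ≫ N.act ▷ A) ⊗≫ M.act ▷ (N.X ⊗ A) ⊗≫ 𝟙 _ := by
          monoidal
        _ = 𝟙 _ ⊗≫ (M.X ⊗ N.X) ◁ Q.R ⊗≫ M.X ◁ Q.R ▷ (N.X ⊗ A) ▷ A ⊗≫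
            M.X ◁ A ◁ ((β_ A (N.X ⊗ A)).hom ≫ N.act ▷ A) ▷ A ⊗≫
            M.X ◁ A ◁ N.X ◁ Q.mul ⊗≫ M.act ▷ (N.X ⊗ A) ⊗≫ 𝟙 _ := by
          rw [whisker_exchange]
          monoidal
        _ = 𝟙 _ ⊗≫ (M.X ⊗ N.X) ◁ Q.R ⊗≫
            M.X ◁ (Q.R ▷ (N.X ⊗ A) ≫ (A ⊗ A) ◁ N.act) ▷ A ⊗≫
            M.X ◁ A ◁ (β_ A N.X).hom ▷ A ⊗≫
            M.X ◁ A ◁ N.X ◁ Q.mul ⊗≫ M.act ▷ (N.X ⊗ A) ⊗≫ 𝟙 _ := by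
          rw [← BraidedCategory.braiding_naturality_right]
          monoidal
        _ = 𝟙 _ ⊗≫ (M.X ⊗ N.X) ◁ Q.R ⊗≫ M.X ◁ N.act ▷ A ⊗≫ M.X ◁ Q.R ▷ N.X ▷ A ⊗≫
            ((M.X ⊗ A) ◁ ((β_ A N.X).hom ▷ A ≫ (α_ _ _ _).hom ≫ N.X ◁ Q.mul) ≫
              M.act ▷ (N.X ⊗ A)) ⊗≫ 𝟙 _ := by
          rw [← whisker_exchange]
          monoidal
        _ = _ := by
          rw [whisker_exchange, MonoidalCategory.tensorHom_def']
          simp only [coact, coactBy, tensorμ]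
          monoidal

theorem braid_naturality_right (M : ModuleO Q) {N N' : ModuleO Q} (f : N ⟶ N') :
    M.X ◁ f.hom ≫ (braidIso M N').hom = (braidIso M N).hom ≫ f.hom ▷ M.X := by
  simp only [braidIso_hom, crossedBraid]
  calc
    _ = M.X ◁ (f.hom ≫ N'.coact) ⊗≫ (β_ M.X N'.X).hom ▷ A ⊗≫ N'.X ◁ M.act := by monoidal
    _ = M.X ◁ N.coact ⊗≫ (M.X ◁ f.hom ≫ (β_ M.X N'.X).hom) ▷ A ⊗≫ N'.X ◁ M.act := by
      rw [← coact_natural]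
      monoidal
    _ = M.X ◁ N.coact ⊗≫ (β_ M.X N.X).hom ▷ A ⊗≫ (f.hom ▷ (M.X ⊗ A) ≫ N'.X ◁ M.act) := by
      rw [BraidedCategory.braiding_naturality_right]
      monoidal
    _ = _ := by
      rw [← whisker_exchange]
      monoidal

theorem braid_naturality_left {M M' : ModuleO Q} (f : M ⟶ M') (N : ModuleO Q) :
    f.hom ▷ N.X ≫ (braidIso M' N).hom = (braidIso M N).hom ≫ N.X ◁ f.hom := by
  simp only [braidIso_hom, crossedBraid]
  calc
    _ = (f.hom ▷ N.X ≫ M'.X ◁ N.coact) ⊗≫ (β_ M'.X N.X).hom ▷ A ⊗≫ N.X ◁ M'.act := by monoidal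
    _ = M.X ◁ N.coact ⊗≫ (f.hom ▷ N.X ≫ (β_ M'.X N.X).hom) ▷ A ⊗≫ N.X ◁ M'.act := by
      rw [← whisker_exchange]
      monoidal
    _ = M.X ◁ N.coact ⊗≫ (β_ M.X N.X).hom ▷ A ⊗≫ N.X ◁ (f.hom ▷ A ≫ M'.act) := by
      rw [BraidedCategory.braiding_naturality_left]
      monoidal
    _ = _ := by
      rw [← f.linear]
      monoidal

theorem hexagon_forward (M N P : ModuleO Q) :
    (α_ M.X N.X P.X).hom ≫ (braidIso M (tensor N P)).hom ≫ (α_ N.X P.X M.X).hom =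
      (braidIso M N).hom ▷ P.X ≫ (α_ N.X M.X P.X).hom ≫ N.X ◁ (braidIso M P).hom := by
  simp only [braidIso_hom, crossedBraid]
  rw [coact_tensor]
  have hB : M.act ▷ P.X ≫ (β_ M.X P.X).hom = ((α_ _ _ _).hom ≫ M.X ◁ (β_ A P.X).hom ≫
      (α_ _ _ _).inv ≫ (β_ M.X P.X).hom ▷ A ≫ (α_ _ _ _).hom) ≫ P.X ◁ M.act := by
    rw [BraidedCategory.braiding_naturality_left, BraidedCategory.braiding_tensor_left_hom]
  calc
    _ = 𝟙 _ ⊗≫ M.X ◁ (N.coact ⊗ₘ P.coact) ⊗≫ M.X ◁ N.X ◁ (β_ A P.X).hom ▷ A ⊗≫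
        ((M.X ⊗ N.X ⊗ P.X) ◁ Q.mul ≫ (β_ M.X (N.X ⊗ P.X)).hom ▷ A) ⊗≫
        N.X ◁ P.X ◁ M.act := by
      simp only [tensorμ]
      monoidal
    _ = 𝟙 _ ⊗≫ M.X ◁ (N.coact ⊗ₘ P.coact) ⊗≫ M.X ◁ N.X ◁ (β_ A P.X).hom ▷ A ⊗≫
        (β_ M.X (N.X ⊗ P.X)).hom ▷ (A ⊗ A) ⊗≫ N.X ◁ P.X ◁ (M.X ◁ Q.mul ≫ M.act) := by
      rw [whisker_exchange]
      monoidal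
    _ = 𝟙 _ ⊗≫ M.X ◁ N.coact ▷ P.X ⊗≫
        ((M.X ⊗ N.X) ◁ (A ◁ P.coact ≫ (α_ _ _ _).inv ≫ (β_ A P.X).hom ▷ A) ≫
          (β_ M.X N.X).hom ▷ ((P.X ⊗ A) ⊗ A)) ⊗≫
        N.X ◁ (β_ M.X P.X).hom ▷ (A ⊗ A) ⊗≫ N.X ◁ P.X ◁ M.act ▷ A ⊗≫ N.X ◁ P.X ◁ M.act := by
      rw [M.act_mul, BraidedCategory.braiding_tensor_right_hom, MonoidalCategory.tensorHom_def]
      monoidal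
    _ = 𝟙 _ ⊗≫ M.X ◁ N.coact ▷ P.X ⊗≫ (β_ M.X N.X).hom ▷ (A ⊗ P.X) ⊗≫
        N.X ◁ M.X ◁ A ◁ P.coact ⊗≫ N.X ◁ (M.act ▷ P.X ≫ (β_ M.X P.X).hom) ▷ A ⊗≫
        N.X ◁ P.X ◁ M.act := by
      rw [whisker_exchange, hB]
      monoidal
    _ = 𝟙 _ ⊗≫ M.X ◁ N.coact ▷ P.X ⊗≫ (β_ M.X N.X).hom ▷ (A ⊗ P.X) ⊗≫
        N.X ◁ ((M.X ⊗ A) ◁ P.coact ≫ M.act ▷ (P.X ⊗ A)) ⊗≫ N.X ◁ (β_ M.X P.X).hom ▷ A ⊗≫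
        N.X ◁ P.X ◁ M.act := by
      monoidal
    _ = _ := by
      rw [whisker_exchange]
      monoidal

theorem hexagon_reverse (M N P : ModuleO Q) :
    (α_ M.X N.X P.X).inv ≫ (braidIso (tensor M N) P).hom ≫ (α_ P.X M.X N.X).inv =
      M.X ◁ (braidIso N P).hom ≫ (α_ M.X P.X N.X).inv ≫ (braidIso M P).hom ▷ N.X := by
  simp only [braidIso_hom, crossedBraid]
  rw [diagAct_eq]
  have hB : (β_ N.X P.X).hom ≫ P.coact ▷ N.X = N.X ◁ P.coact ≫ (α_ _ _ _).inv ≫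
      (β_ N.X P.X).hom ▷ A ≫ (α_ _ _ _).hom ≫ P.X ◁ (β_ N.X A).hom ≫ (α_ _ _ _).inv := by
    rw [← BraidedCategory.braiding_naturality_right, BraidedCategory.braiding_tensor_right_hom]
  calc
    _ = 𝟙 _ ⊗≫ (M.X ⊗ N.X) ◁ P.coact ⊗≫
        ((β_ (M.X ⊗ N.X) P.X).hom ▷ A ≫ (P.X ⊗ M.X ⊗ N.X) ◁ Q.comul) ⊗≫
        P.X ◁ M.X ◁ ((β_ N.X A).hom ▷ A ≫ (α_ _ _ _).hom ≫ A ◁ N.act) ⊗≫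
        P.X ◁ M.act ▷ N.X ⊗≫ 𝟙 _ := by
      simp only [past]
      monoidal
    _ = 𝟙 _ ⊗≫ (M.X ⊗ N.X) ◁ (P.coact ≫ P.X ◁ Q.comul) ⊗≫
        (β_ (M.X ⊗ N.X) P.X).hom ▷ (A ⊗ A) ⊗≫
        P.X ◁ M.X ◁ ((β_ N.X A).hom ▷ A ≫ (α_ _ _ _).hom ≫ A ◁ N.act) ⊗≫
        P.X ◁ M.act ▷ N.X ⊗≫ 𝟙 _ := by
      rw [← whisker_exchange]
      monoidal
    _ = 𝟙 _ ⊗≫ (M.X ⊗ N.X) ◁ P.coact ⊗≫ M.X ◁ N.X ◁ P.coact ▷ A ⊗≫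
        M.X ◁ (β_ N.X P.X).hom ▷ (A ⊗ A) ⊗≫
        ((β_ M.X P.X).hom ▷ ((N.X ⊗ A) ⊗ A) ≫ (P.X ⊗ M.X) ◁
          ((β_ N.X A).hom ▷ A ≫ (α_ _ _ _).hom ≫ A ◁ N.act)) ⊗≫
        P.X ◁ M.act ▷ N.X ⊗≫ 𝟙 _ := by
      rw [coact_comul, BraidedCategory.braiding_tensor_left_hom]
      monoidal
    _ = 𝟙 _ ⊗≫ (M.X ⊗ N.X) ◁ P.coact ⊗≫ M.X ◁ ((β_ N.X P.X).hom ≫ P.coact ▷ N.X) ▷ A ⊗≫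
        M.X ◁ (P.X ⊗ A) ◁ N.act ⊗≫ (β_ M.X P.X).hom ▷ (A ⊗ N.X) ⊗≫
        P.X ◁ M.act ▷ N.X ⊗≫ 𝟙 _ := by
      rw [← whisker_exchange, hB]
      monoidal
    _ = 𝟙 _ ⊗≫ (M.X ⊗ N.X) ◁ P.coact ⊗≫ M.X ◁ (β_ N.X P.X).hom ▷ A ⊗≫
        M.X ◁ (P.coact ▷ (N.X ⊗ A) ≫ (P.X ⊗ A) ◁ N.act) ⊗≫ (β_ M.X P.X).hom ▷ (A ⊗ N.X) ⊗≫
        P.X ◁ M.act ▷ N.X ⊗≫ 𝟙 _ := by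
      monoidal
    _ = _ := by
      rw [← whisker_exchange]
      monoidal

/-- The braiding of `C_{O(A, Ā)}`. -/
@[simps! braiding_hom_hom braiding_inv_hom]
instance : BraidedCategory (ModuleO Q) where
  braiding M N := mkIso (braidIso M N) (braid_linear M N)
  braiding_naturality_right M _ _ f := hom_ext (braid_naturality_right M f)
  braiding_naturality_left f N := hom_ext (braid_naturality_left f N)
  hexagon_forward M N P := hom_ext (hexagon_forward M N P)
  hexagon_reverse M N P := hom_ext (hexagon_reverse M N P)

end ModuleO

/-- A quantum group projection of `(H, H̄, R_H)` onto `(A, Ā, R_A)`. -/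
structure QuantumGroupProjection {A H : C} (QA : QuantumGroup A) (QH : QuantumGroup H) where
  i : A ⟶ H
  p : H ⟶ A
  i_hom : QA.toQTData.IsBialgHom QH.toQTData i
  p_hom : QH.toQTData.IsBialgHom QA.toQTData p
  i_p : i ≫ p = 𝟙 A
  /-- The idempotents `μ_l ∘ (S ⊗ id) ∘ ν_l` of the Hopf bimodules `H` over `A` and `H̄` over `Ā`
  coincide; here `μ_l = m ∘ (i ⊗ id)` and `ν_l = (p ⊗ id) ∘ Δ`. -/
  idempotent_eq : QH.comul ≫ p ▷ H ≫ QA.S ▷ H ≫ i ▷ H ≫ QH.mul =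
    QH.comulBar ≫ p ▷ H ≫ QA.Sbar ▷ H ≫ i ▷ H ≫ QH.mul
  R_right : QH.R ≫ H ◁ p = QA.R ≫ i ▷ A
  R_left : QH.R ≫ p ▷ H = QA.R ≫ A ◁ i

namespace Bosonization

variable {A : C} {QA : QuantumGroup A} {M : ModuleO QA} (QB : QuantumGroup M)

/-- The cross product multiplication on `A ⊗ B`. -/
def mul : (A ⊗ M.X) ⊗ (A ⊗ M.X) ⟶ A ⊗ M.X :=
  mid (past QA.comul M.act) ≫ (QA.mul ⊗ₘ QB.mul.hom)

/-- The canonical morphism `ι_A : A → A ⋉ B`. -/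
def inclA : A ⟶ A ⊗ M.X := (ρ_ A).inv ≫ A ◁ QB.one.hom

/-- The canonical morphism `ι_B : B → A ⋉ B`. -/
def inclB : M.X ⟶ A ⊗ M.X := (λ_ M.X).inv ≫ QA.one ▷ M.X

/-- The canonical morphism `id ⊗ ε_B : A ⋉ B → A`. -/
def projA : A ⊗ M.X ⟶ A := A ◁ QB.counit.hom ≫ (ρ_ A).hom

/-- The cross coproduct comultiplication on `A ⊗ B` for comultiplications of `A` and `B`, a
coaction `ν` of `A` on `B` and a braiding `s` of `A` and `B`. -/
def crossComul (QA : QuantumGroup A) {B : C} (ΔA : A ⟶ A ⊗ A) (ΔB : B ⟶ B ⊗ B) (ν : B ⟶ B ⊗ A)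
    (s : A ⊗ B ⟶ B ⊗ A) : A ⊗ B ⟶ (A ⊗ B) ⊗ (A ⊗ B) :=
  (ΔA ⊗ₘ ΔB) ≫
    mid (A ◁ ν ≫ (α_ A B A).inv ≫ s ▷ A ≫ (α_ B A A).hom ≫ B ◁ QA.mul)

/-- `R_{A ⋉ B} = (m ⊗ m) ∘ (ι_B ⊗ (ι_A ⊗ ι_A) ∘ R_A ⊗ ι_B) ∘ R_B`. -/
def R : 𝟙_ C ⟶ (A ⊗ M.X) ⊗ (A ⊗ M.X) :=
  nest QB.R.hom QA.R ((inclB ⊗ₘ inclA QB) ≫ mul QB) ((inclA QB ⊗ₘ inclB) ≫ mul QB)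

/-- The structure morphisms of the bosonization `(A ⋉ B, Ā ⋉ B̄, R_{A ⋉ B})` on `A ⊗ B`. The
comultiplication of `Ā ⋉ B̄` is the cross coproduct formed in `C̄`. The multiplication formed in
`C̄` agrees with the one formed in `C`, since `B` satisfies `ModuleO.compatible`. -/
@[simps] def data : QTData (A ⊗ M.X) where
  mul := mul QB
  one := (λ_ (𝟙_ C)).inv ≫ (QA.one ⊗ₘ QB.one.hom)
  comul := crossComul QA QA.comul QB.comul.hom M.coact (β_ A M.X).hom
  comulBar := crossComul QA QA.comulBar QB.comulBar.hom M.coactBar (β_ M.X A).inv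
  counit := (QA.counit ⊗ₘ QB.counit.hom) ≫ (λ_ (𝟙_ C)).hom
  R := R QB

end Bosonization

end BraidedQG

/-!
For a Hopf algebra projection `i : A ⟶ H`, `p : H ⟶ A` the endomorphism `(i ∘ S ∘ p) * id` of `H`
(`HopfProjection.proj`, a convolution product) is an idempotent. Its image `B` is at the same time
the object of left `A`-coinvariants of `H` and the quotient of `H` by left multiplication with `A`.
In the first role `B` inherits a multiplication, in the second one a comultiplication, and
`m ∘ (i ⊗ inc) : A ⊗ B ⟶ H` is an isomorphism with inverse `(p ⊗ quo) ∘ Δ`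
(`HopfSplitting.iso`). The right multiplication by `A` and the comultiplication of `H` make `B` an
`A`-module and comodule; for the crossed braiding formed from the two (`HopfSplitting.cross`), `B`
is a Hopf algebra, and `H` is the cross product and cross coproduct of `A` and `B`
(`HopfSplitting.iso_inv_mul`, `HopfSplitting.iso_inv_comul`). All of this is proved in an arbitrary
braided category, and applied both to `H` in `C` and to `H̄` in `C̄`. The two idempotents agree by
assumption and the isomorphism `A ⊗ B ⟶ H` only involves the multiplication, so both cases lead to
the same algebra `B`; the relation between multiplication in `H` and the action
(`HopfSplitting.past_eq`) shows that `B` lies in `C_{O(A, Ā)}`.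

The coaction of `A` on `B` is the one induced by the R-matrix of `A`, which follows from the
quasitriangularity of `H` restricted to `B` (`HopfSplitting.coactA_eq`). Applied in `C̄` to the
R-matrix `Ψ⁻¹ R⁻¹`, the same lemma identifies the coaction of `Ā`. Hence the crossed braidings are
the braiding of `C_{O(A, Ā)}` and its inverse, and `B` is a Hopf algebra there in both senses.

The R-matrix of `B` is `(quo ⊗ quo) R`. Since the first leg of `(id ⊗ quo) R` is coinvariant
(`QuasitriangularSplitting.RB_inc`), `R` can be reconstructed from `R_B` and `R_A`
(`QuasitriangularSplitting.R_eq`), by the formula for the R-matrix of the bosonization. This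
decomposition also turns the axioms of `R_B`, which involve the crossed braiding, into those of `R`
(`QuasitriangularSplitting.RB_comul_left`, `QuasitriangularSplitting.RB_quasitriangular`). The
convolution inverse of `R_B` is `(id ⊗ S⁻¹) R_B`.
-/

namespace BraidedQG

open scoped MonObj ComonObj HopfObj

variable {C : Type u} [Category.{v} C] [MonoidalCategory C]

/-! ### Convolution products -/

section conv

variable {X Y : C} [ComonObj X] [MonObj Y]

/-- The convolution product of two morphisms from a comonoid to a monoid. -/
def conv (f g : X ⟶ Y) : X ⟶ Y := Δ[X] ≫ f ▷ X ≫ Y ◁ g ≫ μ[Y]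

theorem conv_eq (f g : X ⟶ Y) : conv f g = Δ[X] ≫ (f ⊗ₘ g) ≫ μ[Y] := by
  rw [conv, MonoidalCategory.tensorHom_def, Category.assoc]

theorem conv_assoc (f g h : X ⟶ Y) : conv (conv f g) h = conv f (conv g h) :=
  mul_assoc (G := Conv X Y) f g h

theorem unit_conv (f : X ⟶ Y) : conv (ε[X] ≫ η[Y]) f = f :=
  one_mul (M := Conv X Y) f

theorem conv_unit (f : X ⟶ Y) : conv f (ε[X] ≫ η[Y]) = f :=
  mul_one (M := Conv X Y) f

/-- Most identities for antipodes below are obtained by checking that both sides are convolution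
inverses of the same morphism. -/
theorem conv_inverse_unique {f g h : X ⟶ Y} (hg : conv g f = ε[X] ≫ η[Y])
    (hh : conv f h = ε[X] ≫ η[Y]) : g = h := by
  rw [← conv_unit g, ← hh, ← conv_assoc, hg, unit_conv]

theorem conv_postcomp {Z : C} [MonObj Z] {k : Y ⟶ Z} (hk : μ[Y] ≫ k = (k ⊗ₘ k) ≫ μ[Z])
    (f g : X ⟶ Y) : conv f g ≫ k = conv (f ≫ k) (g ≫ k) := by
  simp only [conv_eq, Category.assoc, hk, tensorHom_comp_tensorHom_assoc]

theorem conv_precomp {Z : C} [ComonObj Z] {k : Z ⟶ X} (hk : k ≫ Δ[X] = Δ[Z] ≫ (k ⊗ₘ k))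
    (f g : X ⟶ Y) : k ≫ conv f g = conv (k ≫ f) (k ≫ g) := by
  simp only [conv_eq, reassoc_of% hk, tensorHom_comp_tensorHom_assoc]

end conv

/-- A morphism into the first factor of a tensor product of monoids. -/
def inFst {X Y : C} (Z : C) [MonObj Z] (f : X ⟶ Y) : X ⟶ Y ⊗ Z := f ≫ (ρ_ Y).inv ≫ Y ◁ η[Z]

/-- A morphism into the second factor of a tensor product of monoids. -/
def inSnd {X Z : C} (Y : C) [MonObj Y] (f : X ⟶ Z) : X ⟶ Y ⊗ Z := f ≫ (λ_ Z).inv ≫ η[Y] ▷ Z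

theorem inFst_eq_comp {X Y Z : C} [MonObj Z] (f : X ⟶ Y) : inFst Z f = f ≫ inFst Z (𝟙 Y) := by
  rw [inFst, inFst, Category.id_comp]

theorem inSnd_eq_comp {X Y Z : C} [MonObj Y] (f : X ⟶ Z) : inSnd Y f = f ≫ inSnd Y (𝟙 Z) := by
  rw [inSnd, inSnd, Category.id_comp]

theorem inverse_unique {M : C} [MonObj M] {f g h : 𝟙_ C ⟶ M}
    (hg : (λ_ (𝟙_ C)).inv ≫ (g ⊗ₘ f) ≫ μ[M] = η[M])
    (hh : (λ_ (𝟙_ C)).inv ≫ (f ⊗ₘ h) ≫ μ[M] = η[M]) : g = h := by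
  let _ := ComonObj.instTensorUnit C
  refine conv_inverse_unique (f := f) ?_ ?_
  · rw [conv_eq]
    exact hg.trans (Category.id_comp _).symm
  · rw [conv_eq]
    exact hh.trans (Category.id_comp _).symm

/-! ### Insertions into tensor products and copairings -/

/-- In this form, `mid_tensorHom` compares two bracketings of a fourfold product in a monoid after
the two inner factors have been commuted by `s`. -/
theorem mid_tensorHom {X P Q P' Q' Y X₁ P₁ Q₁ Y₁ : C} (s : P ⊗ Q ⟶ P' ⊗ Q') (f : X ⟶ X₁)
    (g : P' ⟶ P₁) (h : Q' ⟶ Q₁) (k : Y ⟶ Y₁) :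
    mid s ≫ ((f ⊗ₘ g) ⊗ₘ (h ⊗ₘ k)) ≫ (α_ X₁ P₁ (Q₁ ⊗ Y₁)).hom ≫ X₁ ◁ (α_ P₁ Q₁ Y₁).inv =
      (α_ X P (Q ⊗ Y)).hom ≫ (f ⊗ₘ (α_ P Q Y).inv ≫ (s ≫ (g ⊗ₘ h) ⊗ₘ k)) := by
  have h1 : (g ⊗ₘ (h ⊗ₘ k)) ≫ (α_ P₁ Q₁ Y₁).inv = (α_ P' Q' Y).inv ≫ ((g ⊗ₘ h) ⊗ₘ k) :=
    associator_inv_naturality _ _ _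
  rw [mid, associator_naturality_assoc]
  simp only [Category.assoc, Iso.inv_hom_id_assoc]
  rw [← id_tensorHom, ← id_tensorHom, tensorHom_comp_tensorHom, tensorHom_comp_tensorHom, h1]
  simp only [Category.assoc, Iso.hom_inv_id_assoc, Category.comp_id, Category.id_comp]
  rw [← tensorHom_id, tensorHom_comp_tensorHom, Category.id_comp]

theorem mid_id {X P Q Y : C} : mid (X := X) (Y := Y) (𝟙 (P ⊗ Q)) = 𝟙 _ := by
  simp [mid]

section copairing

variable {P Q P' Q' Y Z : C}

theorem nest_natural {P₁ Q₁ P₁' Q₁' : C} (r : 𝟙_ C ⟶ P ⊗ Q) (t : 𝟙_ C ⟶ P' ⊗ Q') (a : P ⟶ P₁)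
    (b : Q ⟶ Q₁) (c : P' ⟶ P₁') (d : Q' ⟶ Q₁') (f : P₁ ⊗ P₁' ⟶ Y) (g : Q₁' ⊗ Q₁ ⟶ Z) :
    nest (r ≫ (a ⊗ₘ b)) (t ≫ (c ⊗ₘ d)) f g = nest r t ((a ⊗ₘ c) ≫ f) ((d ⊗ₘ b) ≫ g) := by
  have h1 : b ≫ (λ_ Q₁).inv ≫ (t ≫ (c ⊗ₘ d)) ▷ Q₁ ≫ (α_ P₁' Q₁' Q₁).hom =
      (λ_ Q).inv ≫ t ▷ Q ≫ (α_ P' Q' Q).hom ≫ (c ⊗ₘ (d ⊗ₘ b)) := by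
    rw [← associator_naturality, leftUnitor_inv_naturality_assoc, whisker_exchange_assoc,
      comp_whiskerRight_assoc, MonoidalCategory.tensorHom_def (c ⊗ₘ d) b]
    simp only [Category.assoc]
  have h2 : (a ⊗ₘ (c ⊗ₘ (d ⊗ₘ b))) ≫ (α_ _ _ _).inv = (α_ _ _ _).inv ≫ ((a ⊗ₘ c) ⊗ₘ (d ⊗ₘ b)) :=
    associator_inv_naturality _ _ _
  simp only [nest]
  rw [← tensorHom_comp_tensorHom, ← id_tensorHom, Category.assoc, tensorHom_comp_tensorHom_assoc,
    Category.comp_id, h1, ← reassoc_of% h2, ← id_tensorHom, tensorHom_comp_tensorHom_assoc]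
  simp only [Category.id_comp, Category.assoc]

theorem nest_comp {Y' Z' : C} (r : 𝟙_ C ⟶ P ⊗ Q) (t : 𝟙_ C ⟶ P' ⊗ Q') (f : P ⊗ P' ⟶ Y)
    (g : Q' ⊗ Q ⟶ Z) (f' : Y ⟶ Y') (g' : Z ⟶ Z') :
    nest r t f g ≫ (f' ⊗ₘ g') = nest r t (f ≫ f') (g ≫ g') := by
  simp only [nest, Category.assoc, tensorHom_comp_tensorHom]

end copairing

variable [BraidedCategory C]

/-! ### Convolution with antipodes and with tensor products -/

theorem conv_antipode_left (X : C) [HopfObj X] : conv 𝒮[X] (𝟙 X) = ε[X] ≫ η[X] := by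
  rw [conv_eq, tensorHom_id, HopfObj.antipode_left]

theorem conv_antipode_right (X : C) [HopfObj X] : conv (𝟙 X) 𝒮[X] = ε[X] ≫ η[X] := by
  rw [conv_eq, id_tensorHom, HopfObj.antipode_right]

section tensor_target

variable {X Y Z : C} [ComonObj X] [MonObj Y] [MonObj Z]

theorem conv_inFst_inSnd (f : X ⟶ Y) (g : X ⟶ Z) :
    conv (inFst Z f) (inSnd Y g) = Δ[X] ≫ (f ⊗ₘ g) := by
  have h : ((ρ_ Y).inv ≫ Y ◁ η[Z] ⊗ₘ (λ_ Z).inv ≫ η[Y] ▷ Z) ≫ tensorμ Y Z Y Z ≫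
      (μ[Y] ⊗ₘ μ[Z]) = 𝟙 (Y ⊗ Z) := by
    rw [← tensorHom_comp_tensorHom, Category.assoc, ← id_tensorHom, ← tensorHom_id,
      tensorμ_natural_assoc, tensorHom_comp_tensorHom, id_tensorHom, tensorHom_id,
      MonObj.mul_one, MonObj.one_mul]
    simp only [tensorμ, braiding_tensorUnit_left]
    monoidal
  rw [conv_eq, MonObj.tensorObj.mul_def, inFst, inSnd, ← tensorHom_comp_tensorHom_assoc, h,
    Category.comp_id]

theorem mul_inFst : μ[Y] ≫ inFst Z (𝟙 Y) = (inFst Z (𝟙 Y) ⊗ₘ inFst Z (𝟙 Y)) ≫ μ[Y ⊗ Z] := by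
  simp only [inFst, Category.id_comp]
  rw [MonObj.tensorObj.mul_def, ← tensorHom_comp_tensorHom, Category.assoc, ← id_tensorHom,
    tensorμ_natural_assoc, tensorHom_comp_tensorHom, id_tensorHom_id, Category.id_comp,
    MonoidalCategory.tensorHom_def' η[Z] η[Z], Category.assoc, MonObj.one_mul]
  simp only [tensorμ, braiding_tensorUnit_left, MonoidalCategory.tensorHom_def]
  monoidal

theorem mul_inSnd : μ[Z] ≫ inSnd Y (𝟙 Z) = (inSnd Y (𝟙 Z) ⊗ₘ inSnd Y (𝟙 Z)) ≫ μ[Y ⊗ Z] := by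
  simp only [inSnd, Category.id_comp]
  rw [MonObj.tensorObj.mul_def, ← tensorHom_comp_tensorHom, Category.assoc, ← tensorHom_id,
    tensorμ_natural_assoc, tensorHom_comp_tensorHom, id_tensorHom_id, Category.id_comp,
    MonoidalCategory.tensorHom_def' η[Y] η[Y], Category.assoc, MonObj.one_mul]
  simp only [tensorμ, braiding_tensorUnit_right, MonoidalCategory.tensorHom_def']
  monoidal

theorem conv_inFst_inFst (f g : X ⟶ Y) :
    conv (inFst Z f) (inFst Z g) = inFst Z (conv f g) := by
  rw [inFst_eq_comp f, inFst_eq_comp g, inFst_eq_comp (conv f g), conv_postcomp mul_inFst]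

theorem conv_inSnd_inSnd (f g : X ⟶ Z) :
    conv (inSnd Y f) (inSnd Y g) = inSnd Y (conv f g) := by
  rw [inSnd_eq_comp f, inSnd_eq_comp g, inSnd_eq_comp (conv f g), conv_postcomp mul_inSnd]

theorem inFst_unit : inFst Z (ε[X] ≫ η[Y]) = ε[X] ≫ η[Y ⊗ Z] := by
  simp only [inFst, MonObj.tensorObj.one_def, MonoidalCategory.tensorHom_def]
  monoidal

theorem inSnd_unit : inSnd Y (ε[X] ≫ η[Z]) = ε[X] ≫ η[Y ⊗ Z] := by
  simp only [inSnd, MonObj.tensorObj.one_def, MonoidalCategory.tensorHom_def']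
  monoidal

end tensor_target

section tensor_source

variable {X Y Z : C} [ComonObj X] [ComonObj Y] [MonObj Z]

/-- A morphism from the first factor of a tensor product of comonoids. -/
def outFst (Y : C) [ComonObj Y] (f : X ⟶ Z) : X ⊗ Y ⟶ Z := X ◁ ε[Y] ≫ (ρ_ X).hom ≫ f

/-- A morphism from the second factor of a tensor product of comonoids. -/
def outSnd (X : C) [ComonObj X] (f : Y ⟶ Z) : X ⊗ Y ⟶ Z := ε[X] ▷ Y ≫ (λ_ Y).hom ≫ f

theorem conv_outFst_outSnd (f : X ⟶ Z) (g : Y ⟶ Z) :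
    conv (outFst Y f) (outSnd X g) = (f ⊗ₘ g) ≫ μ[Z] := by
  have h : Δ[X ⊗ Y] ≫ (X ◁ ε[Y] ≫ (ρ_ X).hom ⊗ₘ ε[X] ▷ Y ≫ (λ_ Y).hom) = 𝟙 (X ⊗ Y) := by
    rw [Comon.tensorObj_comul, ← tensorHom_comp_tensorHom, Category.assoc, ← id_tensorHom,
      ← tensorHom_id, ← tensorμ_natural_assoc, tensorHom_comp_tensorHom_assoc, id_tensorHom,
      tensorHom_id, ComonObj.comul_counit, ComonObj.counit_comul]
    simp only [tensorμ, braiding_tensorUnit_right]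
    monoidal
  rw [conv_eq, outFst, outSnd, ← Category.assoc (X ◁ ε[Y]), ← Category.assoc (ε[X] ▷ Y),
    ← tensorHom_comp_tensorHom, Category.assoc, reassoc_of% h]

theorem fst_comul : (X ◁ ε[Y] ≫ (ρ_ X).hom) ≫ Δ[X] =
    Δ[X ⊗ Y] ≫ (X ◁ ε[Y] ≫ (ρ_ X).hom ⊗ₘ X ◁ ε[Y] ≫ (ρ_ X).hom) := by
  rw [Comon.tensorObj_comul, ← tensorHom_comp_tensorHom, Category.assoc, Category.assoc,
    ← id_tensorHom, ← tensorμ_natural_assoc, tensorHom_comp_tensorHom_assoc, id_tensorHom_id,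
    Category.comp_id, MonoidalCategory.tensorHom_def ε[Y] ε[Y], ComonObj.counit_comul_assoc]
  simp only [tensorμ, braiding_tensorUnit_right, MonoidalCategory.tensorHom_def']
  monoidal

theorem snd_comul : (ε[X] ▷ Y ≫ (λ_ Y).hom) ≫ Δ[Y] =
    Δ[X ⊗ Y] ≫ (ε[X] ▷ Y ≫ (λ_ Y).hom ⊗ₘ ε[X] ▷ Y ≫ (λ_ Y).hom) := by
  rw [Comon.tensorObj_comul, ← tensorHom_comp_tensorHom, Category.assoc, Category.assoc,
    ← tensorHom_id, ← tensorμ_natural_assoc, tensorHom_comp_tensorHom_assoc, id_tensorHom_id,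
    Category.comp_id, MonoidalCategory.tensorHom_def ε[X] ε[X], ComonObj.counit_comul_assoc]
  simp only [tensorμ, braiding_tensorUnit_left, MonoidalCategory.tensorHom_def]
  monoidal

theorem conv_outFst_outFst (f g : X ⟶ Z) :
    conv (outFst Y f) (outFst Y g) = outFst Y (conv f g) := by
  simp only [outFst, ← Category.assoc (X ◁ ε[Y])]
  exact (conv_precomp fst_comul f g).symm

theorem conv_outSnd_outSnd (f g : Y ⟶ Z) :
    conv (outSnd X f) (outSnd X g) = outSnd X (conv f g) := by
  simp only [outSnd, ← Category.assoc (ε[X] ▷ Y)]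
  exact (conv_precomp snd_comul f g).symm

theorem outFst_unit : outFst Y (ε[X] ≫ η[Z]) = ε[X ⊗ Y] ≫ η[Z] := by
  simp only [outFst, Comon.tensorObj_counit, MonoidalCategory.tensorHom_def']
  monoidal

theorem outSnd_unit : outSnd X (ε[Y] ≫ η[Z]) = ε[X ⊗ Y] ≫ η[Z] := by
  simp only [outSnd, Comon.tensorObj_counit, MonoidalCategory.tensorHom_def]
  monoidal

end tensor_source

/-! ### Hopf algebras with a projection -/

/-- A projection of a Hopf algebra `H` onto a Hopf algebra `A`: bialgebra morphisms
`i : A ⟶ H` and `p : H ⟶ A` such that `p ∘ i = id`. -/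
structure HopfProjection (A H : C) [HopfObj A] [HopfObj H] where
  i : A ⟶ H
  p : H ⟶ A
  i_mul : μ[A] ≫ i = (i ⊗ₘ i) ≫ μ[H]
  i_one : η[A] ≫ i = η[H]
  i_comul : i ≫ Δ[H] = Δ[A] ≫ (i ⊗ₘ i)
  i_counit : i ≫ ε[H] = ε[A]
  p_mul : μ[H] ≫ p = (p ⊗ₘ p) ≫ μ[A]
  p_one : η[H] ≫ p = η[A]
  p_comul : p ≫ Δ[A] = Δ[H] ≫ (p ⊗ₘ p)
  p_counit : p ≫ ε[A] = ε[H]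
  i_p : i ≫ p = 𝟙 A

namespace HopfProjection

variable {A H : C} [HopfObj A] [HopfObj H] (P : HopfProjection A H)

/-- The left coaction `(p ⊗ id) ∘ Δ` of `A` on `H`. -/
def coact : H ⟶ A ⊗ H := Δ[H] ≫ P.p ▷ H

/-- The left action `m ∘ (i ⊗ id)` of `A` on `H`. -/
def lmul : A ⊗ H ⟶ H := P.i ▷ H ≫ μ[H]

/-- The right action `m ∘ (id ⊗ i)` of `A` on `H`. -/
def rmul : H ⊗ A ⟶ H := H ◁ P.i ≫ μ[H]

/-- The convolution product `(i ∘ S ∘ p) * id`, an idempotent which projects `H` onto its left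
coinvariants. -/
def proj : H ⟶ H := Δ[H] ≫ P.p ▷ H ≫ 𝒮[A] ▷ H ≫ P.i ▷ H ≫ μ[H]

/-- The convolution product `id * (i ∘ S ∘ p)`, which projects `H` onto its right coinvariants. -/
def rproj : H ⟶ H := conv (𝟙 H) (P.p ≫ 𝒮[A] ≫ P.i)

/-- The convolution product `S * (i ∘ p)`. It restricts to the antipode of the left
coinvariants. -/
def sigma : H ⟶ H := conv 𝒮[H] (P.p ≫ P.i)

theorem proj_eq_conv : P.proj = conv (P.p ≫ 𝒮[A] ≫ P.i) (𝟙 H) := by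
  simp only [proj, conv, MonoidalCategory.whiskerLeft_id, Category.id_comp, comp_whiskerRight,
    Category.assoc]

theorem coact_eq_conv : P.coact = conv (inFst H P.p) (inSnd A (𝟙 H)) := by
  rw [conv_inFst_inSnd, coact, tensorHom_id]

theorem lmul_eq_conv : P.lmul = conv (outFst H P.i) (outSnd A (𝟙 H)) := by
  rw [conv_outFst_outSnd, lmul, tensorHom_id]

theorem rmul_eq_conv : P.rmul = conv (outFst A (𝟙 H)) (outSnd H P.i) := by
  rw [conv_outFst_outSnd, rmul, id_tensorHom]

theorem coact_mul : μ[H] ≫ P.coact = (P.coact ⊗ₘ P.coact) ≫ μ[A ⊗ H] := by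
  rw [coact, BimonObj.mul_comul_assoc, MonObj.tensorObj.mul_def, ← tensorHom_comp_tensorHom,
    Category.assoc, ← tensorHom_id P.p, tensorμ_natural_assoc, tensorHom_comp_tensorHom,
    tensorHom_comp_tensorHom, P.p_mul, id_tensorHom_id, Category.id_comp, Category.comp_id]

theorem coact_one : η[H] ≫ P.coact = η[A ⊗ H] := by
  rw [coact, BimonObj.one_comul_assoc, MonObj.tensorObj.one_def, MonObj.tensorObj.one_def,
    Category.assoc, ← tensorHom_id P.p, tensorHom_comp_tensorHom, P.p_one, Category.comp_id]

theorem lmul_comul : P.lmul ≫ Δ[H] = Δ[A ⊗ H] ≫ (P.lmul ⊗ₘ P.lmul) := by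
  rw [lmul, Category.assoc, BimonObj.mul_comul, Comon.tensorObj_comul,
    ← tensorHom_comp_tensorHom, ← tensorHom_id P.i, tensorHom_comp_tensorHom_assoc, P.i_comul,
    Category.id_comp, Category.assoc, ← tensorμ_natural_assoc, tensorHom_comp_tensorHom_assoc,
    id_tensorHom_id, Category.comp_id]

theorem lmul_counit : P.lmul ≫ ε[H] = ε[A ⊗ H] := by
  rw [lmul, Category.assoc, BimonObj.mul_counit, Comon.tensorObj_counit, Comon.tensorObj_counit,
    ← tensorHom_id P.i, tensorHom_comp_tensorHom_assoc, P.i_counit, Category.id_comp]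

theorem rmul_comul : P.rmul ≫ Δ[H] = Δ[H ⊗ A] ≫ (P.rmul ⊗ₘ P.rmul) := by
  rw [rmul, Category.assoc, BimonObj.mul_comul, Comon.tensorObj_comul,
    ← tensorHom_comp_tensorHom, ← id_tensorHom _ P.i, tensorHom_comp_tensorHom_assoc, P.i_comul,
    Category.id_comp, Category.assoc, ← tensorμ_natural_assoc, tensorHom_comp_tensorHom_assoc,
    id_tensorHom_id, Category.comp_id]

theorem conv_pi_pSi : conv (P.p ≫ P.i) (P.p ≫ 𝒮[A] ≫ P.i) = ε[H] ≫ η[H] := by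
  have h1 := conv_precomp P.p_comul P.i (𝒮[A] ≫ P.i)
  have h2 := conv_postcomp P.i_mul (𝟙 A) 𝒮[A]
  rw [Category.id_comp] at h2
  rw [← h1, ← h2, conv_antipode_right, ← P.p_counit, ← P.i_one]
  simp

theorem conv_pSi_pi : conv (P.p ≫ 𝒮[A] ≫ P.i) (P.p ≫ P.i) = ε[H] ≫ η[H] := by
  have h1 := conv_precomp P.p_comul (𝒮[A] ≫ P.i) P.i
  have h2 := conv_postcomp P.i_mul 𝒮[A] (𝟙 A)
  rw [Category.id_comp] at h2
  rw [← h1, ← h2, conv_antipode_left, ← P.p_counit, ← P.i_one]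
  simp

theorem conv_p_pS : conv P.p (P.p ≫ 𝒮[A]) = ε[H] ≫ η[A] := by
  have h1 := conv_precomp P.p_comul (𝟙 A) 𝒮[A]
  rw [Category.comp_id] at h1
  rw [← h1, conv_antipode_right, ← P.p_counit, Category.assoc]

theorem conv_pS_p : conv (P.p ≫ 𝒮[A]) P.p = ε[H] ≫ η[A] := by
  have h1 := conv_precomp P.p_comul 𝒮[A] (𝟙 A)
  rw [Category.comp_id] at h1
  rw [← h1, conv_antipode_left, ← P.p_counit, Category.assoc]

theorem conv_i_Si : conv P.i (𝒮[A] ≫ P.i) = ε[A] ≫ η[H] := by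
  have h := conv_postcomp P.i_mul (𝟙 A) 𝒮[A]
  rw [Category.id_comp] at h
  rw [← h, conv_antipode_right, Category.assoc, P.i_one]

theorem conv_Si_i : conv (𝒮[A] ≫ P.i) P.i = ε[A] ≫ η[H] := by
  have h := conv_postcomp P.i_mul 𝒮[A] (𝟙 A)
  rw [Category.id_comp] at h
  rw [← h, conv_antipode_left, Category.assoc, P.i_one]

/-- Every element of `H` is a product of an element of `A` and a left coinvariant. -/
theorem conv_pi_proj : conv (P.p ≫ P.i) P.proj = 𝟙 H := by
  rw [proj_eq_conv, ← conv_assoc, conv_pi_pSi, unit_conv]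

theorem pi_coact : (P.p ≫ P.i) ≫ P.coact = conv (inFst H P.p) (inSnd A (P.p ≫ P.i)) := by
  rw [conv_inFst_inSnd, coact, Category.assoc, reassoc_of% P.i_comul, reassoc_of% P.p_comul,
    ← tensorHom_id P.p, tensorHom_comp_tensorHom, tensorHom_comp_tensorHom, P.i_p,
    Category.comp_id, Category.comp_id]

/-- Anticomultiplicativity of the antipode, with the first leg projected to `A`. -/
theorem antipode_coact :
    𝒮[H] ≫ P.coact = conv (inSnd A 𝒮[H]) (inFst H (P.p ≫ 𝒮[A])) := by
  refine conv_inverse_unique (f := P.coact) ?_ ?_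
  · have h := conv_postcomp P.coact_mul 𝒮[H] (𝟙 H)
    rw [Category.id_comp] at h
    rw [← h, conv_antipode_left, Category.assoc, P.coact_one]
  · rw [coact_eq_conv, conv_assoc, ← conv_assoc (inSnd A (𝟙 H)), conv_inSnd_inSnd,
      conv_antipode_right, inSnd_unit, unit_conv, conv_inFst_inFst, conv_p_pS, inFst_unit]

theorem pSi_coact : (P.p ≫ 𝒮[A] ≫ P.i) ≫ P.coact =
    conv (inSnd A (P.p ≫ 𝒮[A] ≫ P.i)) (inFst H (P.p ≫ 𝒮[A])) := by
  refine conv_inverse_unique (f := (P.p ≫ P.i) ≫ P.coact) ?_ ?_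
  · rw [← conv_postcomp P.coact_mul, conv_pSi_pi, Category.assoc, P.coact_one]
  · rw [pi_coact, conv_assoc, ← conv_assoc (inSnd A (P.p ≫ P.i)), conv_inSnd_inSnd,
      conv_pi_pSi, inSnd_unit, unit_conv, conv_inFst_inFst, conv_p_pS, inFst_unit]

/-- The image of `proj` consists of left coinvariants. -/
theorem proj_coact : P.proj ≫ P.coact = inSnd A P.proj := by
  rw [proj_eq_conv, conv_postcomp P.coact_mul, pSi_coact, Category.id_comp, coact_eq_conv,
    conv_assoc, ← conv_assoc (inFst H (P.p ≫ 𝒮[A])), conv_inFst_inFst, conv_pS_p, inFst_unit,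
    unit_conv, conv_inSnd_inSnd]

/-- The image of `sigma` consists of left coinvariants. -/
theorem sigma_coact : P.sigma ≫ P.coact = inSnd A P.sigma := by
  rw [sigma, conv_postcomp P.coact_mul, antipode_coact, pi_coact,
    conv_assoc, ← conv_assoc (inFst H (P.p ≫ 𝒮[A])), conv_inFst_inFst, conv_pS_p, inFst_unit,
    unit_conv, conv_inSnd_inSnd]

theorem lmul_antipode :
    P.lmul ≫ 𝒮[H] = conv (outSnd A 𝒮[H]) (outFst H (𝒮[A] ≫ P.i)) := by
  refine conv_inverse_unique (f := P.lmul) ?_ ?_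
  · have h := conv_precomp P.lmul_comul 𝒮[H] (𝟙 H)
    rw [Category.comp_id] at h
    rw [← h, conv_antipode_left, reassoc_of% P.lmul_counit]
  · rw [lmul_eq_conv, conv_assoc, ← conv_assoc (outSnd A (𝟙 H)), conv_outSnd_outSnd,
      conv_antipode_right, outSnd_unit, unit_conv, conv_outFst_outFst, conv_i_Si, outFst_unit]

theorem lmul_pi : P.lmul ≫ P.p ≫ P.i = conv (outFst H P.i) (outSnd A (P.p ≫ P.i)) := by
  rw [conv_outFst_outSnd, lmul, Category.assoc, reassoc_of% P.p_mul, P.i_mul, ← tensorHom_id P.i,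
    tensorHom_comp_tensorHom_assoc, tensorHom_comp_tensorHom_assoc, P.i_p, Category.id_comp,
    Category.id_comp]

theorem lmul_pSi : P.lmul ≫ P.p ≫ 𝒮[A] ≫ P.i =
    conv (outSnd A (P.p ≫ 𝒮[A] ≫ P.i)) (outFst H (𝒮[A] ≫ P.i)) := by
  refine conv_inverse_unique (f := P.lmul ≫ P.p ≫ P.i) ?_ ?_
  · rw [← conv_precomp P.lmul_comul, conv_pSi_pi, reassoc_of% P.lmul_counit]
  · rw [lmul_pi, conv_assoc, ← conv_assoc (outSnd A (P.p ≫ P.i)), conv_outSnd_outSnd,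
      conv_pi_pSi, outSnd_unit, unit_conv, conv_outFst_outFst, conv_i_Si, outFst_unit]

/-- `proj` is invariant under the left action of `A`, so that its image is also the quotient of `H`
by this action. -/
theorem lmul_proj : P.lmul ≫ P.proj = outSnd A P.proj := by
  rw [proj_eq_conv, conv_precomp P.lmul_comul, lmul_pSi, Category.comp_id, lmul_eq_conv,
    conv_assoc, ← conv_assoc (outFst H (𝒮[A] ≫ P.i)), conv_outFst_outFst, conv_Si_i,
    outFst_unit, unit_conv, conv_outSnd_outSnd]

theorem lmul_sigma : P.lmul ≫ P.sigma = outSnd A P.sigma := by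
  rw [sigma, conv_precomp P.lmul_comul, lmul_antipode, lmul_pi,
    conv_assoc, ← conv_assoc (outFst H (𝒮[A] ≫ P.i)), conv_outFst_outFst, conv_Si_i,
    outFst_unit, unit_conv, conv_outSnd_outSnd]

theorem rmul_pi : P.rmul ≫ P.p ≫ P.i = conv (outFst A (P.p ≫ P.i)) (outSnd H P.i) := by
  rw [conv_outFst_outSnd, rmul, Category.assoc, reassoc_of% P.p_mul, P.i_mul, ← id_tensorHom _ P.i,
    tensorHom_comp_tensorHom_assoc, tensorHom_comp_tensorHom_assoc, P.i_p, Category.id_comp,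
    Category.id_comp]

theorem rmul_pSi : P.rmul ≫ P.p ≫ 𝒮[A] ≫ P.i =
    conv (outSnd H (𝒮[A] ≫ P.i)) (outFst A (P.p ≫ 𝒮[A] ≫ P.i)) := by
  refine conv_inverse_unique (f := conv (outFst A (P.p ≫ P.i)) (outSnd H P.i)) ?_ ?_
  · rw [← rmul_pi, ← conv_precomp P.rmul_comul, conv_pSi_pi, rmul, Category.assoc,
      BimonObj.mul_counit_assoc, Comon.tensorObj_counit, Comon.tensorObj_counit,
      ← id_tensorHom _ P.i]
    simp only [Category.assoc, tensorHom_comp_tensorHom_assoc, P.i_counit, Category.id_comp]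
  · rw [conv_assoc, ← conv_assoc (outSnd H P.i), conv_outSnd_outSnd,
      conv_i_Si, outSnd_unit, unit_conv, conv_outFst_outFst, conv_pi_pSi, outFst_unit]

theorem rmul_rproj : P.rmul ≫ P.rproj = outFst A P.rproj := by
  rw [rproj, conv_precomp P.rmul_comul, rmul_pSi, Category.comp_id, rmul_eq_conv,
    conv_assoc, ← conv_assoc (outSnd H P.i), conv_outSnd_outSnd, conv_i_Si,
    outSnd_unit, unit_conv, conv_outFst_outFst]

end HopfProjection

/-! ### The coinvariants of a projection -/

namespace HopfProjection

variable {A H : C} [HopfObj A] [HopfObj H] (P : HopfProjection A H)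

/-- A left inverse of `h ↦ 1 ⊗ h` through which `proj` factors. -/
def invLmul : A ⊗ H ⟶ H := 𝒮[A] ▷ H ≫ P.i ▷ H ≫ μ[H]

theorem coact_invLmul : P.coact ≫ P.invLmul = P.proj := by
  simp only [coact, invLmul, proj, Category.assoc]

theorem unit_invLmul : inSnd A (𝟙 H) ≫ P.invLmul = 𝟙 H := by
  simp only [inSnd, invLmul, ← comp_whiskerRight_assoc, Category.assoc, HopfObj.one_antipode_assoc,
    P.i_one, MonObj.one_mul, Category.id_comp, Iso.inv_hom_id]

/-- A section of the left action of `A` on `H`, through which `proj` factors. -/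
def split : H ⟶ A ⊗ H := Δ[H] ≫ (P.p ⊗ₘ P.proj)

theorem split_lmul : P.split ≫ P.lmul = 𝟙 H := by
  rw [← conv_pi_proj P, conv_eq, split, lmul, Category.assoc, ← tensorHom_id P.i,
    tensorHom_comp_tensorHom_assoc, Category.comp_id]

theorem split_counit : P.split ≫ ε[A] ▷ H ≫ (λ_ H).hom = P.proj := by
  rw [split, ← tensorHom_id, Category.assoc, tensorHom_comp_tensorHom_assoc, P.p_counit,
    Category.comp_id, MonoidalCategory.tensorHom_def, Category.assoc, ComonObj.counit_comul_assoc]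
  monoidal

/-- A morphism which is invariant under the left action of `A` factors through `proj`. -/
theorem proj_comp {Z : C} {f : H ⟶ Z} (hf : P.lmul ≫ f = ε[A] ▷ H ≫ (λ_ H).hom ≫ f) :
    P.proj ≫ f = f := by
  rw [← split_counit, Category.assoc, Category.assoc, ← hf, ← Category.assoc, split_lmul,
    Category.id_comp]

theorem proj_whiskerRight_comp {Y Z : C} {f : H ⊗ Y ⟶ Z}
    (hf : P.lmul ▷ Y ≫ f = (ε[A] ▷ H ≫ (λ_ H).hom) ▷ Y ≫ f) : P.proj ▷ Y ≫ f = f := by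
  rw [← split_counit, comp_whiskerRight, Category.assoc, ← hf, ← comp_whiskerRight_assoc,
    split_lmul, id_whiskerRight, Category.id_comp]

/-- A morphism into the left coinvariants is fixed by `proj`. -/
theorem comp_proj {Z : C} {f : Z ⟶ H} (hf : f ≫ P.coact = inSnd A f) : f ≫ P.proj = f := by
  rw [← coact_invLmul, ← Category.assoc, hf, inSnd_eq_comp, Category.assoc, unit_invLmul,
    Category.comp_id]

theorem comp_proj_whiskerRight {Y Z : C} {f : Z ⟶ H ⊗ Y}
    (hf : f ≫ P.coact ▷ Y = f ≫ inSnd A (𝟙 H) ▷ Y) : f ≫ P.proj ▷ Y = f := by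
  rw [← coact_invLmul, comp_whiskerRight, ← Category.assoc, hf, Category.assoc,
    ← comp_whiskerRight, unit_invLmul, id_whiskerRight, Category.comp_id]

end HopfProjection

/-- A Hopf algebra projection of `H` onto `A` together with a splitting
`H ⟶ B ⟶ H` of the idempotent `proj`. Thus `B` is both the subobject of left coinvariants of `H`
(via `inc`) and the quotient of `H` by the left action of `A` (via `quo`). -/
structure HopfSplitting (A H B : C) [HopfObj A] [HopfObj H] extends HopfProjection A H where
  inc : B ⟶ H
  quo : H ⟶ B
  inc_quo : inc ≫ quo = 𝟙 B
  quo_inc : quo ≫ inc = toHopfProjection.proj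

namespace HopfSplitting

variable {A H B : C} [HopfObj A] [HopfObj H] (P : HopfSplitting A H B)

theorem inc_proj : P.inc ≫ P.proj = P.inc := by
  rw [← P.quo_inc, reassoc_of% P.inc_quo]

theorem proj_quo : P.proj ≫ P.quo = P.quo := by
  rw [← P.quo_inc, Category.assoc, P.inc_quo, Category.comp_id]

theorem cancel_inc {Z : C} {f g : Z ⟶ B} (h : f ≫ P.inc = g ≫ P.inc) : f = g := by
  rw [← Category.comp_id f, ← Category.comp_id g, ← P.inc_quo, reassoc_of% h]

theorem cancel_quo {Z : C} {f g : B ⟶ Z} (h : P.quo ≫ f = P.quo ≫ g) : f = g := by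
  rw [← Category.id_comp f, ← Category.id_comp g, ← P.inc_quo, Category.assoc, h, Category.assoc]

theorem cancel_inc_whiskerRight {Y Z : C} {f g : Z ⟶ B ⊗ Y}
    (h : f ≫ P.inc ▷ Y = g ≫ P.inc ▷ Y) : f = g := by
  rw [← Category.comp_id f, ← Category.comp_id g, ← id_whiskerRight, ← P.inc_quo,
    comp_whiskerRight, reassoc_of% h]

theorem cancel_quo_whiskerRight {Y Z : C} {f g : B ⊗ Y ⟶ Z}
    (h : P.quo ▷ Y ≫ f = P.quo ▷ Y ≫ g) : f = g := by
  rw [← Category.id_comp f, ← Category.id_comp g, ← id_whiskerRight, ← P.inc_quo,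
    comp_whiskerRight, Category.assoc, h, Category.assoc]

theorem inc_coact : P.inc ≫ P.coact = inSnd A P.inc := by
  rw [← inc_proj, Category.assoc, P.proj_coact, inSnd_eq_comp, inSnd_eq_comp (P.inc ≫ P.proj),
    Category.assoc]

theorem lmul_quo : P.lmul ≫ P.quo = ε[A] ▷ H ≫ (λ_ H).hom ≫ P.quo := by
  rw [← proj_quo, reassoc_of% P.lmul_proj, outSnd]
  simp only [Category.assoc]

/-- The right coaction of `H` on the left coinvariants, a restriction of the comultiplication. -/
def rcoact : B ⟶ B ⊗ H := P.inc ≫ Δ[H] ≫ P.quo ▷ H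

/-- The right action of `H` on the quotient `B` of `H`, induced by the multiplication. -/
def ract : B ⊗ H ⟶ B := P.inc ▷ H ≫ μ[H] ≫ P.quo

/-- The coinvariants are a right coideal. -/
theorem rcoact_inc : P.rcoact ≫ P.inc ▷ H = P.inc ≫ Δ[H] := by
  have h : (P.inc ≫ Δ[H]) ≫ P.coact ▷ H = (P.inc ≫ Δ[H]) ≫ inSnd A (𝟙 H) ▷ H := by
    have h1 : Δ[H] ≫ P.coact ▷ H = P.coact ≫ A ◁ Δ[H] ≫ (α_ A H H).inv := by
      simp only [HopfProjection.coact, comp_whiskerRight, Category.assoc, ← whisker_exchange_assoc]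
      rw [ComonObj.comul_assoc_flip_assoc]
      simp
    rw [Category.assoc, h1, reassoc_of% P.inc_coact, inSnd, inSnd]
    simp only [Category.assoc, ← whisker_exchange_assoc]
    monoidal
  have h2 := P.comp_proj_whiskerRight h
  simpa only [rcoact, Category.assoc, ← comp_whiskerRight, P.quo_inc] using h2

/-- Dually to `rcoact_inc`, the right multiplication of `H` descends to the quotient `B`. -/
theorem quo_ract : P.quo ▷ H ≫ P.ract = μ[H] ≫ P.quo := by
  rw [ract, ← comp_whiskerRight_assoc, P.quo_inc]
  apply P.proj_whiskerRight_comp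
  have h : P.lmul ▷ H ≫ μ[H] = (α_ A H H).hom ≫ A ◁ μ[H] ≫ P.lmul := by
    simp only [HopfProjection.lmul, comp_whiskerRight, Category.assoc, MonObj.mul_assoc]
    rw [whisker_exchange_assoc]
    simp
  rw [reassoc_of% h, lmul_quo, whisker_exchange_assoc]
  monoidal

/-- The multiplication of `B`, which makes `inc` a morphism of algebras. -/
def mul : B ⊗ B ⟶ B := (P.inc ⊗ₘ P.inc) ≫ μ[H] ≫ P.quo

/-- The unit of `B`. -/
def one : 𝟙_ C ⟶ B := η[H] ≫ P.quo

/-- The comultiplication of `B`, which makes `quo` a morphism of coalgebras. -/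
def comul : B ⟶ B ⊗ B := P.inc ≫ Δ[H] ≫ (P.quo ⊗ₘ P.quo)

/-- The counit of `B`. -/
def counit : B ⟶ 𝟙_ C := P.inc ≫ ε[H]

theorem one_inc : P.one ≫ P.inc = η[H] := by
  rw [one, Category.assoc, P.quo_inc]
  apply P.comp_proj
  rw [P.coact_one, inSnd, MonObj.tensorObj.one_def, MonoidalCategory.tensorHom_def']
  monoidal

theorem mul_inc : P.mul ≫ P.inc = (P.inc ⊗ₘ P.inc) ≫ μ[H] := by
  have h := P.comp_proj (f := (P.inc ⊗ₘ P.inc) ≫ μ[H]) (by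
    rw [Category.assoc, P.coact_mul, tensorHom_comp_tensorHom_assoc, inc_coact,
      inSnd_eq_comp P.inc, ← tensorHom_comp_tensorHom, Category.assoc, ← mul_inSnd,
      inSnd_eq_comp (_ ≫ _), Category.assoc])
  simpa only [mul, Category.assoc, P.quo_inc] using h

theorem quo_counit : P.quo ≫ P.counit = ε[H] := by
  rw [counit, ← Category.assoc, P.quo_inc]
  apply P.proj_comp
  rw [P.lmul_counit, Comon.tensorObj_counit, MonoidalCategory.tensorHom_def, Category.assoc]
  monoidal

theorem quo_comul : P.quo ≫ P.comul = Δ[H] ≫ (P.quo ⊗ₘ P.quo) := by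
  rw [comul, ← Category.assoc, P.quo_inc]
  apply P.proj_comp
  have h := snd_comul (X := A) (Y := H)
  simp only [Category.assoc] at h
  rw [reassoc_of% P.lmul_comul, reassoc_of% h, tensorHom_comp_tensorHom, tensorHom_comp_tensorHom,
    lmul_quo, Category.assoc]

theorem mul_eq_ract : P.mul = B ◁ P.inc ≫ P.ract := by
  rw [mul, ract, MonoidalCategory.tensorHom_def', Category.assoc]

theorem comul_eq_rcoact : P.comul = P.rcoact ≫ B ◁ P.quo := by
  rw [comul, rcoact, MonoidalCategory.tensorHom_def, Category.assoc, Category.assoc]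

theorem mul_assoc : P.mul ▷ B ≫ P.mul = (α_ B B B).hom ≫ B ◁ P.mul ≫ P.mul := by
  apply P.cancel_inc
  simp only [Category.assoc, mul_inc]
  have h1 : P.mul ▷ B ≫ (P.inc ⊗ₘ P.inc) = ((P.inc ⊗ₘ P.inc) ⊗ₘ P.inc) ≫ μ[H] ▷ H := by
    rw [← tensorHom_id, tensorHom_comp_tensorHom, mul_inc, ← tensorHom_id, tensorHom_comp_tensorHom]
    simp
  have h2 : B ◁ P.mul ≫ (P.inc ⊗ₘ P.inc) = (P.inc ⊗ₘ (P.inc ⊗ₘ P.inc)) ≫ H ◁ μ[H] := by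
    rw [← id_tensorHom, tensorHom_comp_tensorHom, mul_inc, ← id_tensorHom, tensorHom_comp_tensorHom]
    simp
  rw [reassoc_of% h1, reassoc_of% h2, MonObj.mul_assoc, associator_naturality_assoc]

theorem comul_assoc : P.comul ≫ B ◁ P.comul = P.comul ≫ P.comul ▷ B ≫ (α_ B B B).hom := by
  apply P.cancel_quo
  rw [reassoc_of% P.quo_comul, reassoc_of% P.quo_comul]
  have h1 : (P.quo ⊗ₘ P.quo) ≫ P.comul ▷ B = Δ[H] ▷ H ≫ ((P.quo ⊗ₘ P.quo) ⊗ₘ P.quo) := by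
    rw [← tensorHom_id, tensorHom_comp_tensorHom, quo_comul, ← tensorHom_id,
      tensorHom_comp_tensorHom]
    simp
  have h2 : (P.quo ⊗ₘ P.quo) ≫ B ◁ P.comul = H ◁ Δ[H] ≫ (P.quo ⊗ₘ (P.quo ⊗ₘ P.quo)) := by
    rw [← id_tensorHom, tensorHom_comp_tensorHom, quo_comul, ← id_tensorHom,
      tensorHom_comp_tensorHom]
    simp
  rw [reassoc_of% h1, h2, associator_naturality, ComonObj.comul_assoc_assoc]

theorem one_mul : P.one ▷ B ≫ P.mul = (λ_ B).hom := by
  apply P.cancel_inc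
  rw [Category.assoc, mul_inc, ← tensorHom_id, tensorHom_comp_tensorHom_assoc, one_inc,
    MonoidalCategory.tensorHom_def', Category.assoc, MonObj.one_mul, Category.id_comp,
    leftUnitor_naturality]

theorem mul_one : B ◁ P.one ≫ P.mul = (ρ_ B).hom := by
  apply P.cancel_inc
  rw [Category.assoc, mul_inc, ← id_tensorHom, tensorHom_comp_tensorHom_assoc, one_inc,
    MonoidalCategory.tensorHom_def, Category.assoc, MonObj.mul_one, Category.id_comp,
    rightUnitor_naturality]

theorem counit_comul : P.comul ≫ P.counit ▷ B = (λ_ B).inv := by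
  apply P.cancel_quo
  rw [reassoc_of% P.quo_comul, ← tensorHom_id, tensorHom_comp_tensorHom, quo_counit,
    MonoidalCategory.tensorHom_def, ComonObj.counit_comul_assoc, Category.comp_id,
    leftUnitor_inv_naturality]

theorem comul_counit : P.comul ≫ B ◁ P.counit = (ρ_ B).inv := by
  apply P.cancel_quo
  rw [reassoc_of% P.quo_comul, ← id_tensorHom, tensorHom_comp_tensorHom, quo_counit,
    MonoidalCategory.tensorHom_def', ComonObj.comul_counit_assoc, Category.comp_id,
    rightUnitor_inv_naturality]

/-- The isomorphism `H ≅ A ⊗ B` of a Hopf algebra with the tensor product of a projection and its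
left coinvariants. -/
@[simps]
def iso : H ≅ A ⊗ B where
  hom := Δ[H] ≫ (P.p ⊗ₘ P.quo)
  inv := (P.i ⊗ₘ P.inc) ≫ μ[H]
  hom_inv_id := by
    rw [Category.assoc, tensorHom_comp_tensorHom_assoc, P.quo_inc, ← conv_eq, P.conv_pi_proj]
  inv_hom_id := by
    have h1 : P.coact ≫ A ◁ P.quo = Δ[H] ≫ (P.p ⊗ₘ P.quo) := by
      rw [HopfProjection.coact, Category.assoc, ← MonoidalCategory.tensorHom_def]
    have h2 : P.i ≫ P.coact = Δ[A] ≫ A ◁ P.i := by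
      rw [HopfProjection.coact, reassoc_of% P.i_comul, ← tensorHom_id, tensorHom_comp_tensorHom,
        P.i_p, Category.comp_id, id_tensorHom]
    have h3 : (A ◁ P.i ⊗ₘ inSnd A (𝟙 H)) ≫ μ[A ⊗ H] = (α_ A A H).hom ≫ A ◁ P.lmul := by
      have h : (A ◁ P.i ⊗ₘ inSnd A (𝟙 H)) =
          (A ⊗ A) ◁ (λ_ H).inv ≫ ((𝟙 A ⊗ₘ P.i) ⊗ₘ (η[A] ⊗ₘ 𝟙 H)) := by
        rw [inSnd, id_tensorHom, tensorHom_id, Category.id_comp, ← id_tensorHom (A ⊗ A),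
          tensorHom_comp_tensorHom, Category.id_comp]
      rw [h, MonObj.tensorObj.mul_def, Category.assoc, tensorμ_natural_assoc,
        tensorHom_comp_tensorHom, id_tensorHom, MonObj.mul_one, tensorHom_id,
        MonoidalCategory.tensorHom_def']
      simp only [tensorμ, braiding_tensorUnit_right, HopfProjection.lmul]
      monoidal
    have h4 : Δ[A] ▷ B ≫ (α_ A A B).hom ≫ A ◁ ε[A] ▷ B ≫ A ◁ (λ_ B).hom = 𝟙 _ := by
      have := ComonObj.comul_counit A
      calc
        _ = (Δ[A] ≫ A ◁ ε[A]) ▷ B ⊗≫ 𝟙 _ := by monoidal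
        _ = _ := by rw [this]; monoidal
    rw [← h1, Category.assoc, reassoc_of% P.coact_mul, tensorHom_comp_tensorHom_assoc, h2,
      inc_coact, inSnd_eq_comp P.inc, ← tensorHom_comp_tensorHom_assoc, reassoc_of% h3,
      ← MonoidalCategory.whiskerLeft_comp, lmul_quo, MonoidalCategory.tensorHom_def]
    simp only [MonoidalCategory.whiskerLeft_comp, Category.assoc]
    rw [associator_naturality_right_assoc, ← MonoidalCategory.whiskerLeft_comp_assoc,
      whisker_exchange]
    simp only [MonoidalCategory.whiskerLeft_comp, Category.assoc]
    have h5 : A ◁ 𝟙_ C ◁ P.inc ≫ A ◁ (λ_ H).hom = A ◁ (λ_ B).hom ≫ A ◁ P.inc := by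
      rw [← MonoidalCategory.whiskerLeft_comp, leftUnitor_naturality,
        MonoidalCategory.whiskerLeft_comp]
    rw [reassoc_of% h5, reassoc_of% h4, ← MonoidalCategory.whiskerLeft_comp, P.inc_quo,
      MonoidalCategory.whiskerLeft_id]

end HopfSplitting

/-! ### The antipode of the coinvariants -/

namespace HopfProjection

variable {A H : C} [HopfObj A] [HopfObj H] (P : HopfProjection A H)

theorem p_antipode : P.p ≫ 𝒮[A] = 𝒮[H] ≫ P.p := by
  refine conv_inverse_unique P.conv_pS_p ?_
  have h := conv_postcomp P.p_mul (𝟙 H) 𝒮[H]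
  rw [Category.id_comp] at h
  rw [← h, conv_antipode_right, Category.assoc, P.p_one]

theorem i_antipode : 𝒮[A] ≫ P.i = P.i ≫ 𝒮[H] := by
  refine conv_inverse_unique P.conv_Si_i ?_
  have h := conv_precomp P.i_comul (𝟙 H) 𝒮[H]
  rw [Category.comp_id] at h
  rw [← h, conv_antipode_right, reassoc_of% P.i_counit]

/-- The antipode exchanges left and right coinvariants. -/
theorem antipode_rproj : 𝒮[H] ≫ P.rproj = P.proj ≫ 𝒮[H] := by
  have h : (P.p ≫ 𝒮[A] ≫ P.i) ≫ 𝒮[H] = 𝒮[H] ≫ P.p ≫ 𝒮[A] ≫ P.i := by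
    rw [← reassoc_of% P.p_antipode, Category.assoc, Category.assoc, ← P.i_antipode]
  rw [rproj, proj_eq_conv, conv_eq, conv_eq, Category.assoc, Category.assoc, HopfObj.mul_antipode,
    ← Category.assoc 𝒮[H] Δ[H], HopfObj.antipode_comul, tensorHom_comp_tensorHom_assoc, h,
    BraidedCategory.braiding_naturality_assoc]
  simp only [Category.id_comp, Category.assoc, tensorHom_comp_tensorHom_assoc, Category.comp_id]

/-- After projection to the right coinvariants, `sigma` agrees with the antipode of `H`. With
`antipode_rproj` this inverts the antipode of the left coinvariants. -/
theorem sigma_rproj : P.sigma ≫ P.rproj = 𝒮[H] ≫ P.rproj := by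
  have h : P.sigma = Δ[H] ≫ (𝒮[H] ⊗ₘ P.p) ≫ P.rmul := by
    rw [sigma, conv_eq, rmul, ← id_tensorHom, tensorHom_comp_tensorHom_assoc, Category.comp_id]
  rw [h, Category.assoc, Category.assoc, P.rmul_rproj, outFst, ← id_tensorHom,
    tensorHom_comp_tensorHom_assoc, P.p_counit, MonoidalCategory.tensorHom_def', Category.assoc,
    ComonObj.comul_counit_assoc, rightUnitor_naturality_assoc, Iso.inv_hom_id_assoc,
    Category.comp_id]

/-- The value of `sigma` on a product with an element of `A`. The first factor on the right-hand
side lies in `A` and disappears in the quotient `B`, so that the antipode of `B` is a morphism of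
modules. -/
theorem rmul_sigma : P.rmul ≫ P.sigma =
    conv (outSnd H (𝒮[A] ≫ P.i)) (P.sigma ▷ A ≫ P.rmul) := by
  have h : P.rmul ≫ 𝒮[H] = conv (outSnd H (𝒮[A] ≫ P.i)) (outFst A 𝒮[H]) := by
    refine conv_inverse_unique (f := P.rmul) ?_ ?_
    · have h := conv_precomp P.rmul_comul 𝒮[H] (𝟙 H)
      rw [Category.comp_id] at h
      rw [← h, conv_antipode_left, rmul, Category.assoc,
        BimonObj.mul_counit_assoc, Comon.tensorObj_counit, Comon.tensorObj_counit,
        ← id_tensorHom _ P.i]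
      simp only [Category.assoc, tensorHom_comp_tensorHom_assoc, P.i_counit, Category.id_comp]
    · rw [rmul_eq_conv, conv_assoc, ← conv_assoc (outSnd H P.i), conv_outSnd_outSnd,
        conv_i_Si, outSnd_unit, unit_conv, conv_outFst_outFst, conv_antipode_right, outFst_unit]
  have h2 : P.sigma ▷ A ≫ P.rmul = conv (outFst A P.sigma) (outSnd H P.i) := by
    rw [conv_outFst_outSnd, rmul, MonoidalCategory.tensorHom_def, Category.assoc]
  rw [h2, sigma, conv_precomp P.rmul_comul, h, rmul_pi, conv_assoc, ← conv_assoc (outFst A 𝒮[H]),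
    conv_outFst_outFst]

end HopfProjection

namespace HopfSplitting

variable {A H B : C} [HopfObj A] [HopfObj H] (P : HopfSplitting A H B)

/-- The antipode of `B`. -/
def antipode : B ⟶ B := P.inc ≫ P.sigma ≫ P.quo

theorem quo_antipode : P.quo ≫ P.antipode = P.sigma ≫ P.quo := by
  rw [antipode, ← Category.assoc, P.quo_inc, P.proj_comp]
  rw [reassoc_of% P.lmul_sigma, outSnd]
  simp only [Category.assoc]

theorem sigma_proj : P.sigma ≫ P.proj = P.sigma := P.comp_proj P.sigma_coact

theorem antipode_inc : P.antipode ≫ P.inc = P.inc ≫ P.sigma := by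
  rw [antipode, Category.assoc, Category.assoc, P.quo_inc, sigma_proj]

theorem antipode_left : P.comul ≫ P.antipode ▷ B ≫ P.mul = P.counit ≫ P.one := by
  apply P.cancel_quo
  rw [reassoc_of% P.quo_comul, reassoc_of% P.quo_counit, ← tensorHom_id, mul,
    tensorHom_comp_tensorHom_assoc, tensorHom_comp_tensorHom_assoc, quo_antipode, Category.assoc,
    Category.comp_id, P.quo_inc, sigma_proj, one]
  have h : conv P.sigma P.proj = ε[H] ≫ η[H] := by
    rw [HopfProjection.sigma, conv_assoc, P.conv_pi_proj, conv_antipode_left]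
  rw [conv_eq] at h
  rw [reassoc_of% h]

theorem antipode_right : P.comul ≫ B ◁ P.antipode ≫ P.mul = P.counit ≫ P.one := by
  apply P.cancel_quo
  rw [reassoc_of% P.quo_comul, reassoc_of% P.quo_counit, ← id_tensorHom, mul,
    tensorHom_comp_tensorHom_assoc, tensorHom_comp_tensorHom_assoc, quo_antipode, Category.assoc,
    Category.id_comp, P.quo_inc, Category.assoc, P.quo_inc, sigma_proj, one]
  have h : conv P.proj P.sigma = ε[H] ≫ η[H] := by
    rw [HopfProjection.sigma, P.proj_eq_conv, conv_assoc, ← conv_assoc (𝟙 H), conv_antipode_right,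
      unit_conv, P.conv_pSi_pi]
  rw [conv_eq] at h
  rw [reassoc_of% h]

/-- The antipode of `B` is a split monomorphism, with a retraction induced by the inverse antipode
of `H`. -/
theorem antipode_inv [IsIso 𝒮[H]] : P.antipode ≫ P.inc ≫ inv 𝒮[H] ≫ P.quo = 𝟙 B := by
  have h : P.rproj ≫ inv 𝒮[H] = inv 𝒮[H] ≫ P.proj := by
    rw [IsIso.comp_inv_eq, Category.assoc, ← P.antipode_rproj, IsIso.inv_hom_id_assoc]
  rw [reassoc_of% P.antipode_inc, ← P.proj_quo, ← reassoc_of% h, reassoc_of% P.sigma_rproj,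
    reassoc_of% P.antipode_rproj, IsIso.hom_inv_id_assoc, P.proj_quo, P.inc_quo]

theorem inv_antipode [IsIso 𝒮[A]] [IsIso 𝒮[H]] :
    (P.inc ≫ inv 𝒮[H] ≫ P.quo) ≫ P.antipode = 𝟙 B := by
  have h1 : inv 𝒮[H] ≫ Δ[H] = Δ[H] ≫ (β_ H H).inv ≫ (inv 𝒮[H] ⊗ₘ inv 𝒮[H]) := by
    rw [IsIso.inv_comp_eq, ← Category.assoc 𝒮[H], HopfObj.antipode_comul]
    simp only [Category.assoc, BraidedCategory.braiding_inv_naturality_assoc,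
      tensorHom_comp_tensorHom]
    simp
  have h2 : inv 𝒮[H] ≫ P.p = P.p ≫ inv 𝒮[A] := by
    rw [IsIso.inv_comp_eq, ← reassoc_of% P.p_antipode, IsIso.hom_inv_id, Category.comp_id]
  have h3 : P.inc ≫ inv 𝒮[H] ≫ P.sigma = P.inc := by
    have h4 : η[A] ≫ inv 𝒮[A] ≫ P.i = η[H] := by
      rw [← P.i_one, ← Category.assoc, (IsIso.comp_inv_eq _).2 (HopfObj.one_antipode A).symm]
    have h5 : P.sigma = Δ[H] ≫ (𝒮[H] ⊗ₘ P.p ≫ P.i) ≫ μ[H] := conv_eq _ _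
    have h6 : (β_ H H).inv ≫ (𝟙 H ⊗ₘ P.p ≫ inv 𝒮[A] ≫ P.i) =
        P.p ▷ H ≫ (inv 𝒮[A] ≫ P.i) ▷ H ≫ (β_ H H).inv := by
      rw [id_tensorHom, ← comp_whiskerRight_assoc, BraidedCategory.braiding_inv_naturality_left]
    have h7 : P.inc ≫ Δ[H] ≫ P.p ▷ H = P.inc ≫ (λ_ H).inv ≫ η[A] ▷ H := P.inc_coact
    rw [h5, reassoc_of% h1, tensorHom_comp_tensorHom_assoc, IsIso.inv_hom_id, reassoc_of% h2,
      reassoc_of% h6, reassoc_of% h7, ← comp_whiskerRight_assoc, h4,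
      BraidedCategory.braiding_inv_naturality_left_assoc, MonObj.mul_one]
    simp
  rw [Category.assoc, Category.assoc, P.quo_antipode, reassoc_of% h3, P.inc_quo]

theorem isIso_antipode [IsIso 𝒮[A]] [IsIso 𝒮[H]] : IsIso P.antipode :=
  ⟨_, P.antipode_inv, P.inv_antipode⟩

end HopfSplitting

/-! ### The crossed module structure of the coinvariants -/

namespace HopfSplitting

variable {A H B : C} [HopfObj A] [HopfObj H] (P : HopfSplitting A H B)

/-- The right action of `A` on `B`. -/
def act : B ⊗ A ⟶ B := B ◁ P.i ≫ P.ract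

/-- The right coaction of `A` on `B`. -/
def coactA : B ⟶ B ⊗ A := P.rcoact ≫ B ◁ P.p

theorem ract_one : B ◁ η[H] ≫ P.ract = (ρ_ B).hom := by
  rw [ract, whisker_exchange_assoc, MonObj.mul_one_assoc, rightUnitor_naturality_assoc, P.inc_quo,
    Category.comp_id]

theorem ract_mul : B ◁ μ[H] ≫ P.ract = (α_ B H H).inv ≫ P.ract ▷ H ≫ P.ract := by
  have h : P.ract ▷ H ≫ P.ract = P.inc ▷ H ▷ H ≫ μ[H] ▷ H ≫ μ[H] ≫ P.quo := by
    rw [← P.quo_ract, ← comp_whiskerRight_assoc, ← comp_whiskerRight_assoc, ract]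
    simp only [Category.assoc]
  rw [h, Iso.eq_inv_comp, MonObj.mul_assoc_assoc, ract, whisker_exchange_assoc]
  simp

theorem ract_comul : P.ract ≫ P.comul =
    (P.comul ⊗ₘ Δ[H]) ≫ tensorμ B B H H ≫ (P.ract ⊗ₘ P.ract) := by
  have h1 : μ[H] ≫ P.quo = (P.quo ⊗ₘ 𝟙 H) ≫ P.ract := by rw [tensorHom_id, P.quo_ract]
  have h2 : P.comul ⊗ₘ Δ[H] = (P.inc ▷ H ≫ (Δ[H] ⊗ₘ Δ[H])) ≫
      ((P.quo ⊗ₘ P.quo) ⊗ₘ (𝟙 H ⊗ₘ 𝟙 H)) := by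
    rw [← tensorHom_id, tensorHom_comp_tensorHom, tensorHom_comp_tensorHom, comul]
    simp
  rw [h2, Category.assoc, tensorμ_natural_assoc, tensorHom_comp_tensorHom, ← h1, ract,
    Category.assoc, Category.assoc, P.quo_comul, BimonObj.mul_comul_assoc,
    tensorHom_comp_tensorHom, Category.assoc]

theorem ract_counit : P.ract ≫ P.counit = (P.counit ⊗ₘ ε[H]) ≫ (λ_ (𝟙_ C)).hom := by
  have h : μ[H] ≫ ε[H] = (ε[H] ⊗ₘ ε[H]) ≫ (λ_ (𝟙_ C)).hom := BimonObj.mul_counit H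
  rw [ract, Category.assoc, Category.assoc, P.quo_counit, h, ← tensorHom_id,
    tensorHom_comp_tensorHom_assoc, Category.id_comp, counit]

theorem i_quo : P.i ≫ P.quo = ε[A] ≫ P.one := by
  have h : A ◁ η[H] ≫ P.lmul = (ρ_ A).hom ≫ P.i := by
    rw [HopfProjection.lmul, whisker_exchange_assoc, MonObj.mul_one, rightUnitor_naturality]
  rw [← Iso.inv_comp_eq] at h
  rw [← h, Category.assoc, Category.assoc, P.lmul_quo, whisker_exchange_assoc, one]
  monoidal

theorem quo_act : P.quo ▷ A ≫ P.act = P.rmul ≫ P.quo := by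
  rw [act, ← whisker_exchange_assoc, P.quo_ract, HopfProjection.rmul, Category.assoc]

theorem act_eq : P.act = (P.inc ⊗ₘ P.i) ≫ μ[H] ≫ P.quo := by
  rw [act, ract, MonoidalCategory.tensorHom_def', Category.assoc]

theorem act_one : B ◁ η[A] ≫ P.act = (ρ_ B).hom := by
  rw [act, ← MonoidalCategory.whiskerLeft_comp_assoc, P.i_one, ract_one]

theorem act_mul : B ◁ μ[A] ≫ P.act = (α_ B A A).inv ≫ P.act ▷ A ≫ P.act := by
  rw [act, ← MonoidalCategory.whiskerLeft_comp_assoc, P.i_mul, MonoidalCategory.whiskerLeft_comp,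
    Category.assoc, ract_mul, comp_whiskerRight, Category.assoc, ← whisker_exchange_assoc,
    MonoidalCategory.tensorHom_def]
  monoidal

/-- Moving `A` past `B` is multiplication in `H`, followed by the isomorphism with `A ⊗ B`. The
right-hand side is the same for `H` and `H̄`, so that `B` is an object of `C_{O(A, Ā)}`. -/
theorem past_eq : past Δ[A] P.act = (P.inc ⊗ₘ P.i) ≫ μ[H] ≫ P.iso.hom := by
  have h1 : P.coact ≫ A ◁ P.quo = P.iso.hom := by
    rw [HopfProjection.coact, Category.assoc, ← MonoidalCategory.tensorHom_def, iso_hom]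
  have h2 : P.i ≫ P.coact = Δ[A] ≫ A ◁ P.i := by
    rw [HopfProjection.coact, reassoc_of% P.i_comul, ← tensorHom_id, tensorHom_comp_tensorHom,
      P.i_p, Category.comp_id, id_tensorHom]
  have h3 : (inSnd A P.inc ⊗ₘ Δ[A] ≫ A ◁ P.i) =
      ((λ_ B).inv ⊗ₘ Δ[A]) ≫ ((η[A] ⊗ₘ P.inc) ⊗ₘ (𝟙 A ⊗ₘ P.i)) := by
    have h : inSnd A P.inc = (λ_ B).inv ≫ (η[A] ⊗ₘ P.inc) := by
      rw [inSnd, MonoidalCategory.tensorHom_def', leftUnitor_inv_naturality_assoc]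
    rw [tensorHom_comp_tensorHom, id_tensorHom, h]
  have h4 : (η[A] ⊗ₘ 𝟙 A) ≫ μ[A] = (λ_ A).hom := by rw [tensorHom_id, MonObj.one_mul]
  rw [← h1, reassoc_of% P.coact_mul, tensorHom_comp_tensorHom_assoc, h2, P.inc_coact, h3,
    MonObj.tensorObj.mul_def, Category.assoc, Category.assoc, tensorμ_natural_assoc,
    tensorHom_comp_tensorHom_assoc, h4, ← id_tensorHom, tensorHom_comp_tensorHom, Category.assoc,
    ← P.act_eq, Category.comp_id, MonoidalCategory.tensorHom_def,
    MonoidalCategory.tensorHom_def]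
  simp only [tensorμ, past]
  monoidal

/-- The commutation relation between `A` and `B` in `H`. -/
theorem past_iso_inv : past Δ[A] P.act ≫ P.iso.inv = (P.inc ⊗ₘ P.i) ≫ μ[H] := by
  rw [past_eq, Category.assoc, Category.assoc, Iso.hom_inv_id, Category.comp_id]

theorem act_whiskerRight_mul : P.act ▷ B ≫ P.mul = (α_ B A B).hom ≫ B ◁ P.iso.inv ≫ P.ract := by
  have h : P.act ▷ B ≫ P.mul = (B ◁ P.i) ▷ B ⊗≫ (B ⊗ H) ◁ P.inc ≫ P.ract ▷ H ≫ P.ract := by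
    rw [whisker_exchange_assoc, act, P.mul_eq_ract]
    monoidal
  rw [h, iso_inv, MonoidalCategory.whiskerLeft_comp, Category.assoc, ract_mul,
    MonoidalCategory.tensorHom_def]
  monoidal

theorem mul_linear : diagAct Δ[A] P.act P.act ≫ P.mul = P.mul ▷ A ≫ P.act := by
  have h : P.mul ▷ A ≫ P.act = (B ◁ P.inc) ▷ A ⊗≫ (B ⊗ H) ◁ P.i ≫ P.ract ▷ H ≫ P.ract := by
    rw [whisker_exchange_assoc, act, P.mul_eq_ract]
    monoidal
  rw [diagAct_eq, h]
  simp only [Category.assoc]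
  rw [act_whiskerRight_mul, Iso.inv_hom_id_assoc, ← MonoidalCategory.whiskerLeft_comp_assoc,
    past_iso_inv, MonoidalCategory.whiskerLeft_comp_assoc, ract_mul,
    MonoidalCategory.tensorHom_def]
  monoidal

theorem comul_linear : P.act ≫ P.comul = P.comul ▷ A ≫ diagAct Δ[A] P.act P.act := by
  have h : P.act ⊗ₘ P.act = ((𝟙 B ⊗ₘ P.i) ⊗ₘ (𝟙 B ⊗ₘ P.i)) ≫ (P.ract ⊗ₘ P.ract) := by
    rw [tensorHom_comp_tensorHom, id_tensorHom, act]
  rw [diagAct, tensorAct, h, ← tensorμ_natural_assoc, act, Category.assoc, ract_comul,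
    ← id_tensorHom, tensorHom_comp_tensorHom_assoc, P.i_comul, Category.id_comp,
    ← MonoidalCategory.tensorHom_def_assoc, tensorHom_comp_tensorHom_assoc, id_tensorHom_id,
    Category.comp_id]

theorem one_linear : ((λ_ A).hom ≫ ε[A]) ≫ P.one = P.one ▷ A ≫ P.act := by
  rw [one, comp_whiskerRight_assoc, P.quo_act, HopfProjection.rmul, Category.assoc, Category.assoc,
    ← whisker_exchange_assoc, MonObj.one_mul_assoc, leftUnitor_naturality_assoc, i_quo, one]

theorem counit_linear : P.act ≫ P.counit = P.counit ▷ A ≫ (λ_ A).hom ≫ ε[A] := by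
  rw [act, Category.assoc, ract_counit, ← id_tensorHom, tensorHom_comp_tensorHom_assoc, P.i_counit,
    Category.id_comp, MonoidalCategory.tensorHom_def, Category.assoc, leftUnitor_naturality]

/-- A left factor in `A` is replaced by its counit in the quotient `B`. -/
theorem conv_i_quo {X : C} [ComonObj X] {f : X ⟶ A} (hf : f ≫ ε[A] = ε[X]) (g : X ⟶ H) :
    conv (f ≫ P.i) g ≫ P.quo = g ≫ P.quo := by
  have h : (f ≫ P.i ⊗ₘ g) ≫ μ[H] = (f ⊗ₘ g) ≫ P.lmul := by
    rw [HopfProjection.lmul, ← tensorHom_id, tensorHom_comp_tensorHom_assoc, Category.comp_id]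
  rw [conv_eq, h, Category.assoc, Category.assoc, P.lmul_quo, ← tensorHom_id,
    tensorHom_comp_tensorHom_assoc, hf, Category.comp_id, MonoidalCategory.tensorHom_def,
    Category.assoc, ComonObj.counit_comul_assoc, leftUnitor_naturality_assoc,
    Iso.inv_hom_id_assoc]

theorem antipode_linear : P.act ≫ P.antipode = P.antipode ▷ A ≫ P.act := by
  apply P.cancel_quo_whiskerRight
  rw [reassoc_of% P.quo_act, P.quo_antipode, ← comp_whiskerRight_assoc, P.quo_antipode,
    comp_whiskerRight_assoc, P.quo_act, reassoc_of% P.rmul_sigma]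
  have h1 : outSnd H (𝒮[A] ≫ P.i) = outSnd H 𝒮[A] ≫ P.i := by simp only [outSnd, Category.assoc]
  rw [h1, P.conv_i_quo, Category.assoc]
  rw [outSnd, Category.assoc, Category.assoc, HopfObj.antipode_counit, Comon.tensorObj_counit,
    MonoidalCategory.tensorHom_def, Category.assoc, leftUnitor_naturality]

theorem comul_coactA : P.comul ≫ P.coactA ▷ B =
    P.inc ≫ Δ[H] ≫ Δ[H] ▷ H ≫ ((P.quo ⊗ₘ P.p) ⊗ₘ P.quo) := by
  have h := P.rcoact_inc
  have h1 : P.coactA = P.inc ≫ Δ[H] ≫ (P.quo ⊗ₘ P.p) := by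
    rw [coactA, rcoact, MonoidalCategory.tensorHom_def, Category.assoc, Category.assoc]
  rw [comul_eq_rcoact, Category.assoc, whisker_exchange, h1, comp_whiskerRight_assoc, reassoc_of% h,
    comp_whiskerRight_assoc, ← MonoidalCategory.tensorHom_def]

/-- The coaction of `H` on `B` is determined by the comultiplication of `B` and the coaction of
`A`. -/
theorem rcoact_eq : P.rcoact = P.comul ≫ P.coactA ▷ B ≫ (α_ B A B).hom ≫ B ◁ P.iso.inv := by
  have h : P.quo ⊗ₘ (P.p ⊗ₘ P.quo) = (P.quo ⊗ₘ 𝟙 _) ≫ B ◁ (P.p ⊗ₘ P.quo) := by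
    rw [← id_tensorHom, tensorHom_comp_tensorHom, Category.comp_id, Category.id_comp]
  rw [reassoc_of% P.comul_coactA, associator_naturality_assoc, ← ComonObj.comul_assoc_assoc, h,
    Category.assoc, tensorHom_id, whisker_exchange_assoc, ← MonoidalCategory.whiskerLeft_comp,
    ← MonoidalCategory.whiskerLeft_comp]
  have h1 := P.iso.hom_inv_id
  rw [iso_hom, Category.assoc] at h1
  rw [h1, MonoidalCategory.whiskerLeft_id, Category.comp_id, rcoact]

theorem mul_rcoact :
    P.mul ≫ P.rcoact = (P.rcoact ⊗ₘ P.rcoact) ≫ tensorμ B H B H ≫ (P.mul ⊗ₘ μ[H]) := by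
  apply P.cancel_inc_whiskerRight
  rw [Category.assoc, P.rcoact_inc, reassoc_of% P.mul_inc, BimonObj.mul_comul, ← tensorHom_id,
    Category.assoc, Category.assoc, tensorHom_comp_tensorHom, P.mul_inc,
    tensorHom_comp_tensorHom_assoc, ← P.rcoact_inc, ← tensorHom_comp_tensorHom_assoc,
    ← tensorHom_id, tensorμ_natural_assoc, tensorHom_comp_tensorHom, id_tensorHom_id,
    Category.id_comp, Category.comp_id]

theorem mul_coactA :
    P.mul ≫ P.coactA = (P.coactA ⊗ₘ P.coactA) ≫ tensorμ B A B A ≫ (P.mul ⊗ₘ μ[A]) := by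
  rw [coactA, reassoc_of% P.mul_rcoact, ← tensorHom_comp_tensorHom, ← id_tensorHom,
    tensorHom_comp_tensorHom, Category.assoc, tensorμ_natural_assoc, tensorHom_comp_tensorHom,
    P.p_mul, id_tensorHom_id, Category.id_comp, Category.comp_id]

end HopfSplitting

/-! ### The bialgebra structure of the coinvariants -/

namespace HopfSplitting

variable {A H B : C} [HopfObj A] [HopfObj H] (P : HopfSplitting A H B)

/-- The crossed module braiding of `B` with itself. -/
def cross : B ⊗ B ⟶ B ⊗ B :=
  B ◁ P.coactA ≫ (α_ B B A).inv ≫ (β_ B B).hom ▷ A ≫ (α_ B B A).hom ≫ B ◁ P.act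

/-- Multiplying after a crossed braiding amounts to the action of `H`, after the plain braiding. -/
theorem cross_mul : P.cross ▷ B ≫ (α_ B B B).hom ≫ B ◁ P.mul =
    (α_ B B B).hom ≫ B ◁ (P.coactA ▷ B ≫ (α_ B A B).hom ≫ B ◁ P.iso.inv) ≫ (α_ B B H).inv ≫
      (β_ B B).hom ▷ H ≫ (α_ B B H).hom ≫ B ◁ P.ract := by
  calc
    _ = (B ◁ P.coactA ≫ (α_ B B A).inv ≫ (β_ B B).hom ▷ A ≫ (α_ B B A).hom) ▷ B ⊗≫
        B ◁ (P.act ▷ B ≫ P.mul) := by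
      simp only [cross]
      monoidal
    _ = (B ◁ P.coactA) ▷ B ⊗≫ ((β_ B B).hom ▷ (A ⊗ B) ≫ (B ⊗ B) ◁ P.iso.inv) ⊗≫ B ◁ P.ract := by
      rw [act_whiskerRight_mul]
      monoidal
    _ = _ := by
      rw [← whisker_exchange]
      monoidal

/-- The multiplication of the tensor square of `B` in the category of crossed modules, in terms
of the action and the coaction of `H`. -/
theorem cross_mul_mul :
    (α_ B B (B ⊗ B)).hom ≫ B ◁ (α_ B B B).inv ≫ B ◁ P.cross ▷ B ≫ B ◁ (α_ B B B).hom ≫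
      (α_ B B (B ⊗ B)).inv ≫ (P.mul ⊗ₘ P.mul) =
    (B ⊗ B) ◁ (P.coactA ▷ B ≫ (α_ B A B).hom ≫ B ◁ P.iso.inv) ≫ tensorμ B B B H ≫
      (P.mul ⊗ₘ P.ract) := by
  calc
    _ = 𝟙 _ ⊗≫ B ◁ (P.cross ▷ B ≫ (α_ B B B).hom ≫ B ◁ P.mul) ⊗≫ P.mul ▷ B := by
      rw [MonoidalCategory.tensorHom_def']
      monoidal
    _ = _ := by
      rw [cross_mul, MonoidalCategory.tensorHom_def']
      simp only [tensorμ]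
      monoidal

/-- The bialgebra axiom for `B` in the category of crossed modules. -/
theorem mul_comul : P.mul ≫ P.comul = (P.comul ⊗ₘ P.comul) ≫
    (α_ B B (B ⊗ B)).hom ≫ B ◁ (α_ B B B).inv ≫ B ◁ P.cross ▷ B ≫ B ◁ (α_ B B B).hom ≫
      (α_ B B (B ⊗ B)).inv ≫ (P.mul ⊗ₘ P.mul) := by
  have h : (P.inc ≫ Δ[H]) = P.rcoact ≫ (P.inc ⊗ₘ 𝟙 H) := by rw [tensorHom_id, P.rcoact_inc]
  have h1 : P.mul ⊗ₘ P.ract = ((𝟙 B ⊗ₘ P.inc) ⊗ₘ (𝟙 B ⊗ₘ 𝟙 H)) ≫ (P.ract ⊗ₘ P.ract) := by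
    rw [tensorHom_comp_tensorHom, id_tensorHom, id_tensorHom_id, Category.id_comp, mul_eq_ract]
  rw [cross_mul_mul, MonoidalCategory.tensorHom_def, Category.assoc,
    ← MonoidalCategory.whiskerLeft_comp_assoc, ← rcoact_eq, ← MonoidalCategory.tensorHom_def_assoc,
    h1, ← tensorμ_natural_assoc, tensorHom_comp_tensorHom_assoc, ← h, P.mul_eq_ract, Category.assoc,
    P.ract_comul, ← id_tensorHom, tensorHom_comp_tensorHom_assoc, Category.id_comp,
    id_tensorHom_id, Category.comp_id]

theorem one_comul : P.one ≫ P.comul = (λ_ (𝟙_ C)).inv ≫ (P.one ⊗ₘ P.one) := by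
  have h : η[H] ≫ Δ[H] = (λ_ (𝟙_ C)).inv ≫ (η[H] ⊗ₘ η[H]) := BimonObj.one_comul H
  rw [one, Category.assoc, quo_comul, reassoc_of% h, tensorHom_comp_tensorHom]

theorem mul_counit : P.mul ≫ P.counit = (P.counit ⊗ₘ P.counit) ≫ (λ_ (𝟙_ C)).hom := by
  rw [mul_eq_ract, Category.assoc, ract_counit, ← id_tensorHom, tensorHom_comp_tensorHom_assoc,
    Category.id_comp, counit]

theorem one_counit : P.one ≫ P.counit = 𝟙 (𝟙_ C) := by
  rw [one, Category.assoc, quo_counit, BimonObj.one_counit]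

/-! ### The isomorphism with the cross product -/

/-- The multiplication of `H` is the cross product multiplication. -/
theorem iso_inv_mul : mid (past Δ[A] P.act) ≫ (μ[A] ⊗ₘ P.mul) ≫ P.iso.inv =
    (P.iso.inv ⊗ₘ P.iso.inv) ≫ μ[H] := by
  have hμ : (μ[H] ⊗ₘ μ[H]) ≫ μ[H] = (α_ H H (H ⊗ H)).hom ≫
      H ◁ ((α_ H H H).inv ≫ μ[H] ▷ H ≫ μ[H]) ≫ μ[H] := by
    rw [MonObj.mul_assoc, Iso.inv_hom_id_assoc, MonoidalCategory.tensorHom_def', Category.assoc,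
      MonObj.mul_assoc]
    simp
  have h1 : (P.iso.inv ⊗ₘ P.iso.inv) ≫ μ[H] = ((P.i ⊗ₘ P.inc) ⊗ₘ (P.i ⊗ₘ P.inc)) ≫
      (α_ H H (H ⊗ H)).hom ≫ H ◁ ((α_ H H H).inv ≫ μ[H] ▷ H ≫ μ[H]) ≫ μ[H] := by
    rw [← hμ, tensorHom_comp_tensorHom_assoc, iso_inv]
  have h2 : (μ[A] ⊗ₘ P.mul) ≫ P.iso.inv = ((P.i ⊗ₘ P.i) ⊗ₘ (P.inc ⊗ₘ P.inc)) ≫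
      (α_ H H (H ⊗ H)).hom ≫ H ◁ ((α_ H H H).inv ≫ μ[H] ▷ H ≫ μ[H]) ≫ μ[H] := by
    rw [← hμ, tensorHom_comp_tensorHom_assoc, iso_inv, tensorHom_comp_tensorHom_assoc, P.i_mul,
      P.mul_inc]
  have h3 := P.past_iso_inv
  rw [iso_inv] at h3
  have h4 := mid_tensorHom (past Δ[A] P.act) P.i P.i P.inc P.inc
  have h5 := mid_tensorHom (𝟙 (B ⊗ A)) P.i P.inc P.i P.inc
  rw [mid_id, Category.id_comp, Category.id_comp] at h5
  rw [h1, h2]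
  simp only [MonoidalCategory.whiskerLeft_comp, Category.assoc]
  rw [reassoc_of% h4, reassoc_of% h5, ← id_tensorHom H (μ[H] ▷ H), ← tensorHom_id,
    tensorHom_comp_tensorHom_assoc, tensorHom_comp_tensorHom_assoc, Category.assoc, Category.assoc,
    tensorHom_comp_tensorHom, tensorHom_comp_tensorHom, Category.assoc, h3]

theorem mul_whiskerRight_iso_inv :
    μ[A] ▷ B ≫ P.iso.inv = (α_ A A B).hom ≫ A ◁ P.iso.inv ≫ P.lmul := by
  rw [iso_inv, HopfProjection.lmul, ← tensorHom_id, tensorHom_comp_tensorHom_assoc, P.i_mul,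
    Category.id_comp, ← tensorHom_id, ← id_tensorHom, tensorHom_comp_tensorHom_assoc,
    Category.id_comp, Category.comp_id, ← Category.comp_id P.inc, ← tensorHom_comp_tensorHom,
    tensorHom_id, Category.assoc, MonObj.mul_assoc, associator_naturality_assoc,
    ← Category.comp_id P.i, ← tensorHom_comp_tensorHom, id_tensorHom]
  simp only [Category.comp_id, Category.assoc]

theorem mid_iso_inv :
    mid (A ◁ P.coactA ≫ (α_ A B A).inv ≫ (β_ A B).hom ▷ A ≫ (α_ B A A).hom ≫ B ◁ μ[A]) ≫
      (P.iso.inv ⊗ₘ P.iso.inv) =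
    (A ⊗ A) ◁ (P.coactA ▷ B ≫ (α_ B A B).hom ≫ B ◁ P.iso.inv) ≫ tensorμ A A B H ≫
      (P.iso.inv ⊗ₘ P.lmul) := by
  calc
    _ = 𝟙 _ ⊗≫ A ◁ ((A ◁ P.coactA ≫ (α_ A B A).inv ≫ (β_ A B).hom ▷ A ≫ (α_ B A A).hom) ▷ B ⊗≫
        B ◁ (μ[A] ▷ B ≫ P.iso.inv)) ⊗≫ P.iso.inv ▷ H := by
      rw [MonoidalCategory.tensorHom_def', mid]
      monoidal
    _ = 𝟙 _ ⊗≫ A ◁ ((A ◁ P.coactA) ▷ B ⊗≫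
        ((β_ A B).hom ▷ (A ⊗ B) ≫ (B ⊗ A) ◁ P.iso.inv) ⊗≫ B ◁ P.lmul) ⊗≫ P.iso.inv ▷ H := by
      rw [mul_whiskerRight_iso_inv]
      monoidal
    _ = _ := by
      rw [← whisker_exchange, MonoidalCategory.tensorHom_def']
      simp only [tensorμ]
      monoidal

/-- The comultiplication of `H` is the cross coproduct comultiplication. -/
theorem iso_inv_comul : P.iso.inv ≫ Δ[H] = (Δ[A] ⊗ₘ P.comul) ≫
    mid (A ◁ P.coactA ≫ (α_ A B A).inv ≫ (β_ A B).hom ▷ A ≫ (α_ B A A).hom ≫ B ◁ μ[A]) ≫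
      (P.iso.inv ⊗ₘ P.iso.inv) := by
  have h : (P.inc ≫ Δ[H]) = P.rcoact ≫ (P.inc ⊗ₘ 𝟙 H) := by rw [tensorHom_id, P.rcoact_inc]
  have h1 : P.iso.inv ⊗ₘ P.lmul = ((P.i ⊗ₘ P.inc) ⊗ₘ (P.i ⊗ₘ 𝟙 H)) ≫ (μ[H] ⊗ₘ μ[H]) := by
    rw [tensorHom_comp_tensorHom, iso_inv, HopfProjection.lmul, tensorHom_id]
  rw [mid_iso_inv, MonoidalCategory.tensorHom_def, Category.assoc,
    ← MonoidalCategory.whiskerLeft_comp_assoc, ← rcoact_eq, ← MonoidalCategory.tensorHom_def_assoc,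
    h1, ← tensorμ_natural_assoc, tensorHom_comp_tensorHom_assoc, ← h, ← P.i_comul, iso_inv,
    Category.assoc, BimonObj.mul_comul, tensorHom_comp_tensorHom_assoc]

theorem iso_inv_counit : P.iso.inv ≫ ε[H] = (ε[A] ⊗ₘ P.counit) ≫ (λ_ (𝟙_ C)).hom := by
  have h : μ[H] ≫ ε[H] = (ε[H] ⊗ₘ ε[H]) ≫ (λ_ (𝟙_ C)).hom := BimonObj.mul_counit H
  rw [iso_inv, Category.assoc, h, tensorHom_comp_tensorHom_assoc, P.i_counit, counit]

theorem one_iso_inv : ((λ_ (𝟙_ C)).inv ≫ (η[A] ⊗ₘ P.one)) ≫ P.iso.inv = η[H] := by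
  rw [iso_inv, Category.assoc, tensorHom_comp_tensorHom_assoc, P.i_one, P.one_inc,
    MonoidalCategory.tensorHom_def', Category.assoc, MonObj.one_mul, leftUnitor_naturality,
    Iso.inv_hom_id_assoc]

theorem i_iso_hom : P.i ≫ P.iso.hom = (ρ_ A).inv ≫ A ◁ P.one := by
  rw [iso_hom, reassoc_of% P.i_comul, tensorHom_comp_tensorHom, P.i_p, P.i_quo,
    ← Category.id_comp (𝟙 A), ← tensorHom_comp_tensorHom, id_tensorHom, id_tensorHom,
    ComonObj.comul_counit_assoc]

theorem iso_hom_counit : P.iso.hom ≫ A ◁ P.counit ≫ (ρ_ A).hom = P.p := by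
  rw [iso_hom, ← id_tensorHom, Category.assoc, tensorHom_comp_tensorHom_assoc, P.quo_counit,
    Category.comp_id, MonoidalCategory.tensorHom_def', Category.assoc,
    ComonObj.comul_counit_assoc, rightUnitor_naturality, Iso.inv_hom_id_assoc]

end HopfSplitting

/-! ### Copairings in braided categories -/

section copairing

variable {X Y Z : C}

/-- The morphism `X ⊗ (Y ⊗ Z) ⟶ Y ⊗ W` which moves `X` past `Y` and then applies `f`. -/
def slide {W : C} (s : X ⊗ Y ⟶ Y ⊗ X) (f : X ⊗ Z ⟶ W) : X ⊗ (Y ⊗ Z) ⟶ Y ⊗ W :=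
  (α_ X Y Z).inv ≫ s ▷ Z ≫ (α_ Y X Z).hom ≫ Y ◁ f

/-- An element nested in another one can be moved in front of it, at the cost of a braiding. -/
theorem nest_braiding (R : 𝟙_ C ⟶ X ⊗ X) (m : X ⊗ X ⟶ X) :
    nest R R (𝟙 (X ⊗ X)) m ≫ (β_ X X).inv ▷ X =
      (λ_ (𝟙_ C)).inv ≫ (R ⊗ₘ R) ≫ (α_ X X (X ⊗ X)).hom ≫ X ◁ slide (β_ X X).hom m ≫
        (α_ X X X).inv := by
  have h := ModuleO.insert_braiding (W := X) R
  calc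
    _ = R ⊗≫ ((ρ_ X).inv ≫ X ◁ R ≫ (α_ X X X).inv) ▷ X ⊗≫
        ((X ⊗ X) ◁ m ≫ (β_ X X).inv ▷ X) := by
      rw [nest, MonoidalCategory.tensorHom_def]
      monoidal
    _ = R ⊗≫ ((ρ_ X).inv ≫ X ◁ R ≫ (α_ X X X).inv ≫ (β_ X X).inv ▷ X) ▷ X ⊗≫ (X ⊗ X) ◁ m := by
      rw [whisker_exchange]
      monoidal
    _ = 𝟙 _ ⊗≫ (𝟙_ C ◁ R ≫ R ▷ (X ⊗ X)) ⊗≫ X ◁ (β_ X X).hom ▷ X ⊗≫ (X ⊗ X) ◁ m := by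
      rw [h]
      monoidal
    _ = _ := by
      rw [slide, MonoidalCategory.tensorHom_def', whisker_exchange]
      monoidal

/-- Multiplicativity of a copairing in its first leg, with respect to the opposite comultiplication,
in a form in which the comultiplication appears without a braiding. -/
theorem comul_left_iff (R : 𝟙_ C ⟶ X ⊗ X) (m : X ⊗ X ⟶ X) (Δ' : X ⟶ X ⊗ X) :
    R ≫ (Δ' ≫ (β_ X X).hom) ▷ X = nest R R (𝟙 (X ⊗ X)) m ↔
    R ≫ Δ' ▷ X = (λ_ (𝟙_ C)).inv ≫ (R ⊗ₘ R) ≫ (α_ X X (X ⊗ X)).hom ≫ X ◁ slide (β_ X X).hom m ≫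
        (α_ X X X).inv := by
  rw [← nest_braiding, comp_whiskerRight, ← Category.assoc]
  exact (Iso.eq_comp_inv (whiskerRightIso (β_ X X) X)).symm

theorem rightUnitor_tensorμ : (ρ_ X).inv ▷ (Y ⊗ Z) ≫ tensorμ X (𝟙_ C) Y Z =
    (α_ X Y Z).inv ≫ (X ⊗ Y) ◁ (λ_ Z).inv := by
  simp only [tensorμ, braiding_tensorUnit_left]
  monoidal

theorem tensorμ_leftUnitor : (λ_ (𝟙_ C)).inv ▷ (Y ⊗ Z) ≫ tensorμ (𝟙_ C) (𝟙_ C) Y Z =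
    (λ_ (Y ⊗ Z)).hom ≫ ((λ_ Y).inv ⊗ₘ (λ_ Z).inv) := by
  rw [MonoidalCategory.tensorHom_def]
  simp only [tensorμ, braiding_tensorUnit_left]
  monoidal

end copairing

namespace HopfSplitting

variable {A H B : C} [HopfObj A] [HopfObj H] (P : HopfSplitting A H B)

theorem mul_quo : μ[H] ≫ P.quo = (P.quo ⊗ₘ 𝟙 H) ≫ P.ract := by rw [tensorHom_id, P.quo_ract]

theorem i_mul_quo : (P.i ⊗ₘ 𝟙 H) ≫ μ[H] ≫ P.quo = (ε[A] ⊗ₘ 𝟙 H) ≫ (λ_ H).hom ≫ P.quo := by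
  rw [tensorHom_id, tensorHom_id, ← P.lmul_quo, HopfProjection.lmul, Category.assoc]

/-- The coaction of `A` on `B` is induced by the R-matrix of `A`. This is the quasitriangularity of
`H`, restricted to `B` and projected to `B ⊗ A` by `quo ⊗ p`. -/
theorem coactA_eq {Δ' : H ⟶ H ⊗ H} {R : 𝟙_ C ⟶ H ⊗ H} {RA : 𝟙_ C ⟶ A ⊗ A}
    (hq : (ρ_ H).inv ≫ convMul μ[H] (Δ' ≫ (β_ H H).hom) R = (λ_ H).inv ≫ convMul μ[H] R Δ[H])
    (hinc : P.inc ≫ Δ' ≫ P.p ▷ H = P.inc ≫ (λ_ H).inv ≫ η[A] ▷ H)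
    (hR : R ≫ H ◁ P.p = RA ≫ P.i ▷ A) (hε : RA ≫ ε[A] ▷ A = η[A] ≫ (λ_ A).inv) :
    P.coactA = (ρ_ B).inv ≫ B ◁ RA ≫ (α_ B A A).inv ≫ P.act ▷ A := by
  have hp : ∀ {Y Z : C} (f : Y ⟶ H ⊗ H) (g : Z ⟶ H ⊗ H), convMul μ[H] f g ≫ (P.quo ⊗ₘ P.p) =
      (f ≫ H ◁ P.p ⊗ₘ g ≫ H ◁ P.p) ≫ tensorμ H A H A ≫ (μ[H] ≫ P.quo ⊗ₘ μ[A]) := by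
    intro Y Z f g
    have h : μ[H] ≫ P.quo ⊗ₘ μ[H] ≫ P.p =
        ((𝟙 H ⊗ₘ 𝟙 H) ⊗ₘ (P.p ⊗ₘ P.p)) ≫ (μ[H] ≫ P.quo ⊗ₘ μ[A]) := by
      rw [tensorHom_comp_tensorHom, P.p_mul, id_tensorHom_id, Category.id_comp]
    rw [convMul, Category.assoc, Category.assoc, tensorHom_comp_tensorHom, h,
      ← tensorμ_natural_assoc, tensorHom_comp_tensorHom_assoc, id_tensorHom]
  have h1 : P.inc ≫ Δ' ≫ (β_ H H).hom ≫ H ◁ P.p = P.inc ≫ (ρ_ H).inv ≫ H ◁ η[A] := by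
    rw [← BraidedCategory.braiding_naturality_left, reassoc_of% hinc,
      BraidedCategory.braiding_naturality_left]
    simp
  -- On `B`, the second leg of `Ψ Δ'` becomes the unit of `A`, and the product with `R` an action.
  have h2 : P.inc ≫ (ρ_ H).inv ≫ convMul μ[H] (Δ' ≫ (β_ H H).hom) R ≫ (P.quo ⊗ₘ P.p) =
      (ρ_ B).inv ≫ B ◁ RA ≫ (α_ B A A).inv ≫ P.act ▷ A := by
    have h4 : P.inc ≫ (Δ' ≫ (β_ H H).hom) ≫ H ◁ P.p = (ρ_ B).inv ≫ (P.inc ⊗ₘ η[A]) := by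
      rw [Category.assoc, h1, MonoidalCategory.tensorHom_def, rightUnitor_inv_naturality_assoc]
    have h5 : (η[A] ⊗ₘ 𝟙 A) ≫ μ[A] = (λ_ A).hom := by rw [tensorHom_id, MonObj.one_mul]
    rw [hp, hR, rightUnitor_inv_naturality_assoc, ← tensorHom_id,
      tensorHom_comp_tensorHom_assoc, h4, Category.id_comp, ← tensorHom_id P.i,
      ← tensorHom_comp_tensorHom_assoc, tensorμ_natural_assoc, tensorHom_comp_tensorHom, h5,
      ← P.act_eq, MonoidalCategory.tensorHom_def', Category.assoc, reassoc_of% rightUnitor_tensorμ,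
      MonoidalCategory.tensorHom_def']
    monoidal
  -- In the product `R · Δ`, the first leg of `R` lies in `A` and disappears in the quotient `B`.
  have h3 : P.inc ≫ (λ_ H).inv ≫ convMul μ[H] R Δ[H] ≫ (P.quo ⊗ₘ P.p) = P.coactA := by
    have h4 : RA ≫ (ε[A] ⊗ₘ 𝟙 A) = (λ_ (𝟙_ C)).inv ≫ (𝟙 (𝟙_ C) ⊗ₘ η[A]) := by
      rw [tensorHom_id, hε, id_tensorHom, leftUnitor_inv_naturality]
    have h5 : (η[A] ⊗ₘ 𝟙 A) ≫ μ[A] = (λ_ A).hom := by rw [tensorHom_id, MonObj.one_mul]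
    have h6 : (RA ≫ P.i ▷ A ⊗ₘ Δ[H] ≫ H ◁ P.p) ≫ tensorμ H A H A ≫ (μ[H] ≫ P.quo ⊗ₘ μ[A]) =
        (RA ≫ (ε[A] ⊗ₘ 𝟙 A) ⊗ₘ Δ[H] ≫ H ◁ P.p) ≫ tensorμ (𝟙_ C) A H A ≫
          ((λ_ H).hom ≫ P.quo ⊗ₘ μ[A]) := by
      rw [← tensorHom_id, ← Category.comp_id (Δ[H] ≫ _), ← tensorHom_comp_tensorHom_assoc,
        ← tensorHom_comp_tensorHom_assoc, ← id_tensorHom_id, tensorμ_natural_assoc,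
        tensorμ_natural_assoc, tensorHom_comp_tensorHom, tensorHom_comp_tensorHom, P.i_mul_quo]
    rw [hp, hR, h6, h4, ← Category.comp_id (Δ[H] ≫ _), ← tensorHom_comp_tensorHom_assoc,
      ← id_tensorHom_id, tensorμ_natural_assoc, tensorHom_comp_tensorHom, h5, id_tensorHom_id,
      Category.id_comp, MonoidalCategory.tensorHom_def', Category.assoc,
      reassoc_of% tensorμ_leftUnitor, coactA, rcoact, tensorHom_comp_tensorHom,
      Iso.inv_hom_id_assoc, Iso.inv_hom_id, tensorHom_id, leftUnitor_naturality_assoc,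
      Iso.inv_hom_id_assoc, Category.assoc, Category.assoc, Category.assoc, whisker_exchange]
  rw [← h2, ← h3, reassoc_of% hq]

end HopfSplitting

/-! ### The R-matrix of the coinvariants -/

theorem slide_natural {X Y Z W X' Y' Z' W' : C} (a : X' ⟶ X) (b : Y' ⟶ Y) (c : Z' ⟶ Z)
    (d : W ⟶ W') (f : X ⊗ Z ⟶ W) : slide (β_ X' Y').hom ((a ⊗ₘ c) ≫ f ≫ d) ≫ b ▷ W' =
      (a ⊗ₘ (b ⊗ₘ c)) ≫ slide (β_ X Y).hom f ≫ Y ◁ d := by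
  have h : (a ⊗ₘ (b ⊗ₘ c)) ≫ (α_ X Y Z).inv = (α_ X' Y' Z').inv ≫ ((a ⊗ₘ b) ⊗ₘ c) :=
    associator_inv_naturality _ _ _
  rw [slide, slide]
  simp only [Category.assoc]
  rw [reassoc_of% h, ← tensorHom_id, ← tensorHom_id, ← tensorHom_id, ← id_tensorHom, ← id_tensorHom,
    ← id_tensorHom, tensorHom_comp_tensorHom, tensorHom_comp_tensorHom,
    tensorHom_comp_tensorHom_assoc,
    BraidedCategory.braiding_naturality]
  simp only [Category.id_comp, Category.comp_id]
  have h2 : ((b ⊗ₘ a) ⊗ₘ c) ≫ (α_ Y X Z).hom = (α_ Y' X' Z').hom ≫ (b ⊗ₘ (a ⊗ₘ c)) :=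
    associator_naturality _ _ _
  rw [← Category.id_comp c, ← tensorHom_comp_tensorHom, Category.assoc, reassoc_of% h2,
    tensorHom_comp_tensorHom]
  simp

theorem slide_counit {X Y Z : C} (e : X ⟶ 𝟙_ C) {W : C} (f : Z ⟶ W) :
    slide (β_ X Y).hom (e ▷ Z ≫ (λ_ Z).hom ≫ f) = e ▷ (Y ⊗ Z) ≫ (λ_ (Y ⊗ Z)).hom ≫ Y ◁ f := by
  have h := slide_natural e (𝟙 Y) (𝟙 Z) f (λ_ Z).hom
  rw [tensorHom_id, id_whiskerRight, Category.comp_id, id_tensorHom_id, tensorHom_id] at h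
  rw [h, slide, braiding_tensorUnit_left]
  monoidal

/-- A splitting of a projection onto `A` of a quasitriangular Hopf algebra `H`, where the conditions
on the second comultiplication are recorded in the form in which they enter the construction of the
R-matrix of the coinvariants. -/
structure QuasitriangularSplitting (A H B : C) [HopfObj A] [HopfObj H] extends
    HopfSplitting A H B where
  comulBarA : A ⟶ A ⊗ A
  comulBar : H ⟶ H ⊗ H
  RA : 𝟙_ C ⟶ A ⊗ A
  R : 𝟙_ C ⟶ H ⊗ H
  i_comulBar : i ≫ comulBar = comulBarA ≫ (i ⊗ₘ i)
  comulBarA_counit : comulBarA ≫ (ε[A] ⊗ₘ ε[A]) = ε[A] ≫ (λ_ (𝟙_ C)).inv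
  inc_comulBar : inc ≫ comulBar ≫ p ▷ H = inc ≫ (λ_ H).inv ≫ η[A] ▷ H
  quo_comulBar : quo ≫ inc ≫ comulBar ≫ (quo ⊗ₘ quo) = comulBar ≫ (quo ⊗ₘ quo)
  /-- `proj` fixes every left coinvariant for the second comultiplication. -/
  comp_proj_bar : ∀ f : 𝟙_ C ⟶ H ⊗ B, f ≫ (comulBar ≫ p ▷ H) ▷ B = f ≫ inSnd A (𝟙 H) ▷ B →
    f ≫ toHopfProjection.proj ▷ B = f
  R_comul_left : R ≫ (comulBar ≫ (β_ H H).hom) ▷ H = nest R R (𝟙 (H ⊗ H)) μ[H]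
  R_comul_right : R ≫ H ◁ Δ[H] = nest R R μ[H] (𝟙 (H ⊗ H))
  R_counit_left : R ≫ ε[H] ▷ H = η[H] ≫ (λ_ H).inv
  R_counit_right : R ≫ H ◁ ε[H] = η[H] ≫ (ρ_ H).inv
  RA_counit_left : RA ≫ ε[A] ▷ A = η[A] ≫ (λ_ A).inv
  RA_counit_right : RA ≫ A ◁ ε[A] = η[A] ≫ (ρ_ A).inv
  quasitriangular : (ρ_ H).inv ≫ convMul μ[H] (comulBar ≫ (β_ H H).hom) R =
    (λ_ H).inv ≫ convMul μ[H] R Δ[H]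
  R_right : R ≫ H ◁ p = RA ≫ i ▷ A
  R_left : R ≫ p ▷ H = RA ≫ A ◁ i

namespace QuasitriangularSplitting

variable {A H B : C} [HopfObj A] [HopfObj H] (P : QuasitriangularSplitting A H B)

/-- The R-matrix of the coinvariants. -/
def RB : 𝟙_ C ⟶ B ⊗ B := P.R ≫ (P.quo ⊗ₘ P.quo)

/-- The second comultiplication of the coinvariants. -/
def comulBarB : B ⟶ B ⊗ B := P.inc ≫ P.comulBar ≫ (P.quo ⊗ₘ P.quo)

/-- The first leg of `(id ⊗ quo) R` is a left coinvariant for the second comultiplication. -/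
theorem R_quo_coinvariant : (P.R ≫ H ◁ P.quo) ≫ (P.comulBar ≫ P.p ▷ H) ▷ B =
    (P.R ≫ H ◁ P.quo) ≫ inSnd A (𝟙 H) ▷ B := by
  have h := (comul_left_iff _ _ _).1 P.R_comul_left
  have h1 : P.i ▷ (H ⊗ H) ≫ slide (β_ H H).hom μ[H] ≫ H ◁ P.quo =
      ε[A] ▷ (H ⊗ H) ≫ (λ_ (H ⊗ H)).hom ≫ H ◁ P.quo := by
    have h2 := slide_natural P.i (𝟙 H) (𝟙 H) P.quo μ[H]
    rw [id_tensorHom_id, id_whiskerRight, Category.comp_id, P.i_mul_quo,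
      tensorHom_id, slide_counit, tensorHom_id] at h2
    exact h2.symm
  calc
    _ = (P.R ≫ P.comulBar ▷ H) ≫ (P.p ▷ H) ▷ H ≫ (A ⊗ H) ◁ P.quo := by
      rw [Category.assoc, whisker_exchange, comp_whiskerRight]
      simp only [Category.assoc]
    _ = 𝟙 _ ⊗≫ ((P.R ≫ P.p ▷ H) ⊗ₘ P.R) ⊗≫ A ◁ (slide (β_ H H).hom μ[H] ≫ H ◁ P.quo) ⊗≫ 𝟙 _ := by
      rw [h]
      calc
        _ = 𝟙 _ ⊗≫ (P.R ⊗ₘ P.R) ⊗≫ (H ◁ slide (β_ H H).hom μ[H] ≫ P.p ▷ (H ⊗ H)) ⊗≫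
            A ◁ H ◁ P.quo ⊗≫ 𝟙 _ := by
          monoidal
        _ = _ := by
          rw [whisker_exchange, MonoidalCategory.tensorHom_def', MonoidalCategory.tensorHom_def']
          monoidal
    _ = 𝟙 _ ⊗≫ (𝟙_ C ◁ P.R ≫ P.RA ▷ (H ⊗ H)) ⊗≫ A ◁ (P.i ▷ (H ⊗ H) ≫
        slide (β_ H H).hom μ[H] ≫ H ◁ P.quo) ⊗≫ 𝟙 _ := by
      rw [P.R_left, MonoidalCategory.tensorHom_def']
      monoidal
    _ = 𝟙 _ ⊗≫ 𝟙_ C ◁ P.R ⊗≫ (P.RA ≫ A ◁ ε[A]) ▷ (H ⊗ H) ⊗≫ A ◁ H ◁ P.quo ⊗≫ 𝟙 _ := by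
      rw [h1]
      monoidal
    _ = 𝟙 _ ⊗≫ (P.R ≫ H ◁ P.quo) ⊗≫ η[A] ▷ (H ⊗ B) ⊗≫ 𝟙 _ := by
      rw [P.RA_counit_right]
      calc
        _ = 𝟙 _ ⊗≫ P.R ⊗≫ (η[A] ▷ (H ⊗ H) ≫ A ◁ (H ◁ P.quo)) ⊗≫ 𝟙 _ := by
          monoidal
        _ = _ := by
          rw [← whisker_exchange]
          monoidal
    _ = _ := by
      rw [inSnd]
      monoidal

/-- Projecting the second leg of `R` to `B` suffices to make its first leg coinvariant. -/
theorem RB_inc : P.RB ≫ P.inc ▷ B = P.R ≫ H ◁ P.quo := by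
  have h := P.comp_proj_bar _ P.R_quo_coinvariant
  rw [← h, RB, ← P.quo_inc, MonoidalCategory.tensorHom_def', comp_whiskerRight]
  simp only [Category.assoc]

theorem RB_counit_left : P.RB ≫ P.counit ▷ B = P.one ≫ (λ_ B).inv := by
  rw [RB, MonoidalCategory.tensorHom_def', Category.assoc, Category.assoc, ← comp_whiskerRight,
    P.quo_counit, whisker_exchange, reassoc_of% P.R_counit_left, HopfSplitting.one, Category.assoc,
    leftUnitor_inv_naturality]

theorem RB_counit_right : P.RB ≫ B ◁ P.counit = P.one ≫ (ρ_ B).inv := by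
  rw [RB, MonoidalCategory.tensorHom_def, Category.assoc, Category.assoc,
    ← MonoidalCategory.whiskerLeft_comp, P.quo_counit, ← whisker_exchange,
    reassoc_of% P.R_counit_right, HopfSplitting.one, Category.assoc, rightUnitor_inv_naturality]

theorem RB_comul_right : P.RB ≫ B ◁ P.comul = nest P.RB P.RB P.mul (𝟙 (B ⊗ B)) := by
  have h1 := nest_comp P.R P.R μ[H] (𝟙 (H ⊗ H)) P.quo (P.quo ⊗ₘ P.quo)
  have h2 := nest_natural P.R P.R (𝟙 H) P.quo (𝟙 H) P.quo (μ[H] ≫ P.quo) (𝟙 (B ⊗ B))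
  have h3 := nest_natural P.RB P.RB P.inc (𝟙 B) P.inc (𝟙 B) (μ[H] ≫ P.quo) (𝟙 (B ⊗ B))
  rw [tensorHom_id, P.RB_inc, ← id_tensorHom, h2] at h3
  simp only [id_tensorHom_id, Category.id_comp, Category.comp_id] at h1 h3
  have h4 : P.RB ≫ B ◁ P.comul = (P.R ≫ H ◁ Δ[H]) ≫ (P.quo ⊗ₘ (P.quo ⊗ₘ P.quo)) := by
    rw [RB, ← id_tensorHom, ← id_tensorHom, Category.assoc, Category.assoc,
      tensorHom_comp_tensorHom, tensorHom_comp_tensorHom, P.quo_comul, Category.id_comp,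
      Category.comp_id]
  rw [h4, P.R_comul_right, h1, h3, HopfSplitting.mul]

/-- The R-matrix of `H` is built from those of `A` and `B`. -/
theorem R_eq : P.R = nest P.RB P.RA ((P.inc ⊗ₘ P.i) ≫ μ[H]) P.iso.inv := by
  have h1 := nest_comp P.R P.R μ[H] (𝟙 (H ⊗ H)) (𝟙 H) ((P.p ⊗ₘ P.quo) ≫ P.iso.inv)
  have h2 := nest_natural P.R P.R (𝟙 H) P.quo (𝟙 H) P.p μ[H] P.iso.inv
  have h3 := nest_natural P.RB P.RA P.inc (𝟙 B) P.i (𝟙 A) μ[H] P.iso.inv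
  rw [tensorHom_id, tensorHom_id, P.RB_inc, ← P.R_right, ← id_tensorHom, ← id_tensorHom, h2] at h3
  simp only [id_tensorHom_id, Category.id_comp, Category.comp_id] at h1 h3
  rw [← h3, ← h1, ← P.R_comul_right, Category.assoc, id_tensorHom,
    ← MonoidalCategory.whiskerLeft_comp, ← Category.assoc]
  have h4 := P.iso.hom_inv_id
  rw [HopfSplitting.iso_hom] at h4
  rw [h4, MonoidalCategory.whiskerLeft_id, Category.comp_id]

theorem coactA_eq : P.coactA = (ρ_ B).inv ≫ B ◁ P.RA ≫ (α_ B A A).inv ≫ P.act ▷ A :=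
  HopfSplitting.coactA_eq P.toHopfSplitting P.quasitriangular P.inc_comulBar P.R_right
    P.RA_counit_left

/-- Projecting the first leg of `R` to `B` gives `R_B` with the coaction of `A` on its first leg. -/
theorem R_quo : P.R ≫ P.quo ▷ H = P.RB ≫ P.coactA ▷ B ≫ (α_ B A B).hom ≫ B ◁ P.iso.inv := by
  have h := nest_comp P.RB P.RA ((P.inc ⊗ₘ P.i) ≫ μ[H]) P.iso.inv P.quo (𝟙 H)
  rw [← R_eq, tensorHom_id, Category.assoc, ← P.act_eq, Category.comp_id] at h
  rw [h, coactA_eq, nest, MonoidalCategory.tensorHom_def]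
  monoidal

/-- The R-matrix of `B` is a morphism of `A`-modules. -/
theorem RB_linear : ((λ_ A).hom ≫ ε[A]) ≫ P.RB = P.RB ▷ A ≫ diagAct Δ[A] P.act P.act := by
  have h := (P.i ≫= P.quasitriangular) =≫ (P.quo ⊗ₘ P.quo)
  have h1 : P.act ⊗ₘ P.act = ((𝟙 B ⊗ₘ P.i) ⊗ₘ (𝟙 B ⊗ₘ P.i)) ≫ (P.ract ⊗ₘ P.ract) := by
    rw [tensorHom_comp_tensorHom, id_tensorHom, HopfSplitting.act]
  -- The product `R · Δ`, restricted to `A`, gives the diagonal action on `R_B`.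
  have hr : (P.i ≫ (λ_ H).inv ≫ convMul μ[H] P.R Δ[H]) ≫ (P.quo ⊗ₘ P.quo) =
      (λ_ A).inv ≫ P.RB ▷ A ≫ diagAct Δ[A] P.act P.act := by
    rw [convMul]
    simp only [Category.assoc]
    rw [tensorHom_comp_tensorHom, P.mul_quo, ← tensorHom_comp_tensorHom, ← tensorμ_natural_assoc,
      leftUnitor_inv_naturality_assoc, ← id_tensorHom, tensorHom_comp_tensorHom_assoc, P.i_comul,
      tensorHom_comp_tensorHom_assoc, Category.id_comp, ← RB, id_tensorHom_id, Category.comp_id,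
      diagAct, tensorAct, h1, ← tensorμ_natural_assoc, ← MonoidalCategory.tensorHom_def_assoc,
      id_tensorHom_id, tensorHom_comp_tensorHom_assoc, Category.comp_id]
  -- The product `Ψ Δ' · R`, restricted to `A`, has left factors in `A`, which `quo` replaces by
  -- their counits.
  have hl : (P.i ≫ (ρ_ H).inv ≫ convMul μ[H] (P.comulBar ≫ (β_ H H).hom) P.R) ≫
      (P.quo ⊗ₘ P.quo) = ε[A] ≫ P.RB := by
    have h3 : (P.comulBarA ≫ (β_ A A).hom) ≫ (ε[A] ⊗ₘ ε[A]) = ε[A] ≫ (λ_ (𝟙_ C)).inv := by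
      rw [Category.assoc, ← BraidedCategory.braiding_naturality, reassoc_of% P.comulBarA_counit,
        braiding_tensorUnit_left]
      monoidal
    have h4 : P.i ≫ P.comulBar ≫ (β_ H H).hom = (P.comulBarA ≫ (β_ A A).hom) ≫ (P.i ⊗ₘ P.i) := by
      rw [reassoc_of% P.i_comulBar, BraidedCategory.braiding_naturality, Category.assoc]
    rw [convMul]
    simp only [Category.assoc]
    rw [tensorHom_comp_tensorHom, rightUnitor_inv_naturality_assoc, ← tensorHom_id,
      tensorHom_comp_tensorHom_assoc, Category.id_comp, h4,
      ← Category.comp_id P.R, ← tensorHom_comp_tensorHom_assoc, ← id_tensorHom_id,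
      tensorμ_natural_assoc, tensorHom_comp_tensorHom, P.i_mul_quo, ← tensorHom_comp_tensorHom,
      ← tensorμ_natural_assoc, tensorHom_comp_tensorHom_assoc, h3, id_tensorHom_id,
      Category.comp_id, MonoidalCategory.tensorHom_def', comp_whiskerRight]
    simp only [Category.assoc]
    rw [← tensorHom_comp_tensorHom, reassoc_of% tensorμ_leftUnitor]
    simp only [tensorHom_comp_tensorHom_assoc, Iso.inv_hom_id, RB, id_tensorHom_id,
      Category.id_comp]
    rw [whisker_exchange_assoc]
    monoidal
  rw [hl, hr] at h
  rw [Category.assoc, h, Iso.hom_inv_id_assoc]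

/-- `R_B` is multiplicative in its first leg, for the crossed braiding. -/
theorem RB_comul_left : P.RB ≫ P.comulBarB ▷ B = (λ_ (𝟙_ C)).inv ≫ (P.RB ⊗ₘ P.RB) ≫
    (α_ B B (B ⊗ B)).hom ≫ B ◁ slide P.cross P.mul ≫ (α_ B B B).inv := by
  have h := (comul_left_iff _ _ _).1 P.R_comul_left =≫ ((P.quo ⊗ₘ P.quo) ⊗ₘ P.quo)
  have hc : slide P.cross P.mul =
      B ◁ (P.coactA ▷ B ≫ (α_ B A B).hom ≫ B ◁ P.iso.inv) ≫ slide (β_ B B).hom P.ract := by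
    rw [slide, P.cross_mul, Iso.inv_hom_id_assoc, slide]
  have hs : slide (β_ H H).hom μ[H] ≫ (P.quo ⊗ₘ P.quo) =
      (P.quo ⊗ₘ (P.quo ⊗ₘ 𝟙 H)) ≫ slide (β_ B B).hom P.ract := by
    have h1 := slide_natural (𝟙 H) (𝟙 H) (𝟙 H) P.quo μ[H]
    have h2 := slide_natural P.quo P.quo (𝟙 H) (𝟙 B) P.ract
    simp only [id_tensorHom_id, Category.id_comp, MonoidalCategory.whiskerLeft_id,
      Category.comp_id, id_whiskerRight] at h1 h2
    rw [← h2, ← P.mul_quo, h1, MonoidalCategory.tensorHom_def', Category.assoc]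
  have hl : P.RB ≫ P.comulBarB ▷ B =
      (P.R ≫ P.comulBar ▷ H) ≫ ((P.quo ⊗ₘ P.quo) ⊗ₘ P.quo) := by
    rw [RB, comulBarB, ← tensorHom_id, ← tensorHom_id, Category.assoc, Category.assoc,
      tensorHom_comp_tensorHom, tensorHom_comp_tensorHom, P.quo_comulBar]
    simp
  have ha : (α_ H H H).inv ≫ ((P.quo ⊗ₘ P.quo) ⊗ₘ P.quo) =
      (P.quo ⊗ₘ (P.quo ⊗ₘ P.quo)) ≫ (α_ B B B).inv :=
    (associator_inv_naturality _ _ _).symm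
  have hb : (P.quo ⊗ₘ (P.quo ⊗ₘ (P.quo ⊗ₘ 𝟙 H))) = (α_ _ _ _).inv ≫
      ((P.quo ⊗ₘ P.quo) ⊗ₘ (P.quo ⊗ₘ 𝟙 H)) ≫ (α_ B B (B ⊗ H)).hom := by
    rw [associator_naturality, Iso.inv_hom_id_assoc]
  rw [hl, h]
  simp only [Category.assoc]
  rw [ha, ← id_tensorHom H, tensorHom_comp_tensorHom_assoc, Category.id_comp, hs,
    ← Category.comp_id P.quo, ← tensorHom_comp_tensorHom_assoc, Category.comp_id, hb]
  simp only [Category.assoc, Iso.hom_inv_id_assoc]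
  rw [tensorHom_comp_tensorHom_assoc, tensorHom_id, P.R_quo, ← RB, hc, ← Category.comp_id P.RB,
    ← tensorHom_comp_tensorHom, Category.comp_id]
  simp

/-- The action of the first leg of `R` on `B`, in terms of the coaction of `A` on `B`. -/
theorem R_ract : (ρ_ B).inv ≫ B ◁ P.R ≫ (α_ B H H).inv ≫ P.ract ▷ H =
    (ρ_ B).inv ≫ (P.coactA ⊗ₘ P.R ≫ P.quo ▷ H) ≫ tensorμ B A B H ≫ (P.mul ⊗ₘ P.lmul) := by
  have h1 : B ◁ ((P.inc ⊗ₘ P.i) ≫ μ[H]) ≫ P.ract = (α_ B B A).inv ≫ P.mul ▷ A ≫ P.act := by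
    rw [MonoidalCategory.whiskerLeft_comp, Category.assoc, P.ract_mul, HopfSplitting.act,
      P.mul_eq_ract, comp_whiskerRight, Category.assoc, ← whisker_exchange_assoc,
      MonoidalCategory.tensorHom_def]
    monoidal
  have h3 : P.mul ⊗ₘ P.lmul = P.mul ▷ _ ≫ B ◁ P.lmul := MonoidalCategory.tensorHom_def _ _
  calc
    _ = 𝟙 _ ⊗≫ B ◁ P.RB ⊗≫ B ◁ B ◁ P.RA ▷ B ⊗≫ (B ◁ ((P.inc ⊗ₘ P.i) ≫ μ[H]) ≫ P.ract) ▷ (A ⊗ B) ⊗≫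
        B ◁ P.iso.inv := by
      conv_lhs => rw [P.R_eq]
      calc
        _ = 𝟙 _ ⊗≫ B ◁ P.RB ⊗≫ B ◁ B ◁ P.RA ▷ B ⊗≫ B ◁ ((P.inc ⊗ₘ P.i) ≫ μ[H]) ▷ (A ⊗ B) ⊗≫
            ((B ⊗ H) ◁ P.iso.inv ≫ P.ract ▷ H) ⊗≫ 𝟙 _ := by
          rw [nest, MonoidalCategory.tensorHom_def _ P.iso.inv]
          monoidal
        _ = _ := by
          rw [whisker_exchange]
          monoidal
    _ = 𝟙 _ ⊗≫ B ◁ P.RB ⊗≫ ((B ⊗ B) ◁ P.RA ≫ P.mul ▷ (A ⊗ A)) ▷ B ⊗≫ P.act ▷ A ▷ B ⊗≫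
        B ◁ P.iso.inv := by
      rw [h1]
      monoidal
    _ = 𝟙 _ ⊗≫ B ◁ P.RB ⊗≫ (P.mul ≫ P.coactA) ▷ B ⊗≫ B ◁ P.iso.inv := by
      rw [whisker_exchange, coactA_eq]
      monoidal
    _ = 𝟙 _ ⊗≫ (B ◁ P.RB ≫ P.coactA ▷ (B ⊗ B)) ⊗≫ (B ⊗ A) ◁ P.coactA ▷ B ⊗≫
        B ◁ (β_ A B).hom ▷ A ▷ B ⊗≫ (P.mul ▷ (A ⊗ A) ≫ B ◁ μ[A]) ▷ B ⊗≫ B ◁ P.iso.inv := by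
      rw [P.mul_coactA, MonoidalCategory.tensorHom_def P.coactA,
        MonoidalCategory.tensorHom_def P.mul]
      simp only [tensorμ]
      monoidal
    _ = 𝟙 _ ⊗≫ P.coactA ⊗≫ (B ⊗ A) ◁ (P.RB ≫ P.coactA ▷ B) ⊗≫
        B ◁ (β_ A B).hom ▷ A ▷ B ⊗≫ P.mul ▷ (A ⊗ A) ▷ B ⊗≫ B ◁ (μ[A] ▷ B ≫ P.iso.inv) := by
      rw [whisker_exchange]
      monoidal
    _ = 𝟙 _ ⊗≫ P.coactA ⊗≫ (B ⊗ A) ◁ (P.RB ≫ P.coactA ▷ B) ⊗≫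
        B ◁ (β_ A B).hom ▷ A ▷ B ⊗≫ (P.mul ▷ (A ⊗ A ⊗ B) ≫ B ◁ A ◁ P.iso.inv) ⊗≫ B ◁ P.lmul := by
      rw [P.mul_whiskerRight_iso_inv]
      monoidal
    _ = 𝟙 _ ⊗≫ P.coactA ⊗≫ (B ⊗ A) ◁ (P.RB ≫ P.coactA ▷ B) ⊗≫
        B ◁ ((β_ A B).hom ▷ (A ⊗ B) ≫ (B ⊗ A) ◁ P.iso.inv) ⊗≫ P.mul ▷ (A ⊗ H) ⊗≫ B ◁ P.lmul := by
      rw [← whisker_exchange]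
      monoidal
    _ = _ := by
      rw [← whisker_exchange, P.R_quo, MonoidalCategory.tensorHom_def, h3]
      simp only [tensorμ]
      monoidal

/-- In a product with the R-matrix, the crossed braiding may be traded for the plain one. This
reduces the quasitriangularity of `B` to that of `H`. -/
theorem cross_R : (ρ_ (B ⊗ B)).inv ≫ (P.cross ⊗ₘ P.R ≫ P.quo ▷ H) ≫ tensorμ B B B H ≫
      (P.mul ⊗ₘ P.ract) =
    (ρ_ (B ⊗ B)).inv ≫ ((β_ B B).hom ⊗ₘ P.R) ≫ tensorμ B B H H ≫ (P.ract ⊗ₘ P.ract) := by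
  have h1 : P.act ▷ H ≫ P.ract = (α_ B A H).hom ≫ B ◁ P.lmul ≫ P.ract := by
    rw [HopfSplitting.act, HopfProjection.lmul, MonoidalCategory.whiskerLeft_comp, Category.assoc,
      P.ract_mul]
    monoidal
  have h2 : P.act ▷ B ≫ (β_ B B).hom = ((α_ _ _ _).hom ≫ B ◁ (β_ A B).hom ≫ (α_ _ _ _).inv ≫
      (β_ B B).hom ▷ A ≫ (α_ _ _ _).hom) ≫ B ◁ P.act := by
    rw [BraidedCategory.braiding_naturality_left, BraidedCategory.braiding_tensor_left_hom]
  have h3 : B ◁ P.ract ≫ (β_ B B).hom = ((α_ _ _ _).inv ≫ (β_ B B).hom ▷ H ≫ (α_ _ _ _).hom ≫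
      B ◁ (β_ B H).hom ≫ (α_ _ _ _).inv) ≫ P.ract ▷ B := by
    rw [BraidedCategory.braiding_naturality_right, BraidedCategory.braiding_tensor_right_hom]
  have h4 : B ◁ P.mul ≫ (β_ B B).hom = ((α_ _ _ _).inv ≫ (β_ B B).hom ▷ B ≫ (α_ _ _ _).hom ≫
      B ◁ (β_ B B).hom ≫ (α_ _ _ _).inv) ≫ P.mul ▷ B := by
    rw [BraidedCategory.braiding_naturality_right, BraidedCategory.braiding_tensor_right_hom]
  have hl : (ρ_ (B ⊗ B)).inv ≫ (P.cross ⊗ₘ P.R ≫ P.quo ▷ H) ≫ tensorμ B B B H ≫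
      (P.mul ⊗ₘ P.ract) = B ◁ ((ρ_ B).inv ≫ (P.coactA ⊗ₘ P.R ≫ P.quo ▷ H) ≫ tensorμ B A B H ≫
        (P.mul ⊗ₘ P.lmul)) ≫ (α_ B B H).inv ≫ (β_ B B).hom ▷ H ≫ (α_ B B H).hom ≫ B ◁ P.ract := by
    generalize P.R ≫ P.quo ▷ H = t
    calc
      _ = 𝟙 _ ⊗≫ B ◁ P.coactA ⊗≫ (β_ B B).hom ▷ A ⊗≫ B ◁ (P.act ▷ 𝟙_ C ≫ B ◁ t) ⊗≫
          B ◁ (β_ B B).hom ▷ H ⊗≫ P.mul ▷ (B ⊗ H) ⊗≫ B ◁ P.ract := by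
        rw [MonoidalCategory.tensorHom_def, MonoidalCategory.tensorHom_def P.mul,
          HopfSplitting.cross]
        simp only [tensorμ]
        monoidal
      _ = 𝟙 _ ⊗≫ B ◁ P.coactA ⊗≫ (β_ B B).hom ▷ A ⊗≫ B ◁ (B ⊗ A) ◁ t ⊗≫
          B ◁ (P.act ▷ B ≫ (β_ B B).hom) ▷ H ⊗≫ P.mul ▷ (B ⊗ H) ⊗≫ B ◁ P.ract := by
        rw [← whisker_exchange]
        monoidal
      _ = 𝟙 _ ⊗≫ B ◁ P.coactA ⊗≫ (β_ B B).hom ▷ A ⊗≫ B ◁ (B ⊗ A) ◁ t ⊗≫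
          B ◁ B ◁ (β_ A B).hom ▷ H ⊗≫ B ◁ (β_ B B).hom ▷ A ▷ H ⊗≫
          ((B ⊗ B) ◁ P.act ▷ H ≫ P.mul ▷ (B ⊗ H)) ⊗≫ B ◁ P.ract := by
        rw [h2]
        monoidal
      _ = 𝟙 _ ⊗≫ B ◁ P.coactA ⊗≫ (β_ B B).hom ▷ A ⊗≫ B ◁ (B ⊗ A) ◁ t ⊗≫
          B ◁ B ◁ (β_ A B).hom ▷ H ⊗≫ B ◁ (β_ B B).hom ▷ A ▷ H ⊗≫
          P.mul ▷ ((B ⊗ A) ⊗ H) ⊗≫ B ◁ (P.act ▷ H ≫ P.ract) := by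
        rw [whisker_exchange]
        monoidal
      _ = 𝟙 _ ⊗≫ B ◁ P.coactA ⊗≫ ((β_ B B).hom ▷ (A ⊗ 𝟙_ C) ≫ (B ⊗ B) ◁ (A ◁ t)) ⊗≫
          B ◁ B ◁ (β_ A B).hom ▷ H ⊗≫ B ◁ (β_ B B).hom ▷ A ▷ H ⊗≫
          P.mul ▷ (B ⊗ (A ⊗ H)) ⊗≫ B ◁ B ◁ P.lmul ⊗≫ B ◁ P.ract := by
        rw [h1]
        monoidal
      _ = 𝟙 _ ⊗≫ B ◁ P.coactA ⊗≫ B ◁ (B ⊗ A) ◁ t ⊗≫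
          ((β_ B B).hom ▷ (A ⊗ B ⊗ H) ≫ (B ⊗ B) ◁ ((α_ _ _ _).inv ≫ (β_ A B).hom ▷ H)) ⊗≫
          B ◁ (β_ B B).hom ▷ A ▷ H ⊗≫
          P.mul ▷ (B ⊗ (A ⊗ H)) ⊗≫ B ◁ B ◁ P.lmul ⊗≫ B ◁ P.ract := by
        rw [← whisker_exchange]
        monoidal
      _ = 𝟙 _ ⊗≫ B ◁ P.coactA ⊗≫ B ◁ (B ⊗ A) ◁ t ⊗≫ B ◁ B ◁ (β_ A B).hom ▷ H ⊗≫
          (B ◁ P.mul ≫ (β_ B B).hom) ▷ (A ⊗ H) ⊗≫ B ◁ B ◁ P.lmul ⊗≫ B ◁ P.ract := by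
        rw [← whisker_exchange, h4]
        monoidal
      _ = 𝟙 _ ⊗≫ B ◁ P.coactA ⊗≫ B ◁ (B ⊗ A) ◁ t ⊗≫ B ◁ B ◁ (β_ A B).hom ▷ H ⊗≫
          B ◁ P.mul ▷ (A ⊗ H) ⊗≫ ((β_ B B).hom ▷ (A ⊗ H) ≫ (B ⊗ B) ◁ P.lmul) ⊗≫
          B ◁ P.ract := by
        monoidal
      _ = _ := by
        rw [← whisker_exchange, MonoidalCategory.tensorHom_def,
          MonoidalCategory.tensorHom_def P.mul]
        simp only [tensorμ]
        monoidal
  rw [hl, ← R_ract]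
  calc
    _ = 𝟙 _ ⊗≫ B ◁ B ◁ P.R ⊗≫ (B ◁ P.ract ≫ (β_ B B).hom) ▷ H ⊗≫ B ◁ P.ract := by
      monoidal
    _ = 𝟙 _ ⊗≫ ((B ⊗ B) ◁ P.R ≫ (β_ B B).hom ▷ (H ⊗ H)) ⊗≫ B ◁ (β_ B H).hom ▷ H ⊗≫
        P.ract ▷ (B ⊗ H) ⊗≫ B ◁ P.ract := by
      rw [h3]
      monoidal
    _ = _ := by
      rw [MonoidalCategory.tensorHom_def', MonoidalCategory.tensorHom_def P.ract]
      simp only [tensorμ]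
      monoidal

/-- Quasitriangularity for `R_B`, with all products formed with the crossed braiding. Both sides are
images under `quo ⊗ quo` of the corresponding products for `H`. -/
theorem RB_quasitriangular :
    (ρ_ B).inv ≫ (P.comulBarB ≫ P.cross ⊗ₘ P.RB) ≫ (α_ B B (B ⊗ B)).hom ≫ B ◁ (α_ B B B).inv ≫
      B ◁ P.cross ▷ B ≫ B ◁ (α_ B B B).hom ≫ (α_ B B (B ⊗ B)).inv ≫ (P.mul ⊗ₘ P.mul) =
    (λ_ B).inv ≫ (P.RB ⊗ₘ P.comul) ≫ (α_ B B (B ⊗ B)).hom ≫ B ◁ (α_ B B B).inv ≫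
      B ◁ P.cross ▷ B ≫ B ◁ (α_ B B B).hom ≫ (α_ B B (B ⊗ B)).inv ≫ (P.mul ⊗ₘ P.mul) := by
  have hg : ∀ {Y Z : C} (f : Y ⟶ H ⊗ H) (g : Z ⟶ H ⊗ H), convMul μ[H] f g ≫ (P.quo ⊗ₘ P.quo) =
      (f ≫ (P.quo ⊗ₘ P.quo) ⊗ₘ g) ≫ tensorμ B B H H ≫ (P.ract ⊗ₘ P.ract) := by
    intro Y Z f g
    rw [convMul, Category.assoc, Category.assoc, tensorHom_comp_tensorHom, P.mul_quo,
      ← tensorHom_comp_tensorHom, ← tensorμ_natural_assoc, tensorHom_comp_tensorHom_assoc,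
      id_tensorHom_id, Category.comp_id]
  have hr : (λ_ B).inv ≫ (P.RB ⊗ₘ P.comul) ≫ (α_ B B (B ⊗ B)).hom ≫ B ◁ (α_ B B B).inv ≫
      B ◁ P.cross ▷ B ≫ B ◁ (α_ B B B).hom ≫ (α_ B B (B ⊗ B)).inv ≫ (P.mul ⊗ₘ P.mul) =
      P.inc ≫ (λ_ H).inv ≫ convMul μ[H] P.R Δ[H] ≫ (P.quo ⊗ₘ P.quo) := by
    have h1 : P.mul ⊗ₘ P.ract = ((𝟙 B ⊗ₘ P.inc) ⊗ₘ (𝟙 B ⊗ₘ 𝟙 H)) ≫ (P.ract ⊗ₘ P.ract) := by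
      rw [tensorHom_comp_tensorHom, id_tensorHom, id_tensorHom_id, Category.id_comp, P.mul_eq_ract]
    rw [P.cross_mul_mul, MonoidalCategory.tensorHom_def, Category.assoc,
      ← MonoidalCategory.whiskerLeft_comp_assoc, ← P.rcoact_eq,
      ← MonoidalCategory.tensorHom_def_assoc, h1, ← tensorμ_natural_assoc,
      tensorHom_comp_tensorHom_assoc, tensorHom_id P.inc, P.rcoact_inc, id_tensorHom_id,
      Category.comp_id, hg, leftUnitor_inv_naturality_assoc, ← id_tensorHom,
      tensorHom_comp_tensorHom_assoc, Category.id_comp, RB]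
  have hl : (ρ_ B).inv ≫ (P.comulBarB ≫ P.cross ⊗ₘ P.RB) ≫ (α_ B B (B ⊗ B)).hom ≫
      B ◁ (α_ B B B).inv ≫ B ◁ P.cross ▷ B ≫ B ◁ (α_ B B B).hom ≫ (α_ B B (B ⊗ B)).inv ≫
      (P.mul ⊗ₘ P.mul) =
      P.inc ≫ (ρ_ H).inv ≫ convMul μ[H] (P.comulBar ≫ (β_ H H).hom) P.R ≫ (P.quo ⊗ₘ P.quo) := by
    have h2 : ∀ {Y Z W : C} (f : Y ⟶ Z) (g : 𝟙_ C ⟶ W), (ρ_ Y).inv ≫ (f ⊗ₘ g) =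
        f ≫ (ρ_ Z).inv ≫ (𝟙 Z ⊗ₘ g) := by
      intro Y Z W f g
      rw [MonoidalCategory.tensorHom_def, rightUnitor_inv_naturality_assoc, id_tensorHom]
    have h3 := P.cross_R
    rw [P.cross_mul_mul, ← id_tensorHom (B ⊗ B), tensorHom_comp_tensorHom_assoc, ← P.R_quo,
      Category.comp_id, reassoc_of% (h2 (P.comulBarB ≫ P.cross)), ← reassoc_of% (h2 P.cross), h3,
      hg, reassoc_of% (h2 (β_ B B).hom), reassoc_of% (h2 (_ ≫ (P.quo ⊗ₘ P.quo))), comulBarB]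
    simp only [Category.assoc, BraidedCategory.braiding_naturality_assoc]
  rw [hl, hr, reassoc_of% P.quasitriangular]

end QuasitriangularSplitting

/-! ### Convolution inverses of R-matrices -/

section skew

theorem copairing_unit {X : C} [HopfObj X] {R : 𝟙_ C ⟶ X ⊗ X}
    (hε : R ≫ X ◁ ε[X] = η[X] ≫ (ρ_ X).inv) :
    R ≫ X ◁ (ε[X] ≫ η[X]) = (λ_ (𝟙_ C)).inv ≫ (η[X] ⊗ₘ η[X]) := by
  rw [MonoidalCategory.whiskerLeft_comp, reassoc_of% hε, MonoidalCategory.tensorHom_def,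
    rightUnitor_inv_naturality_assoc]
  monoidal

variable {X : C} [HopfObj X] [IsIso 𝒮[X]]

/-- The inverse of the antipode is an antipode for the opposite multiplication, formed with the
inverse braiding (this and the next lemma). -/
theorem comul_inv_antipode_left :
    Δ[X] ≫ (inv 𝒮[X] ⊗ₘ 𝟙 X) ≫ (β_ X X).inv ≫ μ[X] = ε[X] ≫ η[X] := by
  rw [← cancel_mono 𝒮[X]]
  simp only [Category.assoc, HopfObj.mul_antipode, HopfObj.one_antipode]
  rw [BraidedCategory.braiding_naturality_assoc, Iso.inv_hom_id_assoc,
    tensorHom_comp_tensorHom_assoc, IsIso.inv_hom_id, Category.id_comp, id_tensorHom,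
    HopfObj.antipode_right]

theorem comul_inv_antipode_right :
    Δ[X] ≫ (𝟙 X ⊗ₘ inv 𝒮[X]) ≫ (β_ X X).inv ≫ μ[X] = ε[X] ≫ η[X] := by
  rw [← cancel_mono 𝒮[X]]
  simp only [Category.assoc, HopfObj.mul_antipode, HopfObj.one_antipode]
  rw [BraidedCategory.braiding_naturality_assoc, Iso.inv_hom_id_assoc,
    tensorHom_comp_tensorHom_assoc, IsIso.inv_hom_id, Category.id_comp, tensorHom_id,
    HopfObj.antipode_left]

/-- A product in the tensor square algebra, written as a nested product. -/
theorem convMul_eq_nest {X : C} (m : X ⊗ X ⟶ X) (r t : 𝟙_ C ⟶ X ⊗ X) :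
    (λ_ (𝟙_ C)).inv ≫ convMul m r t = nest r t m ((β_ X X).inv ≫ m) := by
  have h : (ρ_ X).inv ≫ X ◁ t ≫ (α_ X X X).inv ≫ (β_ X X).hom ▷ X =
      (λ_ X).inv ≫ t ▷ X ≫ (α_ X X X).hom ≫ X ◁ (β_ X X).inv ≫ (α_ X X X).inv :=
    @ModuleO.insert_braiding C _ _ (reverseBraiding C) X X t
  calc
    _ = 𝟙 _ ⊗≫ r ⊗≫ X ◁ ((ρ_ X).inv ≫ X ◁ t ≫ (α_ X X X).inv ≫ (β_ X X).hom ▷ X) ⊗≫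
        (m ⊗ₘ m) := by
      rw [convMul, MonoidalCategory.tensorHom_def]
      simp only [tensorμ]
      monoidal
    _ = _ := by
      rw [h, nest, MonoidalCategory.tensorHom_def', MonoidalCategory.tensorHom_def']
      monoidal

variable {R : 𝟙_ C ⟶ X ⊗ X}

/-- `(id ⊗ S⁻¹) R` is a convolution inverse of the copairing `R` (this and the next lemma). -/
theorem R_mul_inv_antipode (hΔ : R ≫ X ◁ Δ[X] = nest R R μ[X] (𝟙 (X ⊗ X)))
    (hε : R ≫ X ◁ ε[X] = η[X] ≫ (ρ_ X).inv) :
    (λ_ (𝟙_ C)).inv ≫ convMul μ[X] R (R ≫ X ◁ inv 𝒮[X]) =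
      (λ_ (𝟙_ C)).inv ≫ (η[X] ⊗ₘ η[X]) := by
  have h1 := nest_natural R R (𝟙 X) (𝟙 X) (𝟙 X) (inv 𝒮[X]) μ[X] ((β_ X X).inv ≫ μ[X])
  have h2 := nest_comp R R μ[X] (𝟙 (X ⊗ X)) (𝟙 X) ((inv 𝒮[X] ⊗ₘ 𝟙 X) ≫ (β_ X X).inv ≫ μ[X])
  simp only [id_tensorHom_id, Category.comp_id, Category.id_comp] at h1 h2
  rw [convMul_eq_nest, ← id_tensorHom, h1, ← h2, ← hΔ, id_tensorHom, Category.assoc,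
    ← MonoidalCategory.whiskerLeft_comp, comul_inv_antipode_left, copairing_unit hε]

theorem inv_antipode_mul_R (hΔ : R ≫ X ◁ Δ[X] = nest R R μ[X] (𝟙 (X ⊗ X)))
    (hε : R ≫ X ◁ ε[X] = η[X] ≫ (ρ_ X).inv) :
    (λ_ (𝟙_ C)).inv ≫ convMul μ[X] (R ≫ X ◁ inv 𝒮[X]) R =
      (λ_ (𝟙_ C)).inv ≫ (η[X] ⊗ₘ η[X]) := by
  have h1 := nest_natural R R (𝟙 X) (inv 𝒮[X]) (𝟙 X) (𝟙 X) μ[X] ((β_ X X).inv ≫ μ[X])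
  have h2 := nest_comp R R μ[X] (𝟙 (X ⊗ X)) (𝟙 X) ((𝟙 X ⊗ₘ inv 𝒮[X]) ≫ (β_ X X).inv ≫ μ[X])
  simp only [id_tensorHom_id, Category.comp_id, Category.id_comp] at h1 h2
  rw [convMul_eq_nest, ← id_tensorHom, h1, ← h2, ← hΔ, id_tensorHom, Category.assoc,
    ← MonoidalCategory.whiskerLeft_comp, comul_inv_antipode_right, copairing_unit hε]

end skew

/-! ### The inverse R-matrix and the inverse braiding -/

section bar

/-- The braiding exchanges the tensor square algebras formed with the braiding and its inverse. -/
theorem convMul_reverse {X Y Z : C} (m : X ⊗ X ⟶ X) (f : Y ⟶ X ⊗ X) (g : Z ⟶ X ⊗ X) :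
    @convMul C _ _ (reverseBraiding C) X Y Z m f g ≫ (β_ X X).hom =
      convMul m (f ≫ (β_ X X).hom) (g ≫ (β_ X X).hom) := by
  have h := tensorAct_braiding m m
  simp only [tensorAct, Category.assoc] at h
  change ((f ⊗ₘ g) ≫ @tensorμ C _ _ (reverseBraiding C) X X X X ≫ (m ⊗ₘ m)) ≫ _ = _
  rw [Category.assoc, Category.assoc, h, convMul, ← tensorHom_comp_tensorHom,
    Category.assoc, MonoidalCategory.tensorHom_def (β_ X X).hom, Category.assoc]

variable {A H : C} [HopfObj A] [HopfObj H]

theorem conv_counit_right (f : H ⟶ H ⊗ H) (r : 𝟙_ C ⟶ H ⊗ H) :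
    conv f (ε[H] ≫ r) = (ρ_ H).inv ≫ convMul μ[H] f r := by
  have h : f ⊗ₘ ε[H] ≫ r = (𝟙 H ⊗ₘ ε[H]) ≫ (f ⊗ₘ r) := by
    rw [tensorHom_comp_tensorHom, Category.id_comp]
  rw [conv_eq, h, id_tensorHom, Category.assoc, ComonObj.comul_counit_assoc]
  rfl

theorem conv_counit_left (f : H ⟶ H ⊗ H) (r : 𝟙_ C ⟶ H ⊗ H) :
    conv (ε[H] ≫ r) f = (λ_ H).inv ≫ convMul μ[H] r f := by
  have h : ε[H] ≫ r ⊗ₘ f = (ε[H] ⊗ₘ 𝟙 H) ≫ (r ⊗ₘ f) := by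
    rw [tensorHom_comp_tensorHom, Category.id_comp]
  rw [conv_eq, h, tensorHom_id, Category.assoc, ComonObj.counit_comul_assoc]
  rfl

theorem conv_counit_counit {r t : 𝟙_ C ⟶ H ⊗ H}
    (h : (λ_ (𝟙_ C)).inv ≫ convMul μ[H] r t = (λ_ (𝟙_ C)).inv ≫ (η[H] ⊗ₘ η[H])) :
    conv (ε[H] ≫ r) (ε[H] ≫ t) = ε[H] ≫ η[H ⊗ H] := by
  have h1 : ε[H] ≫ r ⊗ₘ t = ε[H] ▷ 𝟙_ C ≫ (r ⊗ₘ t) := by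
    rw [← tensorHom_id, tensorHom_comp_tensorHom, Category.id_comp]
  rw [conv_counit_right, MonObj.tensorObj.one_def, ← h, convMul, convMul, h1, Category.assoc,
    ← rightUnitor_inv_naturality_assoc, unitors_inv_equal]

/-- The inverse R-matrix intertwines the two comultiplications in the category with the inverse
braiding. -/
theorem quasitriangular_bar {Δ' : H ⟶ H ⊗ H} {R Rinv : 𝟙_ C ⟶ H ⊗ H}
    (hq : (ρ_ H).inv ≫ convMul μ[H] (Δ' ≫ (β_ H H).hom) R = (λ_ H).inv ≫ convMul μ[H] R Δ[H])
    (h1 : (λ_ (𝟙_ C)).inv ≫ convMul μ[H] R Rinv = (λ_ (𝟙_ C)).inv ≫ (η[H] ⊗ₘ η[H]))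
    (h2 : (λ_ (𝟙_ C)).inv ≫ convMul μ[H] Rinv R = (λ_ (𝟙_ C)).inv ≫ (η[H] ⊗ₘ η[H])) :
    (ρ_ H).inv ≫ @convMul C _ _ (reverseBraiding C) _ _ _ μ[H] (Δ[H] ≫ (β_ H H).inv)
        (Rinv ≫ (β_ H H).inv) =
      (λ_ H).inv ≫ @convMul C _ _ (reverseBraiding C) _ _ _ μ[H] (Rinv ≫ (β_ H H).inv) Δ' := by
  rw [← cancel_mono (β_ H H).hom, Category.assoc, Category.assoc, convMul_reverse,
    convMul_reverse]
  simp only [Category.assoc, Iso.inv_hom_id, Category.comp_id]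
  rw [← conv_counit_right, ← conv_counit_left] at hq ⊢
  rw [← unit_conv (conv Δ[H] _), ← conv_counit_counit h2, conv_assoc, ← conv_assoc _ Δ[H], ← hq,
    conv_assoc, conv_counit_counit h1, conv_unit]

theorem mul_tensorHom {X Y X' Y' : C} [MonObj X] [MonObj Y] [MonObj X'] [MonObj Y'] {f : X ⟶ X'}
    {g : Y ⟶ Y'} (hf : μ[X] ≫ f = (f ⊗ₘ f) ≫ μ[X']) (hg : μ[Y] ≫ g = (g ⊗ₘ g) ≫ μ[Y']) :
    μ[X ⊗ Y] ≫ (f ⊗ₘ g) = ((f ⊗ₘ g) ⊗ₘ (f ⊗ₘ g)) ≫ μ[X' ⊗ Y'] := by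
  rw [MonObj.tensorObj.mul_def, MonObj.tensorObj.mul_def, Category.assoc,
    tensorHom_comp_tensorHom, hf, hg, ← tensorHom_comp_tensorHom, tensorμ_natural_assoc]

theorem map_inverse {X Y X' Y' : C} [MonObj X] [MonObj Y] [MonObj X'] [MonObj Y'] {f : X ⟶ X'}
    {g : Y ⟶ Y'} (hf : μ[X] ≫ f = (f ⊗ₘ f) ≫ μ[X']) (hg : μ[Y] ≫ g = (g ⊗ₘ g) ≫ μ[Y'])
    (hf1 : η[X] ≫ f = η[X']) (hg1 : η[Y] ≫ g = η[Y']) {r t : 𝟙_ C ⟶ X ⊗ Y}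
    (h : (λ_ (𝟙_ C)).inv ≫ (r ⊗ₘ t) ≫ μ[X ⊗ Y] = η[X ⊗ Y]) :
    (λ_ (𝟙_ C)).inv ≫ (r ≫ (f ⊗ₘ g) ⊗ₘ t ≫ (f ⊗ₘ g)) ≫ μ[X' ⊗ Y'] = η[X' ⊗ Y'] := by
  rw [← tensorHom_comp_tensorHom, Category.assoc, ← mul_tensorHom hf hg, reassoc_of% h,
    MonObj.tensorObj.one_def, MonObj.tensorObj.one_def, Category.assoc, tensorHom_comp_tensorHom,
    hf1, hg1]

/-- The relation between the R-matrices of `H` and `A` is inherited by their inverses. -/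
theorem HopfProjection.inverse_p (P : HopfProjection A H) {R Rinv : 𝟙_ C ⟶ H ⊗ H}
    {RA RAinv : 𝟙_ C ⟶ A ⊗ A} (hR : R ≫ P.p ▷ H = RA ≫ A ◁ P.i)
    (h1 : (λ_ (𝟙_ C)).inv ≫ convMul μ[H] Rinv R = (λ_ (𝟙_ C)).inv ≫ (η[H] ⊗ₘ η[H]))
    (h2 : (λ_ (𝟙_ C)).inv ≫ convMul μ[A] RA RAinv = (λ_ (𝟙_ C)).inv ≫ (η[A] ⊗ₘ η[A])) :
    Rinv ≫ P.p ▷ H = RAinv ≫ A ◁ P.i := by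
  have hid : ∀ X : C, [MonObj X] → μ[X] ≫ 𝟙 X = (𝟙 X ⊗ₘ 𝟙 X) ≫ μ[X] := by
    intro X _
    simp
  have k1 := map_inverse P.p_mul (hid H) P.p_one (Category.comp_id _) h1
  have k2 := map_inverse (hid A) P.i_mul (Category.comp_id _) P.i_one h2
  rw [tensorHom_id] at k1
  rw [id_tensorHom] at k2
  rw [hR] at k1
  exact inverse_unique k1 k2

/-- The inverse R-matrix is normalized. -/
theorem inverse_counit {R Rinv : 𝟙_ C ⟶ A ⊗ A} (hR : R ≫ A ◁ ε[A] = η[A] ≫ (ρ_ A).inv)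
    (h : (λ_ (𝟙_ C)).inv ≫ convMul μ[A] R Rinv = (λ_ (𝟙_ C)).inv ≫ (η[A] ⊗ₘ η[A])) :
    Rinv ≫ A ◁ ε[A] = η[A] ≫ (ρ_ A).inv := by
  have hk : convMul μ[A] R Rinv ≫ A ◁ ε[A] ≫ (ρ_ A).hom =
      (R ≫ A ◁ ε[A] ≫ (ρ_ A).hom ⊗ₘ Rinv ≫ A ◁ ε[A] ≫ (ρ_ A).hom) ≫ μ[A] := by
    have h1 : μ[A] ≫ ε[A] = (ε[A] ⊗ₘ ε[A]) ≫ (λ_ (𝟙_ C)).hom := BimonObj.mul_counit A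
    have h2 : μ[A] ⊗ₘ μ[A] ≫ ε[A] = ((𝟙 A ⊗ₘ 𝟙 A) ⊗ₘ (ε[A] ⊗ₘ ε[A])) ≫
        (μ[A] ⊗ₘ (λ_ (𝟙_ C)).hom) := by
      rw [tensorHom_comp_tensorHom, h1, id_tensorHom_id, Category.id_comp]
    rw [convMul, Category.assoc, Category.assoc, ← id_tensorHom, tensorHom_comp_tensorHom_assoc,
      Category.comp_id, h2, Category.assoc, ← tensorμ_natural_assoc,
      tensorHom_comp_tensorHom_assoc, ← Category.assoc R, ← Category.assoc Rinv,
      ← tensorHom_comp_tensorHom (R ≫ _), Category.assoc]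
    simp only [tensorμ, braiding_tensorUnit_left, MonoidalCategory.tensorHom_def]
    monoidal
  have h3 := h =≫ (A ◁ ε[A] ≫ (ρ_ A).hom)
  rw [Category.assoc, hk, reassoc_of% hR, Iso.inv_hom_id, Category.comp_id] at h3
  have h4 : η[A] ≫ ε[A] = 𝟙 (𝟙_ C) := BimonObj.one_counit A
  rw [MonoidalCategory.tensorHom_def', Category.assoc, MonObj.one_mul, leftUnitor_naturality,
    Iso.inv_hom_id_assoc, MonoidalCategory.tensorHom_def, Category.assoc, Category.assoc,
    ← MonoidalCategory.whiskerLeft_comp_assoc, h4] at h3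
  rw [← cancel_mono (ρ_ A).hom, Category.assoc, h3]
  simp
  monoidal

end bar

/-! ### The coinvariants of a quantum group projection -/

theorem tensorμ_comp {X Y Z W V : C} (f : (X ⊗ Z) ⊗ (Y ⊗ W) ⟶ V) : tensorμ X Y Z W ≫ f =
    (α_ X Y (Z ⊗ W)).hom ≫ X ◁ (α_ Y Z W).inv ≫ X ◁ (β_ Y Z).hom ▷ W ≫
      X ◁ (α_ Z Y W).hom ≫ (α_ X Z (Y ⊗ W)).inv ≫ f := by
  simp only [tensorμ, Category.assoc]

/-- A Hopf algebra with its multiplication, unit and counit replaced by equal morphisms. -/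
@[reducible]
def hopfCopy {X : C} (h : HopfObj X) (m : X ⊗ X ⟶ X) (u : 𝟙_ C ⟶ X) (e : X ⟶ 𝟙_ C)
    (hm : h.mul = m) (hu : h.one = u) (he : h.counit = e) : HopfObj X where
  one := u
  mul := m
  counit := e
  comul := h.comul
  antipode := h.antipode
  one_mul := by subst hm hu; exact h.one_mul
  mul_one := by subst hm hu; exact h.mul_one
  mul_assoc := by subst hm; exact h.mul_assoc
  counit_comul := by subst he; exact h.counit_comul
  comul_counit := by subst he; exact h.comul_counit
  comul_assoc := h.comul_assoc
  mul_comul := by subst hm; exact h.mul_comul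
  one_comul := by subst hu; exact h.one_comul
  mul_counit := by subst hm he; exact h.mul_counit
  one_counit := by subst hu he; exact h.one_counit
  antipode_left := by subst hm hu he; exact h.antipode_left
  antipode_right := by subst hm hu he; exact h.antipode_right

/-- The Hopf algebra `X̄` in `C̄`, with the multiplication, unit and counit taken from `X`. -/
@[reducible]
def QuantumGroup.barHopf {X : C} (Q : QuantumGroup X) : @HopfObj C _ _ (reverseBraiding C) X :=
  @hopfCopy C _ _ (reverseBraiding C) X Q.hopfBar Q.mul Q.one Q.counit Q.mul_bar Q.one_bar
    Q.counit_bar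

namespace QuantumGroupProjection

variable {A H : C} {QA : QuantumGroup A} {QH : QuantumGroup H} (P : QuantumGroupProjection QA QH)

/-- The projection of `H` onto `A` in `C`. -/
@[reducible]
def fwd : @HopfProjection C _ _ _ A H QA.hopf QH.hopf :=
  letI := QA.hopf
  letI := QH.hopf
  { i := P.i
    p := P.p
    i_mul := P.i_hom.mul
    i_one := P.i_hom.one
    i_comul := P.i_hom.comul
    i_counit := P.i_hom.counit
    p_mul := P.p_hom.mul
    p_one := P.p_hom.one
    p_comul := P.p_hom.comul
    p_counit := P.p_hom.counit
    i_p := P.i_p }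

/-- The projection of `H̄` onto `Ā` in `C̄`. -/
@[reducible]
def bar : @HopfProjection C _ _ (reverseBraiding C) A H QA.barHopf QH.barHopf :=
  @HopfProjection.mk C _ _ (reverseBraiding C) A H QA.barHopf QH.barHopf P.i P.p P.i_hom.mul
    P.i_hom.one P.i_hom.comulBar P.i_hom.counit P.p_hom.mul P.p_hom.one P.p_hom.comulBar
    P.p_hom.counit P.i_p

/-- The common idempotent of the two projections. -/
def idem : H ⟶ H := QH.comul ≫ P.p ▷ H ≫ QA.S ▷ H ≫ P.i ▷ H ≫ QH.mul

theorem idem_idem : P.idem ≫ P.idem = P.idem := by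
  let _ := QA.hopf
  let _ := QH.hopf
  exact HopfProjection.comp_proj P.fwd P.fwd.proj_coact

/-- A splitting `H ⟶ B ⟶ H` of the idempotent of a quantum group projection. -/
structure Splitting where
  B : C
  inc : B ⟶ H
  quo : H ⟶ B
  inc_quo : inc ≫ quo = 𝟙 B
  quo_inc : quo ≫ inc = P.idem

theorem nonempty_splitting [IsIdempotentComplete C] : Nonempty P.Splitting := by
  obtain ⟨B, inc, quo, h1, h2⟩ := IsIdempotentComplete.idempotents_split H P.idem P.idem_idem
  exact ⟨⟨B, inc, quo, h1, h2⟩⟩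

namespace Splitting

variable {P} (S : P.Splitting)

/-- The splitting of the projection of `H` onto `A` in `C`. -/
@[reducible]
def fwd : @HopfSplitting C _ _ _ A H S.B QA.hopf QH.hopf :=
  letI := QA.hopf
  letI := QH.hopf
  { P.fwd with
    inc := S.inc
    quo := S.quo
    inc_quo := S.inc_quo
    quo_inc := S.quo_inc }

/-- The splitting of the projection of `H̄` onto `Ā` in `C̄`. -/
@[reducible]
def bar : @HopfSplitting C _ _ (reverseBraiding C) A H S.B QA.barHopf QH.barHopf :=
  @HopfSplitting.mk C _ _ (reverseBraiding C) A H S.B QA.barHopf QH.barHopf P.bar S.inc S.quo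
    S.inc_quo (S.quo_inc.trans P.idempotent_eq)

/-- The right action of `A` on the coinvariants. -/
def act : S.B ⊗ A ⟶ S.B := S.B ◁ P.i ≫ S.inc ▷ H ≫ QH.mul ≫ S.quo

/-- The multiplication of the coinvariants. -/
def mul : S.B ⊗ S.B ⟶ S.B := (S.inc ⊗ₘ S.inc) ≫ QH.mul ≫ S.quo

/-- The unit of the coinvariants. -/
def one : 𝟙_ C ⟶ S.B := QH.one ≫ S.quo

/-- The counit of the coinvariants. -/
def counit : S.B ⟶ 𝟙_ C := S.inc ≫ QH.counit

/-- The comultiplication of the coinvariants of `H`. -/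
def comul : S.B ⟶ S.B ⊗ S.B := S.inc ≫ QH.comul ≫ (S.quo ⊗ₘ S.quo)

/-- The comultiplication of the coinvariants of `H̄`. -/
def comulBar : S.B ⟶ S.B ⊗ S.B := S.inc ≫ QH.comulBar ≫ (S.quo ⊗ₘ S.quo)

/-- The R-matrix of the coinvariants. -/
def R : 𝟙_ C ⟶ S.B ⊗ S.B := QH.R ≫ (S.quo ⊗ₘ S.quo)

/-- The antipode of the coinvariants of `H`. -/
def antipode : S.B ⟶ S.B :=
  @HopfSplitting.antipode C _ _ _ A H S.B QA.hopf QH.hopf S.fwd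

/-- The antipode of the coinvariants of `H̄`. -/
def antipodeBar : S.B ⟶ S.B :=
  @HopfSplitting.antipode C _ _ (reverseBraiding C) A H S.B QA.barHopf QH.barHopf S.bar

/-- The isomorphism of `H` with the tensor product of `A` and the coinvariants. -/
def iso : H ≅ A ⊗ S.B :=
  @HopfSplitting.iso C _ _ _ A H S.B QA.hopf QH.hopf S.fwd

/-- The inverse of the isomorphism only involves the multiplication, which `H` and `H̄` share. -/
theorem iso_eq_bar : S.iso =
    @HopfSplitting.iso C _ _ (reverseBraiding C) A H S.B QA.barHopf QH.barHopf S.bar :=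
  Iso.ext_inv rfl

/-- Both sides equal multiplication in `H` followed by the isomorphism with `A ⊗ B`, which is the
same for `H` and `H̄`. -/
theorem compatible : past QA.comul S.act = pastBar QA.comulBar S.act := by
  have h1 := @HopfSplitting.past_eq C _ _ _ A H S.B QA.hopf QH.hopf S.fwd
  have h2 := @HopfSplitting.past_eq C _ _ (reverseBraiding C) A H S.B QA.barHopf QH.barHopf S.bar
  rw [← iso_eq_bar] at h2
  exact h1.trans h2.symm

/-- The coinvariants, as an object of `C_{O(A, Ā)}`. -/
@[reducible]
def module : ModuleO QA where
  X := S.B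
  act := S.act
  act_one := @HopfSplitting.act_one C _ _ _ A H S.B QA.hopf QH.hopf S.fwd
  act_mul := @HopfSplitting.act_mul C _ _ _ A H S.B QA.hopf QH.hopf S.fwd
  compatible := S.compatible

/-- The data of the splitting which enter the construction of the R-matrix. -/
@[reducible]
def quasi : @QuasitriangularSplitting C _ _ _ A H S.B QA.hopf QH.hopf :=
  letI := QA.hopf
  letI := QH.hopf
  { S.fwd with
    comulBarA := QA.comulBar
    comulBar := QH.comulBar
    RA := QA.R
    R := QH.R
    i_comulBar := P.i_hom.comulBar
    comulBarA_counit := by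
      have h : QA.comulBar ≫ A ◁ QA.counit = (ρ_ A).inv := QA.barHopf.comul_counit
      change QA.comulBar ≫ (QA.counit ⊗ₘ QA.counit) = QA.counit ≫ _
      rw [MonoidalCategory.tensorHom_def', reassoc_of% h, ← rightUnitor_inv_naturality,
        unitors_inv_equal]
    inc_comulBar := @HopfSplitting.inc_coact C _ _ (reverseBraiding C) A H S.B QA.barHopf QH.barHopf
      S.bar
    quo_comulBar := @HopfSplitting.quo_comul C _ _ (reverseBraiding C) A H S.B QA.barHopf QH.barHopf
      S.bar
    comp_proj_bar := by
      intro f hf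
      have h := @HopfProjection.comp_proj_whiskerRight C _ _ (reverseBraiding C) A H
        QA.barHopf QH.barHopf P.bar _ _ f hf
      have h2 : @HopfProjection.proj C _ _ (reverseBraiding C) A H QA.barHopf QH.barHopf P.bar =
        HopfProjection.proj P.fwd := P.idempotent_eq.symm
      rw [h2] at h
      exact h
    R_comul_left := QH.R_comul_left
    R_comul_right := QH.R_comul_right
    R_counit_left := QH.R_counit_left
    R_counit_right := QH.R_counit_right
    RA_counit_left := QA.R_counit_left
    RA_counit_right := QA.R_counit_right
    quasitriangular := QH.quasitriangular
    R_right := P.R_right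
    R_left := P.R_left }

theorem coact_eq :
    @HopfSplitting.coactA C _ _ _ A H S.B QA.hopf QH.hopf S.fwd = S.module.coact :=
  @QuasitriangularSplitting.coactA_eq C _ _ _ A H S.B QA.hopf QH.hopf S.quasi

/-- The coaction of `Ā` on the coinvariants is induced by the inverse R-matrix of `A`. This is
`HopfSplitting.coactA_eq` in `C̄`, applied to the R-matrix `Ψ⁻¹ R⁻¹`, for which the two
comultiplications are interchanged. -/
theorem coactBar_eq :
    @HopfSplitting.coactA C _ _ (reverseBraiding C) A H S.B QA.barHopf QH.barHopf S.bar =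
      S.module.coactBar := by
  have hq := @quasitriangular_bar C _ _ _ H QH.hopf QH.comulBar QH.R QH.Rinv QH.quasitriangular
    QH.R_mul_Rinv QH.Rinv_mul_R
  have hp : QH.Rinv ≫ P.p ▷ H = QA.Rinv ≫ A ◁ P.i :=
    @HopfProjection.inverse_p C _ _ _ A H QA.hopf QH.hopf P.fwd QH.R QH.Rinv QA.R QA.Rinv
      P.R_left QH.Rinv_mul_R QA.R_mul_Rinv
  have hε : QA.Rinv ≫ A ◁ QA.counit = QA.one ≫ (ρ_ A).inv :=
    @inverse_counit C _ _ _ A QA.hopf QA.R QA.Rinv QA.R_counit_right QA.R_mul_Rinv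
  refine @HopfSplitting.coactA_eq C _ _ (reverseBraiding C) A H S.B QA.barHopf QH.barHopf S.bar
    QH.comul (QH.Rinv ≫ (β_ H H).inv) (QA.Rinv ≫ (β_ A A).inv) hq
    (@HopfSplitting.inc_coact C _ _ _ A H S.B QA.hopf QH.hopf S.fwd) ?_ ?_
  · change (QH.Rinv ≫ (β_ H H).inv) ≫ H ◁ P.p = (QA.Rinv ≫ (β_ A A).inv) ≫ P.i ▷ A
    rw [Category.assoc, ← BraidedCategory.braiding_inv_naturality_left, reassoc_of% hp,
      Category.assoc, BraidedCategory.braiding_inv_naturality_right]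
  · change (QA.Rinv ≫ (β_ A A).inv) ≫ QA.counit ▷ A = QA.one ≫ (λ_ A).inv
    rw [Category.assoc, ← BraidedCategory.braiding_inv_naturality_right, reassoc_of% hε]
    simp

theorem cross_eq : @HopfSplitting.cross C _ _ _ A H S.B QA.hopf QH.hopf S.fwd =
    (β_ S.module S.module).hom.hom :=
  congrArg (S.module.crossedBraid S.module (β_ S.B S.B).hom) S.coact_eq

theorem crossBar_eq :
    @HopfSplitting.cross C _ _ (reverseBraiding C) A H S.B QA.barHopf QH.barHopf S.bar =
      (β_ S.module S.module).inv.hom :=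
  congrArg (S.module.crossedBraid S.module (β_ S.B S.B).inv) S.coactBar_eq

/-- The coinvariants of `H`, as a Hopf algebra in `C_{O(A, Ā)}`. -/
@[reducible]
def hopf : HopfObj S.module where
  one := ⟨S.one, @HopfSplitting.one_linear C _ _ _ A H S.B QA.hopf QH.hopf S.fwd⟩
  mul := ⟨S.mul, @HopfSplitting.mul_linear C _ _ _ A H S.B QA.hopf QH.hopf S.fwd⟩
  counit := ⟨S.counit, @HopfSplitting.counit_linear C _ _ _ A H S.B QA.hopf QH.hopf S.fwd⟩
  comul := ⟨S.comul, @HopfSplitting.comul_linear C _ _ _ A H S.B QA.hopf QH.hopf S.fwd⟩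
  antipode :=
    ⟨S.antipode, @HopfSplitting.antipode_linear C _ _ _ A H S.B QA.hopf QH.hopf S.fwd⟩
  one_mul := ModuleO.hom_ext (@HopfSplitting.one_mul C _ _ _ A H S.B QA.hopf QH.hopf S.fwd)
  mul_one := ModuleO.hom_ext (@HopfSplitting.mul_one C _ _ _ A H S.B QA.hopf QH.hopf S.fwd)
  mul_assoc := ModuleO.hom_ext (@HopfSplitting.mul_assoc C _ _ _ A H S.B QA.hopf QH.hopf S.fwd)
  counit_comul :=
    ModuleO.hom_ext (@HopfSplitting.counit_comul C _ _ _ A H S.B QA.hopf QH.hopf S.fwd)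
  comul_counit :=
    ModuleO.hom_ext (@HopfSplitting.comul_counit C _ _ _ A H S.B QA.hopf QH.hopf S.fwd)
  comul_assoc :=
    ModuleO.hom_ext (@HopfSplitting.comul_assoc C _ _ _ A H S.B QA.hopf QH.hopf S.fwd)
  mul_comul := by
    have h := @HopfSplitting.mul_comul C _ _ _ A H S.B QA.hopf QH.hopf S.fwd
    rw [cross_eq] at h
    rw [tensorμ_comp]
    exact ModuleO.hom_ext h
  one_comul := ModuleO.hom_ext (@HopfSplitting.one_comul C _ _ _ A H S.B QA.hopf QH.hopf S.fwd)
  mul_counit := ModuleO.hom_ext (@HopfSplitting.mul_counit C _ _ _ A H S.B QA.hopf QH.hopf S.fwd)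
  one_counit := ModuleO.hom_ext (@HopfSplitting.one_counit C _ _ _ A H S.B QA.hopf QH.hopf S.fwd)
  antipode_left :=
    ModuleO.hom_ext (@HopfSplitting.antipode_left C _ _ _ A H S.B QA.hopf QH.hopf S.fwd)
  antipode_right :=
    ModuleO.hom_ext (@HopfSplitting.antipode_right C _ _ _ A H S.B QA.hopf QH.hopf S.fwd)

/-- The coinvariants of `H̄`, as a Hopf algebra in `C_{O(A, Ā)}` with the inverse braiding. -/
@[reducible]
def hopfBar : @HopfObj (ModuleO QA) _ _ (reverseBraiding (ModuleO QA)) S.module :=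
  @HopfObj.mk (ModuleO QA) _ _ (reverseBraiding (ModuleO QA)) S.module
    (@BimonObj.mk (ModuleO QA) _ _ (reverseBraiding (ModuleO QA)) S.module S.hopf.toMonObj
      { counit := S.hopf.counit
        comul := ⟨S.comulBar, by
          have h := @HopfSplitting.comul_linear C _ _ (reverseBraiding C) A H S.B QA.barHopf
            QH.barHopf S.bar
          change S.act ≫ S.comulBar = S.comulBar ▷ A ≫ diagAct QA.comul S.module.act S.module.act
          rw [ModuleO.diagAct_bar]
          exact h⟩
        counit_comul := ModuleO.hom_ext
          (@HopfSplitting.counit_comul C _ _ (reverseBraiding C) A H S.B QA.barHopf QH.barHopf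
            S.bar)
        comul_counit := ModuleO.hom_ext
          (@HopfSplitting.comul_counit C _ _ (reverseBraiding C) A H S.B QA.barHopf QH.barHopf
            S.bar)
        comul_assoc := ModuleO.hom_ext
          (@HopfSplitting.comul_assoc C _ _ (reverseBraiding C) A H S.B QA.barHopf QH.barHopf
            S.bar) }
      (by
        have h := @HopfSplitting.mul_comul C _ _ (reverseBraiding C) A H S.B QA.barHopf QH.barHopf
          S.bar
        rw [crossBar_eq] at h
        rw [@tensorμ_comp (ModuleO QA) _ _ (reverseBraiding (ModuleO QA))]
        exact ModuleO.hom_ext h)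
      (ModuleO.hom_ext (@HopfSplitting.one_comul C _ _ (reverseBraiding C) A H S.B QA.barHopf
        QH.barHopf S.bar))
      (ModuleO.hom_ext (@HopfSplitting.mul_counit C _ _ (reverseBraiding C) A H S.B QA.barHopf
        QH.barHopf S.bar))
      (ModuleO.hom_ext (@HopfSplitting.one_counit C _ _ (reverseBraiding C) A H S.B QA.barHopf
        QH.barHopf S.bar)))
    ⟨S.antipodeBar, @HopfSplitting.antipode_linear C _ _ (reverseBraiding C) A H S.B QA.barHopf
      QH.barHopf S.bar⟩
    (ModuleO.hom_ext (@HopfSplitting.antipode_left C _ _ (reverseBraiding C) A H S.B QA.barHopf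
      QH.barHopf S.bar))
    (ModuleO.hom_ext (@HopfSplitting.antipode_right C _ _ (reverseBraiding C) A H S.B QA.barHopf
      QH.barHopf S.bar))

/-- The R-matrix of the coinvariants, as a morphism in `C_{O(A, Ā)}`. -/
@[reducible]
def RHom : 𝟙_ (ModuleO QA) ⟶ S.module ⊗ S.module :=
  ⟨S.R, @QuasitriangularSplitting.RB_linear C _ _ _ A H S.B QA.hopf QH.hopf S.quasi⟩

theorem RHom_comul_right : S.RHom ≫ S.module ◁ S.hopf.comul =
    nest S.RHom S.RHom S.hopf.mul (𝟙 (S.module ⊗ S.module)) :=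
  ModuleO.hom_ext
    (@QuasitriangularSplitting.RB_comul_right C _ _ _ A H S.B QA.hopf QH.hopf S.quasi)

theorem RHom_counit_right : S.RHom ≫ S.module ◁ S.hopf.counit =
    S.hopf.one ≫ (ρ_ S.module).inv :=
  ModuleO.hom_ext
    (@QuasitriangularSplitting.RB_counit_right C _ _ _ A H S.B QA.hopf QH.hopf S.quasi)

theorem isIso_antipode : IsIso S.hopf.antipode := by
  let _ := QA.hopf
  let _ := QH.hopf
  have _ : IsIso 𝒮[A] := QA.isIso_antipode
  have _ : IsIso 𝒮[H] := QH.isIso_antipode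
  have _ : IsIso S.antipode := S.fwd.isIso_antipode
  exact (ModuleO.mkIso (M := S.module) (N := S.module) (asIso S.antipode)
    S.hopf.antipode.linear).isIso_hom

theorem isIso_antipodeBar : IsIso S.hopfBar.antipode := by
  have _ : IsIso S.antipodeBar :=
    @HopfSplitting.isIso_antipode C _ _ (reverseBraiding C) A H S.B QA.barHopf QH.barHopf S.bar
      QA.isIso_antipode_bar QH.isIso_antipode_bar
  exact (ModuleO.mkIso (M := S.module) (N := S.module) (asIso S.antipodeBar)
    S.hopfBar.antipode.linear).isIso_hom

/-- The coinvariants, as a quasitriangular Hopf algebra in `C_{O(A, Ā)}`. The inverse of the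
R-matrix is obtained by applying the inverse antipode to its second leg. -/
@[reducible]
noncomputable def quantumGroup : QuantumGroup S.module where
  hopf := S.hopf
  hopfBar := S.hopfBar
  mul_bar := rfl
  one_bar := rfl
  counit_bar := rfl
  isIso_antipode := S.isIso_antipode
  isIso_antipode_bar := S.isIso_antipodeBar
  R := S.RHom
  Rinv := S.RHom ≫ S.module ◁ @inv _ _ _ _ S.hopf.antipode S.isIso_antipode
  R_comul_left := by
    have h := @QuasitriangularSplitting.RB_comul_left C _ _ _ A H S.B QA.hopf QH.hopf S.quasi
    rw [cross_eq] at h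
    exact (comul_left_iff _ _ _).2 (ModuleO.hom_ext h)
  R_comul_right := S.RHom_comul_right
  R_counit_left := ModuleO.hom_ext
    (@QuasitriangularSplitting.RB_counit_left C _ _ _ A H S.B QA.hopf QH.hopf S.quasi)
  R_counit_right := S.RHom_counit_right
  R_mul_Rinv := @R_mul_inv_antipode _ _ _ _ _ S.hopf S.isIso_antipode _ S.RHom_comul_right
    S.RHom_counit_right
  Rinv_mul_R := @inv_antipode_mul_R _ _ _ _ _ S.hopf S.isIso_antipode _ S.RHom_comul_right
    S.RHom_counit_right
  quasitriangular := by
    have h := @QuasitriangularSplitting.RB_quasitriangular C _ _ _ A H S.B QA.hopf QH.hopf S.quasi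
    rw [cross_eq] at h
    rw [convMul, convMul, tensorμ_comp]
    exact ModuleO.hom_ext h

/-! ### Comparison with the bosonization -/

theorem inclA_iso_inv : Bosonization.inclA S.quantumGroup ≫ S.iso.inv = P.i := by
  rw [Iso.comp_inv_eq]
  exact (@HopfSplitting.i_iso_hom C _ _ _ A H S.B QA.hopf QH.hopf S.fwd).symm

theorem inclB_iso_inv : Bosonization.inclB (M := S.module) ≫ S.iso.inv = S.inc := by
  let _ := QH.hopf
  have h1 : QA.one ≫ P.i = η[H] := P.i_hom.one
  change ((λ_ S.B).inv ≫ QA.one ▷ S.B) ≫ (P.i ⊗ₘ S.inc) ≫ μ[H] = _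
  rw [MonoidalCategory.tensorHom_def, Category.assoc, Category.assoc,
    ← comp_whiskerRight_assoc, h1, ← whisker_exchange_assoc, MonObj.one_mul,
    leftUnitor_naturality, Iso.inv_hom_id_assoc]

theorem mul_iso_inv : Bosonization.mul S.quantumGroup ≫ S.iso.inv =
    (S.iso.inv ⊗ₘ S.iso.inv) ≫ QH.mul := by
  have h := @HopfSplitting.iso_inv_mul C _ _ _ A H S.B QA.hopf QH.hopf S.fwd
  rw [Bosonization.mul, Category.assoc]
  exact h

/-- The R-matrix of `H` is that of the bosonization. -/
theorem R_iso_inv : Bosonization.R S.quantumGroup ≫ (S.iso.inv ⊗ₘ S.iso.inv) = QH.R := by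
  rw [Bosonization.R, nest_comp, Category.assoc, Category.assoc, mul_iso_inv,
    tensorHom_comp_tensorHom_assoc, tensorHom_comp_tensorHom_assoc, inclA_iso_inv, inclB_iso_inv]
  exact (@QuasitriangularSplitting.R_eq C _ _ _ A H S.B QA.hopf QH.hopf S.quasi).symm

theorem isBialgHom : QH.toQTData.IsBialgHom (Bosonization.data S.quantumGroup) S.iso.hom where
  mul := by
    rw [← cancel_mono S.iso.inv]
    simp only [Category.assoc, Iso.hom_inv_id, Category.comp_id]
    change QH.mul = _ ≫ Bosonization.mul S.quantumGroup ≫ _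
    rw [mul_iso_inv, tensorHom_comp_tensorHom_assoc]
    simp
  one := by
    rw [← Iso.eq_comp_inv]
    exact (@HopfSplitting.one_iso_inv C _ _ _ A H S.B QA.hopf QH.hopf S.fwd).symm
  comul := by
    have h := @HopfSplitting.iso_inv_comul C _ _ _ A H S.B QA.hopf QH.hopf S.fwd
    rw [coact_eq] at h
    have h1 : S.iso.inv ≫ QH.toQTData.comul =
        (Bosonization.data S.quantumGroup).comul ≫ (S.iso.inv ⊗ₘ S.iso.inv) :=
      h.trans (Category.assoc _ _ _).symm
    rw [← Iso.eq_inv_comp, ← Category.assoc, h1]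
    simp
  comulBar := by
    have h := @HopfSplitting.iso_inv_comul C _ _ (reverseBraiding C) A H S.B QA.barHopf QH.barHopf
      S.bar
    rw [coactBar_eq, ← iso_eq_bar] at h
    have h1 : S.iso.inv ≫ QH.toQTData.comulBar =
        (Bosonization.data S.quantumGroup).comulBar ≫ (S.iso.inv ⊗ₘ S.iso.inv) :=
      h.trans (Category.assoc _ _ _).symm
    rw [← Iso.eq_inv_comp, ← Category.assoc, h1]
    simp
  counit := by
    rw [← Iso.eq_inv_comp]
    exact (@HopfSplitting.iso_inv_counit C _ _ _ A H S.B QA.hopf QH.hopf S.fwd).symm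

end Splitting

end QuantumGroupProjection

end BraidedQG

theorem mainTheorem6 {C : Type u} [Category.{v} C] [MonoidalCategory C] [BraidedCategory C]
    [IsIdempotentComplete C] {A H : C}
    (QA : BraidedQG.QuantumGroup A) (QH : BraidedQG.QuantumGroup H)
    (P : BraidedQG.QuantumGroupProjection QA QH) :
    ∃ (B : BraidedQG.ModuleO QA) (QB : BraidedQG.QuantumGroup B) (φ : H ≅ A ⊗ B.X),
      QH.toQTData.IsBialgHom (BraidedQG.Bosonization.data QB) φ.hom ∧
      QH.R ≫ (φ.hom ⊗ₘ φ.hom) = (BraidedQG.Bosonization.data QB).R ∧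
      P.i ≫ φ.hom = BraidedQG.Bosonization.inclA QB ∧
      φ.hom ≫ BraidedQG.Bosonization.projA QB = P.p := by
  obtain ⟨S⟩ := P.nonempty_splitting
  refine ⟨S.module, S.quantumGroup, S.iso, S.isBialgHom, ?_, ?_, ?_⟩
  · rw [← S.R_iso_inv, Category.assoc, tensorHom_comp_tensorHom, Iso.inv_hom_id, id_tensorHom_id,
      Category.comp_id]
    rfl
  · rw [← S.inclA_iso_inv, Category.assoc, Iso.inv_hom_id, Category.comp_id]
  · exact @BraidedQG.HopfSplitting.iso_hom_counit C _ _ _ A H S.B QA.hopf QH.hopf S.fwd
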